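/- Let $1<\alpha<2$, let $E,A\in\mathbb{R}^{n\times n}$ with $\operatorname{rank}E=r$, and let $E_0\in\mathbb{R}^{n\times(n-r)}$ be any matrix of full column rank with $E^{T}E_0=0$. Put $$\Theta=\begin{bmatrix}\sin\frac{\pi}{2}\alpha & -\cos\frac{\pi}{2}\alpha\\ \cos\frac{\pi}{2}\alpha & \sin\frac{\pi}{2}\alpha\end{bmatrix},\qquad \operatorname{Sym}(M)=M+M^{T},$$ let $I$ be the $2\times 2$ identity matrix, let $\otimes$ be the Kronecker product, and write $M<0$ (resp. $M>0$, $M\ge 0$) for "symmetric and negative definite (resp. positive definite, positive semidefinite)". Let $D^{\alpha}x(t)=\frac{1}{\Gamma(2-\alpha)}\int_0^t(t-\tau)^{1-\alpha}x''(\tau)\,d\tau$ be the Caputo derivative. The system $(E,A,\alpha)$, that is, $E D^{\alpha}x(t)=Ax(t)$, is called *admissible* if it is regular, impulse-free and stable in the following sense. A solution of $ED^{\alpha}x=Ax+g$ is a function $x$ that is $C^1$ on $[0,\infty)$ and $C^2$ on $(0,\infty)$, whose second derivative is integrable on $(0,T)$ for every $T>0$, and that satisfies the equation for every $t>0$. *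 *Regular*: for every $C^\infty$ function $g:\mathbb{R}\to\mathbb{R}^n$ with $g(t)=0$ for $t\le 0$, the equation $ED^{\alpha}x=Ax+g$ has a solution, and two solutions with the same initial data $x(0),x'(0)$ coincide on $[0,\infty)$. * *Impulse-free*: for arbitrary initial data $x_0,x_1\in\mathbb{R}^n$ the response of $ED^{\alpha}x=Ax$ contains no impulsive term, i.e. it is an ordinary function: there is $x$, integrable on $(0,T)$ for every $T>0$, with $Ex(t)=E(x_0+tx_1)+\frac{1}{\Gamma(\alpha)}\int_0^t(t-\tau)^{\alpha-1}Ax(\tau)\,d\tau$ for almost every $t>0$. * *Stable*: for every admissible initial value $x_0$ (one from which some solution of $ED^{\alpha}x=Ax$ starts), every solution of $ED^{\alpha}x=Ax$ with $x(0)=x_0$ satisfies $\lim_{t\to\infty}\|x(t)\|=0$. Then the following statements are equivalent: 1. the system $(E,A,\alpha)$ is admissible; 2. there exist a matrix $P\in\mathbb{R}^{n\times n}$, $P>0$, and a matrix $Q\in\mathbb{R}^{(n-r)\times n}$ such that $$\operatorname{Sym}\{\Theta\otimes(E^{T}PA)+I\otimes(Q^{T}E_0^{T}A)\}<0;$$ 3.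 there exists a matrix $P\in\mathbb{R}^{n\times n}$ such that $$\operatorname{Sym}\{\Theta\otimes(PA)\}<0,\qquad PE=E^{T}P^{T}\ge 0;$$ 4. there exist a matrix $P\in\mathbb{R}^{n\times n}$, $P>0$, and a symmetric matrix $Q\in\mathbb{R}^{n\times n}$ such that $$\operatorname{Sym}\{\Theta\otimes(E^{T}PA)\}+I\otimes(A^{T}QA)<0,\qquad E^{T}QE\ge 0.$$ -/

import Mathlib

open scoped Kronecker

namespace SFOS

/-- The Caputo derivative of order `1 < α < 2` with base point `0`:
`(1 / Γ(2 - α)) ∫₀ᵗ (t - τ)^(1 - α) x''(τ) dτ`. -/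
noncomputable def caputoDeriv {n : ℕ} (α : ℝ) (x : ℝ → Fin n → ℝ) (t : ℝ) : Fin n → ℝ :=
  (Real.Gamma (2 - α))⁻¹ • ∫ τ in (0 : ℝ)..t, (t - τ) ^ (1 - α) • iteratedDeriv 2 x τ

/-- The Riemann-Liouville fractional integral of order `α` with base point `0`:
`(1 / Γ(α)) ∫₀ᵗ (t - τ)^(α - 1) f(τ) dτ`. -/
noncomputable def fracIntegral {n : ℕ} (α : ℝ) (f : ℝ → Fin n → ℝ) (t : ℝ) : Fin n → ℝ :=
  (Real.Gamma α)⁻¹ • ∫ τ in (0 : ℝ)..t, (t - τ) ^ (α - 1) • f τ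

/-- `x` is a solution on `[0, ∞)` of `E D^α x = A x + g`, `D^α` being the Caputo derivative. Only
the values of `x` on `[0, ∞)` matter. As usual for `1 < α < 2`, the second derivative exists on
`(0, ∞)` and may have an integrable singularity at `0`. -/
structure IsSolution {n : ℕ} (E A : Matrix (Fin n) (Fin n) ℝ) (α : ℝ)
    (g x : ℝ → Fin n → ℝ) : Prop where
  contDiffOn_one : ContDiffOn ℝ 1 x (Set.Ici 0)
  contDiffOn_two : ContDiffOn ℝ 2 x (Set.Ioi 0)
  integrable : ∀ T : ℝ, 0 < T →
    MeasureTheory.IntegrableOn (iteratedDeriv 2 x) (Set.Ioc 0 T)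
  equation : ∀ t : ℝ, 0 < t → E.mulVec (caputoDeriv α x t) = A.mulVec (x t) + g t

/-- Regularity, in the time domain: for every smooth forcing term `g` that starts from rest at
`t = 0`, the system `E D^α x = A x + g` has a solution, and a solution is determined by its
initial data `x(0)`, `x'(0)`. -/
def Regular {n : ℕ} (E A : Matrix (Fin n) (Fin n) ℝ) (α : ℝ) : Prop :=
  ∀ g : ℝ → Fin n → ℝ, ContDiff ℝ ((⊤ : ℕ∞) : WithTop ℕ∞) g → (∀ t ≤ 0, g t = 0) →
    (∃ x, IsSolution E A α g x) ∧
    ∀ x y, IsSolution E A α g x → IsSolution E A α g y →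
      x 0 = y 0 → derivWithin x (Set.Ici 0) 0 = derivWithin y (Set.Ici 0) 0 →
      Set.EqOn x y (Set.Ici 0)

/-- The locally integrable function `x` is the response of `E D^α x = A x` to the arbitrary
(possibly inconsistent) initial data `x(0) = x₀`, `x'(0) = x₁`: the equation holds in the
`α`-fold integrated form `E x(t) = E (x₀ + t x₁) + I^α (A x)(t)`. In terms of Laplace transforms
this reads `s^α E X(s) - s^(α-1) E x₀ - s^(α-2) E x₁ = A X(s)`. -/
structure IsFunctionResponse {n : ℕ} (E A : Matrix (Fin n) (Fin n) ℝ) (α : ℝ)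
    (x₀ x₁ : Fin n → ℝ) (x : ℝ → Fin n → ℝ) : Prop where
  integrable : ∀ T : ℝ, 0 < T → MeasureTheory.IntegrableOn x (Set.Ioc 0 T)
  equation : ∀ᵐ t ∂(MeasureTheory.volume.restrict (Set.Ioi (0 : ℝ))),
    E.mulVec (x t) = E.mulVec (x₀ + t • x₁) + fracIntegral α (fun τ => A.mulVec (x τ)) t

/-- Freedom from impulses: for arbitrary initial data the response, in general a distribution on
`[0, ∞)` (with impulsive terms such as the finite part of `t^(-α)`), is an ordinary locally
integrable function. -/
def ImpulseFree {n : ℕ} (E A : Matrix (Fin n) (Fin n) ℝ) (α : ℝ) : Prop :=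
  ∀ x₀ x₁ : Fin n → ℝ, ∃ x, IsFunctionResponse E A α x₀ x₁ x

/-- The initial value `x₀` is admissible if a solution of the autonomous system, continuous up to
`t = 0`, starts from it. -/
def AdmissibleInitial {n : ℕ} (E A : Matrix (Fin n) (Fin n) ℝ) (α : ℝ) (x₀ : Fin n → ℝ) : Prop :=
  ∃ x, IsSolution E A α 0 x ∧ x 0 = x₀

/-- Asymptotic stability: from every admissible initial value, every solution of the autonomous
system tends to zero. -/
def Stable {n : ℕ} (E A : Matrix (Fin n) (Fin n) ℝ) (α : ℝ) : Prop :=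
  ∀ x₀, AdmissibleInitial E A α x₀ → ∀ x, IsSolution E A α 0 x → x 0 = x₀ →
    Filter.Tendsto (fun t => ‖x t‖) Filter.atTop (nhds 0)

/-- The system `E D^α x = A x` is admissible: regular, impulse-free and stable. -/
def Admissible {n : ℕ} (E A : Matrix (Fin n) (Fin n) ℝ) (α : ℝ) : Prop :=
  Regular E A α ∧ ImpulseFree E A α ∧ Stable E A α

/-- `Sym(M) = M + Mᵀ` for a real matrix `M`. -/
def sym {ι : Type*} (M : Matrix ι ι ℝ) : Matrix ι ι ℝ := M + M.transpose

/-- `M < 0`: the matrix `M` is (symmetric and) negative definite. -/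
def NegDef {ι : Type*} (M : Matrix ι ι ℝ) : Prop := (-M).PosDef

/-- The `2 × 2` matrix `Θ`. -/
noncomputable def theta (α : ℝ) : Matrix (Fin 2) (Fin 2) ℝ :=
  !![Real.sin (Real.pi / 2 * α), -Real.cos (Real.pi / 2 * α);
     Real.cos (Real.pi / 2 * α), Real.sin (Real.pi / 2 * α)]

end SFOS

/-! ### Quadratic forms of the matrix inequalities; each inequality forces the spectral condition -/

namespace SFOS

open Matrix

/-! All four statements are compared with one spectral condition, `SpectrallyAdmissible`: the pencil
`μ E - A` is nonsingular on the closed sector `|arg μ| ≤ απ/2` and has index at most one.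

Write `s = sin(πα/2)`, `c = cos(πα/2)`, `v = a + i b`. The form of `Θ ⊗ X` at `(a, b)` is `s Re(v* X
v) - c Im(v* X v)`, so the inequalities are Lyapunov inequalities for a rotated half plane; since
the data are real, conjugation covers the other half plane of the sector. If `M E ≥ 0` and `μ E v =
A v`, then `v* M A v = μ v* M E v`, which has the wrong sign when `μ` lies in the sector. A nonzero
`v` with `E v = 0` and `A v = E w` makes the form of `M A` vanish, which excludes a higher index
(`spectrallyAdmissible_of_quad_neg`).

Conversely, `0` lies in the sector, so `A` is invertible, and `K = A⁻¹ E` has a group inverse `B`,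
with projection `J = K B`. The matrix `C = B - (1 - J)` carries the finite eigenvalues of the
pencil, and `-1` on the kernel of `K`, hence has no eigenvalue in the sector. Triangularization with
rescaled coordinates yields a Lyapunov matrix for `C` (`exists_posDef_quad_neg`), from which
solutions of all three inequalities are written down (`SpectrallyAdmissible.lmis`).

On the analytic side, the equation splits along `J` into a purely algebraic part and `D^α y = C y +
F`, a Volterra equation; this gives regularity and freedom from impulses. Decay comes from Laplace
inversion: `s ↦ s^α` maps the closed right half plane into the sector, where the resolvent of `C` is
controlled, and the Riemann-Lebesgue lemma applies on the imaginary axis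
(`tendsto_zero_of_volterra`). For the converse, a higher index yields a functional incompatible with
solvability and function responses (`index_le_one_of_regular_impulseFree`), while an eigenvalue in
the sector yields a non-decaying solution, detected by an Abelian argument on its Laplace transform
(`not_tendsto_zero_of_mem_sector`). -/

/-- The closed sector `|arg μ| ≤ απ/2`, as a union of two half planes. -/
def sector (α : ℝ) : Set ℂ :=
  {μ | 0 ≤ Real.sin (Real.pi / 2 * α) * μ.re - Real.cos (Real.pi / 2 * α) * μ.im ∨
    0 ≤ Real.sin (Real.pi / 2 * α) * μ.re + Real.cos (Real.pi / 2 * α) * μ.im}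

/-- The quadratic form of `Θ ⊗ X` at the vector with blocks `a` and `b`. -/
noncomputable def quad {n : ℕ} (α : ℝ) (X : Matrix (Fin n) (Fin n) ℝ) (a b : Fin n → ℝ) : ℝ :=
  Real.sin (Real.pi / 2 * α) * (a ⬝ᵥ X *ᵥ a + b ⬝ᵥ X *ᵥ b) -
    Real.cos (Real.pi / 2 * α) * (a ⬝ᵥ X *ᵥ b - b ⬝ᵥ X *ᵥ a)

/-- The pencil `μ E - A` has index at most one and no eigenvalue in the sector. -/
structure SpectrallyAdmissible {n : ℕ} (E A : Matrix (Fin n) (Fin n) ℝ) (α : ℝ) : Prop where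
  index_le_one : ∀ v w, E *ᵥ v = 0 → A *ᵥ v = E *ᵥ w → v = 0
  det_ne_zero : ∀ μ ∈ sector α,
    (μ • E.map ((↑) : ℝ → ℂ) - A.map ((↑) : ℝ → ℂ)).det ≠ 0

lemma sin_pos_of_order {α : ℝ} (h₁ : 1 < α) (h₂ : α < 2) : 0 < Real.sin (Real.pi / 2 * α) := by
  apply Real.sin_pos_of_pos_of_lt_pi <;> nlinarith [Real.pi_pos]

lemma dotProduct_sym_mulVec {ι : Type*} [Fintype ι] (M : Matrix ι ι ℝ) (z : ι → ℝ) :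
    z ⬝ᵥ sym M *ᵥ z = 2 * (z ⬝ᵥ M *ᵥ z) := by
  rw [sym, add_mulVec, dotProduct_add, two_mul]
  congr 1
  rw [dotProduct_mulVec, vecMul_transpose, dotProduct_comm]

lemma dotProduct_kronecker_mulVec {n : ℕ} (T : Matrix (Fin 2) (Fin 2) ℝ)
    (X : Matrix (Fin n) (Fin n) ℝ) (z : Fin 2 × Fin n → ℝ) :
    z ⬝ᵥ (T ⊗ₖ X) *ᵥ z =
      ∑ i, ∑ j, T i j * ((fun k => z (i, k)) ⬝ᵥ X *ᵥ (fun k => z (j, k))) := by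
  simp only [dotProduct, mulVec, Fintype.sum_prod_type, kroneckerMap_apply, Finset.mul_sum]
  refine Finset.sum_congr rfl fun i _ => ?_
  rw [Finset.sum_comm]
  refine Finset.sum_congr rfl fun j _ => Finset.sum_congr rfl fun k _ =>
    Finset.sum_congr rfl fun l _ => by ring

lemma dotProduct_theta_kronecker {n : ℕ} (α : ℝ) (X : Matrix (Fin n) (Fin n) ℝ)
    (z : Fin 2 × Fin n → ℝ) :
    z ⬝ᵥ (theta α ⊗ₖ X) *ᵥ z = quad α X (fun k => z (0, k)) (fun k => z (1, k)) := by
  rw [dotProduct_kronecker_mulVec]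
  simp [Fin.sum_univ_two, theta, quad]
  ring

/-- The separate block `S` makes one criterion serve all three inequalities: `S` is `0`, a
symmetrized `Qᵀ E₀ᵀ A`, or `Aᵀ Q A`. -/
lemma negDef_iff {n : ℕ} (α : ℝ) (X S : Matrix (Fin n) (Fin n) ℝ) (hS : S.IsSymm) :
    NegDef (sym (theta α ⊗ₖ X) + (1 : Matrix (Fin 2) (Fin 2) ℝ) ⊗ₖ S) ↔
      ∀ a b : Fin n → ℝ, (a ≠ 0 ∨ b ≠ 0) →
        2 * quad α X a b + a ⬝ᵥ S *ᵥ a + b ⬝ᵥ S *ᵥ b < 0 := by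
  have hform : ∀ z : Fin 2 × Fin n → ℝ,
      z ⬝ᵥ (sym (theta α ⊗ₖ X) + (1 : Matrix (Fin 2) (Fin 2) ℝ) ⊗ₖ S) *ᵥ z =
        2 * quad α X (fun k => z (0, k)) (fun k => z (1, k)) +
          (fun k => z (0, k)) ⬝ᵥ S *ᵥ (fun k => z (0, k)) +
          (fun k => z (1, k)) ⬝ᵥ S *ᵥ (fun k => z (1, k)) := by
    intro z
    rw [add_mulVec, dotProduct_add, dotProduct_sym_mulVec, dotProduct_theta_kronecker,
      dotProduct_kronecker_mulVec]
    simp [Fin.sum_univ_two]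
    ring
  rw [NegDef, posDef_iff_dotProduct_mulVec]
  constructor
  · rintro ⟨-, h⟩ a b hab
    have := @h (fun p => ![a, b] p.1 p.2) (by
      intro h0
      rcases hab with h' | h'
      · exact h' (funext fun k => by simpa using congrFun h0 (0, k))
      · exact h' (funext fun k => by simpa using congrFun h0 (1, k)))
    rw [neg_mulVec, dotProduct_neg, star_trivial, hform, neg_pos] at this
    exact this
  · intro h
    refine ⟨?_, fun z hz => ?_⟩
    · have h1 : ((1 : Matrix (Fin 2) (Fin 2) ℝ) ⊗ₖ S)ᵀ = (1 : Matrix (Fin 2) (Fin 2) ℝ) ⊗ₖ S := by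
        rw [← kroneckerMap_transpose, transpose_one, hS]
      rw [IsHermitian, conjTranspose_eq_transpose_of_trivial, transpose_neg, transpose_add, h1,
        sym, transpose_add, transpose_transpose, add_comm (theta α ⊗ₖ X)]
    · rw [neg_mulVec, dotProduct_neg, star_trivial, hform, neg_pos]
      refine h _ _ ?_
      by_contra! h0
      refine hz (funext fun p => ?_)
      obtain ⟨i, k⟩ := p
      fin_cases i
      · exact congrFun h0.1 k
      · exact congrFun h0.2 k

lemma sym_theta_add {n : ℕ} (α : ℝ) (X Y : Matrix (Fin n) (Fin n) ℝ) :
    sym (theta α ⊗ₖ X + (1 : Matrix (Fin 2) (Fin 2) ℝ) ⊗ₖ Y) =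
      sym (theta α ⊗ₖ X) + (1 : Matrix (Fin 2) (Fin 2) ℝ) ⊗ₖ sym Y := by
  simp only [sym, transpose_add, kronecker_add]
  rw [← kroneckerMap_transpose (f := (· * ·)) (1 : Matrix (Fin 2) (Fin 2) ℝ) Y, transpose_one]
  abel

lemma isSymm_sym {ι : Type*} (M : Matrix ι ι ℝ) : (sym M).IsSymm := by
  rw [IsSymm, sym, transpose_add, transpose_transpose, add_comm]

/-- A singular value of the pencil in the sector has a real pair of eigenvector components. -/
lemma exists_real_eigenpair {n : ℕ} {E A : Matrix (Fin n) (Fin n) ℝ} {α : ℝ} {μ : ℂ}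
    (hμ : μ ∈ sector α) (hdet : (μ • E.map ((↑) : ℝ → ℂ) - A.map ((↑) : ℝ → ℂ)).det = 0) :
    ∃ (a b : Fin n → ℝ) (p q : ℝ), (a ≠ 0 ∨ b ≠ 0) ∧
      0 ≤ Real.sin (Real.pi / 2 * α) * p - Real.cos (Real.pi / 2 * α) * q ∧
      A *ᵥ a = p • E *ᵥ a - q • E *ᵥ b ∧ A *ᵥ b = q • E *ᵥ a + p • E *ᵥ b := by
  obtain ⟨v, hv, h⟩ := exists_mulVec_eq_zero_iff.mpr hdet
  rw [sub_mulVec, smul_mulVec, sub_eq_zero] at h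
  have hmv : ∀ (M : Matrix (Fin n) (Fin n) ℝ) i,
      (M.map ((↑) : ℝ → ℂ) *ᵥ v) i = ((M *ᵥ fun j => (v j).re) i : ℝ) +
        ((M *ᵥ fun j => (v j).im) i : ℝ) * Complex.I := by
    intro M i
    apply Complex.ext <;> simp [mulVec, dotProduct]
  have hre : ∀ i, (A *ᵥ fun j => (v j).re) i =
      μ.re * (E *ᵥ fun j => (v j).re) i - μ.im * (E *ᵥ fun j => (v j).im) i := by
    intro i
    have := congrArg Complex.re (congrFun h i)
    simpa [hmv] using this.symm
  have him : ∀ i, (A *ᵥ fun j => (v j).im) i =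
      μ.im * (E *ᵥ fun j => (v j).re) i + μ.re * (E *ᵥ fun j => (v j).im) i := by
    intro i
    have := congrArg Complex.im (congrFun h i)
    simp [hmv] at this
    linarith
  have hne : (fun j => (v j).re) ≠ 0 ∨ (fun j => (v j).im) ≠ 0 := by
    by_contra! h0
    exact hv (funext fun j => Complex.ext (congrFun h0.1 j) (congrFun h0.2 j))
  -- In the second half plane the conjugate eigenvector and eigenvalue are used, so that only the
  -- first sign condition has to be recorded.
  rcases hμ with hμ | hμ
  · exact ⟨_, _, μ.re, μ.im, hne, hμ, funext fun i => by simpa using hre i,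
      funext fun i => by simpa using him i⟩
  · refine ⟨fun j => (v j).re, -fun j => (v j).im, μ.re, -μ.im, ?_, by linarith,
      funext fun i => ?_, funext fun i => ?_⟩
    · simpa [neg_eq_zero] using hne
    · simpa [mulVec_neg] using hre i
    · simp [mulVec_neg, him i]
      ring

/-- With `v = a + i b` and `μ = p + i q` the hypotheses say `A v = μ E v`, so `v* M A v = μ v* M E
v`; the last factor is real by symmetry of `M E`. -/
lemma quad_of_eigenpair {n : ℕ} {E A M : Matrix (Fin n) (Fin n) ℝ} {α p q : ℝ}
    {a b : Fin n → ℝ} (ha : A *ᵥ a = p • E *ᵥ a - q • E *ᵥ b)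
    (hb : A *ᵥ b = q • E *ᵥ a + p • E *ᵥ b) (hM : (M * E).IsSymm) :
    quad α (M * A) a b = (Real.sin (Real.pi / 2 * α) * p - Real.cos (Real.pi / 2 * α) * q) *
      (a ⬝ᵥ (M * E) *ᵥ a + b ⬝ᵥ (M * E) *ᵥ b) := by
  have hsym : b ⬝ᵥ M *ᵥ E *ᵥ a = a ⬝ᵥ M *ᵥ E *ᵥ b := by
    rw [mulVec_mulVec, mulVec_mulVec, dotProduct_mulVec, ← mulVec_transpose, hM, dotProduct_comm]
  simp only [quad, ← mulVec_mulVec, ha, hb, mulVec_sub, mulVec_add, mulVec_smul, dotProduct_sub,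
    dotProduct_add, dotProduct_smul, smul_eq_mul, hsym]
  ring

/-- A matrix inequality of the considered kind forces spectral admissibility. -/
lemma spectrallyAdmissible_of_quad_neg {n : ℕ} {E A M S : Matrix (Fin n) (Fin n) ℝ} {α : ℝ}
    (hM : (M * E).PosSemidef)
    (hneg : ∀ a b : Fin n → ℝ, (a ≠ 0 ∨ b ≠ 0) →
      2 * quad α (M * A) a b + a ⬝ᵥ S *ᵥ a + b ⬝ᵥ S *ᵥ b < 0)
    (hS : ∀ (v w : Fin n → ℝ), A *ᵥ v = E *ᵥ w → 0 ≤ v ⬝ᵥ S *ᵥ v) :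
    SpectrallyAdmissible E A α := by
  have hMs : (M * E).IsSymm := by
    rw [IsSymm, ← conjTranspose_eq_transpose_of_trivial]
    exact hM.isHermitian
  have hM0 : ∀ v, 0 ≤ v ⬝ᵥ (M * E) *ᵥ v := fun v => by
    simpa using hM.dotProduct_mulVec_nonneg v
  refine ⟨fun v w hv hw => ?_, fun μ hμ hdet => ?_⟩
  -- A kernel vector violating the index condition has `v · M A v = v · M E w = w · M E v = 0`, so
  -- the form is nonnegative at `(v, 0)`.
  · by_contra h0
    have h1 := hneg v 0 (Or.inl h0)
    have h2 : v ⬝ᵥ (M * A) *ᵥ v = 0 := by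
      rw [← mulVec_mulVec, hw, mulVec_mulVec, dotProduct_mulVec, ← mulVec_transpose, hMs,
        ← mulVec_mulVec, hv]
      simp
    have := hS v w hw
    simp only [quad, h2] at h1
    simp at h1
    linarith
  · obtain ⟨a, b, p, q, hab, hpq, ha, hb⟩ := exists_real_eigenpair hμ hdet
    have h1 := hneg a b hab
    rw [quad_of_eigenpair ha hb hMs] at h1
    -- Both `A a` and `A b` lie in the range of `E`, which is where `S` is known to be nonnegative.
    have ha' := hS a (p • a - q • b) (by simpa [mulVec_sub, mulVec_smul] using ha)
    have hb' := hS b (q • a + p • b) (by simpa [mulVec_add, mulVec_smul] using hb)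
    have := mul_nonneg hpq (add_nonneg (hM0 a) (hM0 b))
    linarith

/-- The multiplier is `M = Eᵀ P`, and the `Q`-term vanishes wherever `A v` lies in the range of `E`,
because `E₀ᵀ E = 0`. -/
lemma spectrallyAdmissible_of_lmi_two {n m : ℕ} {E A P : Matrix (Fin n) (Fin n) ℝ} {α : ℝ}
    {E₀ : Matrix (Fin n) (Fin m) ℝ} (hEE₀ : Eᵀ * E₀ = 0) {Q : Matrix (Fin m) (Fin n) ℝ}
    (hP : P.PosDef)
    (h : NegDef (sym (theta α ⊗ₖ (Eᵀ * P * A) +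
      (1 : Matrix (Fin 2) (Fin 2) ℝ) ⊗ₖ (Qᵀ * E₀ᵀ * A)))) :
    SpectrallyAdmissible E A α := by
  rw [sym_theta_add, negDef_iff _ _ _ (isSymm_sym _)] at h
  refine spectrallyAdmissible_of_quad_neg (M := Eᵀ * P) ?_ h fun v w hvw => ?_
  · simpa using hP.posSemidef.conjTranspose_mul_mul_same E
  · have h0 : E₀ᵀ * E = 0 := by simpa using congrArg transpose hEE₀
    rw [dotProduct_sym_mulVec, ← mulVec_mulVec, hvw, mulVec_mulVec, Matrix.mul_assoc, h0]
    simp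

lemma spectrallyAdmissible_of_lmi_three {n : ℕ} {E A P : Matrix (Fin n) (Fin n) ℝ} {α : ℝ}
    (h : NegDef (sym (theta α ⊗ₖ (P * A)))) (hP : (P * E).PosSemidef) :
    SpectrallyAdmissible E A α := by
  have h' := (negDef_iff α (P * A) 0 (by simp [IsSymm])).mp (by simpa using h)
  exact spectrallyAdmissible_of_quad_neg hP h' fun v w _ => by simp

/-- For `A v = E w` the extra term `v · Aᵀ Q A v` equals `w · Eᵀ Q E w ≥ 0`. -/
lemma spectrallyAdmissible_of_lmi_four {n : ℕ} {E A P Q : Matrix (Fin n) (Fin n) ℝ} {α : ℝ}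
    (hP : P.PosDef) (hQ : Q.IsSymm)
    (h : NegDef (sym (theta α ⊗ₖ (Eᵀ * P * A)) +
      (1 : Matrix (Fin 2) (Fin 2) ℝ) ⊗ₖ (Aᵀ * Q * A))) (hEQ : (Eᵀ * Q * E).PosSemidef) :
    SpectrallyAdmissible E A α := by
  rw [negDef_iff _ _ _ (by rw [IsSymm, transpose_mul, transpose_mul, hQ, transpose_transpose,
    Matrix.mul_assoc])] at h
  refine spectrallyAdmissible_of_quad_neg (M := Eᵀ * P) ?_ h fun v w hvw => ?_
  · simpa using hP.posSemidef.conjTranspose_mul_mul_same E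
  · have := hEQ.dotProduct_mulVec_nonneg w
    have e : ∀ (M : Matrix (Fin n) (Fin n) ℝ) u, u ⬝ᵥ (Mᵀ * Q * M) *ᵥ u =
        (M *ᵥ u) ⬝ᵥ Q *ᵥ (M *ᵥ u) := fun M u => by
      rw [Matrix.mul_assoc, ← mulVec_mulVec, dotProduct_mulVec, vecMul_transpose, mulVec_mulVec]
    rw [e, hvw, ← e]
    simpa using this

end SFOS

/-! ### The Lyapunov inequality for the sector -/

namespace SFOS

open Matrix

/-- If a sublinear functional `ρ` is negative on the eigenvalues of `T`, then in suitable
coordinates it is negative on the numerical range of `T`. -/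
lemma exists_coordinates_numericalRange {ρ : ℂ → ℝ} (hadd : ∀ x y, ρ (x + y) ≤ ρ x + ρ y)
    (hsmul : ∀ (r : ℝ) x, 0 ≤ r → ρ (r * x) = r * ρ x) (hle : ∀ x, ρ x ≤ ‖x‖) (d : ℕ) :
    ∀ (V : Type) [AddCommGroup V] [Module ℂ V] [FiniteDimensional ℂ V] (T : V →ₗ[ℂ] V),
      Module.finrank ℂ V = d → (∀ μ, Module.End.HasEigenvalue T μ → ρ μ < 0) →
      ∃ (k : ℕ) (φ : V →ₗ[ℂ] (Fin k → ℂ)) (m : ℝ), Function.Injective φ ∧ 0 < m ∧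
        ∀ v, ρ (star (φ v) ⬝ᵥ φ (T v)) ≤ -m * ∑ i, ‖φ v i‖ ^ 2 := by
  have hρ0 : ρ 0 = 0 := by simpa using hsmul 0 0 le_rfl
  induction d with
  | zero =>
    intro V _ _ _ T hd _
    have : Subsingleton V := Module.finrank_zero_iff.mp hd
    exact ⟨0, 0, 1, Function.injective_of_subsingleton _, one_pos, fun v => by simp [hρ0]⟩
  | succ d ih =>
    intro V _ _ _ T hd hT
    have hnt : Nontrivial V := Module.nontrivial_of_finrank_pos (R := ℂ) (by omega)
    -- An eigenvector `f` of the transpose gives the invariant hyperplane `ker f` on which the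
    -- induction runs.
    obtain ⟨l, hl⟩ := Module.End.exists_eigenvalue (T.dualMap : Module.End ℂ (Module.Dual ℂ V))
    obtain ⟨f, hf⟩ := hl.exists_hasEigenvector
    have hfT : ∀ v, f (T v) = l * f v := fun v => by
      have := LinearMap.congr_fun hf.apply_eq_smul v
      simpa using this
    -- If `T - l` were injective it would be surjective, but `f` vanishes on its range.
    have hl' : Module.End.HasEigenvalue T l := by
      rw [Module.End.hasEigenvalue_iff, Module.End.eigenspace_def]
      intro hbot
      have hinj : Function.Injective (T - l • (1 : Module.End ℂ V)) := LinearMap.ker_eq_bot.mp hbot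
      have hsurj := LinearMap.surjective_of_injective hinj
      refine hf.2 (LinearMap.ext fun v => ?_)
      obtain ⟨w, rfl⟩ := hsurj v
      simp [hfT]
    obtain ⟨u, hu⟩ : ∃ u, f u = 1 := by
      obtain ⟨x, hx⟩ : ∃ x, f x ≠ 0 := by
        by_contra! h
        exact hf.2 (LinearMap.ext h)
      exact ⟨(f x)⁻¹ • x, by simp [hx]⟩
    let W := LinearMap.ker f
    have hTW : ∀ w ∈ W, T w ∈ W := fun w hw => by
      rw [LinearMap.mem_ker] at hw ⊢
      rw [hfT, hw, mul_zero]
    have hWd : Module.finrank ℂ W = d := by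
      have : Module.finrank ℂ W + 1 = _ := Module.Dual.finrank_ker_add_one_of_ne_zero hf.2
      omega
    obtain ⟨k, φ, m, hφ, hm, hφm⟩ := ih W (T.restrict hTW) hWd (fun μ hμ => by
      refine hT μ ?_
      obtain ⟨w, hw⟩ := hμ.exists_hasEigenvector
      refine Module.End.hasEigenvalue_of_hasEigenvector (x := (w : V)) ⟨?_, ?_⟩
      · rw [Module.End.mem_eigenspace_iff]
        simpa using congrArg Subtype.val hw.apply_eq_smul
      · simpa using hw.2)
    -- In the splitting `W ⊕ ℂ u` the map `T` is block triangular, with diagonal entries `T|W` and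
    -- `l` and off-diagonal entry `w₀`.
    let w₀ : W := ⟨T u - l • u, by simp [W, hfT, hu]⟩
    let π : V →ₗ[ℂ] W :=
      { toFun := fun v => ⟨v - f v • u, by simp [W, hu]⟩
        map_add' := fun x y => by ext; simp [add_smul]; abel
        map_smul' := fun c x => by ext; simp [smul_sub, mul_smul] }
    have hπT : ∀ v, π (T v) = T.restrict hTW (π v) + f v • w₀ := fun v => by
      ext
      simp [π, w₀, hfT, smul_sub, mul_smul, smul_comm l]
    set Y := ∑ i, ‖φ w₀ i‖ ^ 2 with hY
    have hY0 : 0 ≤ Y := Finset.sum_nonneg fun i _ => by positivity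
    have hη := hT l hl'
    -- The weight on the new coordinate is chosen so that its diagonal contribution `κ2 ρ(l) |f v|²`
    -- absorbs the share `Y / (2m) |f v|²` of the cross term and still leaves `-|f v|²`.
    set κ2 : ℝ := (Y / (2 * m) + 1) / (-ρ l) with hκ2
    have hκ0 : 0 < κ2 := div_pos (by positivity) (by linarith)
    have hκl : κ2 * ρ l = -(Y / (2 * m) + 1) := by
      rw [hκ2, div_mul_eq_mul_div, div_eq_iff (by linarith)]
      ring
    let κ : ℝ := Real.sqrt κ2
    have hκ : κ ^ 2 = κ2 := Real.sq_sqrt hκ0.le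
    have hκp : 0 < κ := Real.sqrt_pos.mpr hκ0
    let ψ : V →ₗ[ℂ] (Fin (k + 1) → ℂ) := LinearMap.pi (Fin.cons ((κ : ℂ) • f)
      fun i => (LinearMap.proj i).comp (φ.comp π))
    have hψ0 : ∀ v, ψ v 0 = κ * f v := fun v => by simp [ψ]
    have hψs : ∀ v i, ψ v (Fin.succ i) = φ (π v) i := fun v i => by simp [ψ]
    refine ⟨k + 1, ψ, min (m / 2) (1 / κ2), ?_, by positivity, fun v => ?_⟩
    · rw [← LinearMap.ker_eq_bot, LinearMap.ker_eq_bot']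
      intro v hv
      have h0 : f v = 0 := by
        have := congrFun hv 0
        rw [hψ0] at this
        simpa [hκp.ne'] using this
      have h1 : φ (π v) = 0 := funext fun i => by rw [← hψs, hv]; rfl
      have h2 : π v = 0 := hφ (by rw [h1, map_zero])
      simpa [π, h0] using congrArg Subtype.val h2
    · have hexp : star (ψ v) ⬝ᵥ ψ (T v) = (κ2 * ‖f v‖ ^ 2 : ℝ) * l +
          (star (φ (π v)) ⬝ᵥ φ (T.restrict hTW (π v)) + f v * (star (φ (π v)) ⬝ᵥ φ w₀)) := by
        rw [dotProduct, Fin.sum_univ_succ]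
        congr 1
        · rw [Pi.star_apply, hψ0, hψ0, hfT, ← hκ]
          simp only [star_mul', Complex.star_def, Complex.conj_ofReal]
          push_cast
          rw [← Complex.conj_mul']
          ring
        · simp only [Pi.star_apply, hψs, hπT, map_add, map_smul, dotProduct, Finset.mul_sum,
            ← Finset.sum_add_distrib, Pi.add_apply, Pi.smul_apply, smul_eq_mul]
          exact Finset.sum_congr rfl fun i _ => by ring
      -- Young's inequality: the cross term costs half of the decay already available on `W`, plus a
      -- multiple of `|f v|²`.
      have hcross : ‖f v * (star (φ (π v)) ⬝ᵥ φ w₀)‖ ≤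
          m / 2 * ∑ i, ‖φ (π v) i‖ ^ 2 + ‖f v‖ ^ 2 * (Y / (2 * m)) := by
        rw [hY, dotProduct, Finset.mul_sum, Finset.mul_sum, Finset.sum_div, Finset.mul_sum,
          ← Finset.sum_add_distrib]
        refine (norm_sum_le _ _).trans (Finset.sum_le_sum fun i _ => ?_)
        simp only [norm_mul, Pi.star_apply, norm_star]
        set x := ‖φ (π v) i‖
        set y := ‖f v‖ * ‖φ w₀ i‖ with hy
        have e : ‖f v‖ ^ 2 * (‖φ w₀ i‖ ^ 2 / (2 * m)) = y ^ 2 / (2 * m) := by rw [hy]; ring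
        have e2 : m / 2 * x ^ 2 + y ^ 2 / (2 * m) - y * x = (m * x - y) ^ 2 / (2 * m) := by
          field_simp
          ring
        rw [e, show ‖f v‖ * (x * ‖φ w₀ i‖) = y * x by rw [hy]; ring]
        have : 0 ≤ (m * x - y) ^ 2 / (2 * m) := by positivity
        linarith
      have hbd : ρ (star (ψ v) ⬝ᵥ ψ (T v)) ≤
          -(m / 2) * ∑ i, ‖φ (π v) i‖ ^ 2 - ‖f v‖ ^ 2 := by
        rw [hexp]
        have h1 := hadd ((κ2 * ‖f v‖ ^ 2 : ℝ) * l)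
          (star (φ (π v)) ⬝ᵥ φ (T.restrict hTW (π v)) + f v * (star (φ (π v)) ⬝ᵥ φ w₀))
        have h2 := hadd (star (φ (π v)) ⬝ᵥ φ (T.restrict hTW (π v)))
          (f v * (star (φ (π v)) ⬝ᵥ φ w₀))
        have h3 := hφm (π v)
        have h4 := (hle _).trans hcross
        rw [hsmul _ _ (by positivity)] at h1
        have h5 : κ2 * ‖f v‖ ^ 2 * ρ l = -(Y / (2 * m) + 1) * ‖f v‖ ^ 2 := by
          rw [← hκl]; ring
        linarith
      refine hbd.trans ?_
      rw [Fin.sum_univ_succ, hψ0]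
      simp only [hψs]
      rw [norm_mul, Complex.norm_real, Real.norm_of_nonneg hκp.le, mul_pow, hκ]
      have h1 : min (m / 2) (1 / κ2) * ∑ i, ‖φ (π v) i‖ ^ 2 ≤ m / 2 * ∑ i, ‖φ (π v) i‖ ^ 2 :=
        mul_le_mul_of_nonneg_right (min_le_left _ _) (Finset.sum_nonneg fun i _ => by positivity)
      have h2 : min (m / 2) (1 / κ2) * (κ2 * ‖f v‖ ^ 2) ≤ 1 / κ2 * (κ2 * ‖f v‖ ^ 2) :=
        mul_le_mul_of_nonneg_right (min_le_right _ _) (by positivity)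
      have h3 : 1 / κ2 * (κ2 * ‖f v‖ ^ 2) = ‖f v‖ ^ 2 := by field_simp
      linarith

/-- The Lyapunov inequality for the sector. -/
lemma exists_posDef_quad_neg {n : ℕ} (α : ℝ) (C : Matrix (Fin n) (Fin n) ℝ)
    (hC : ∀ μ ∈ sector α, (μ • (1 : Matrix (Fin n) (Fin n) ℂ) - C.map ((↑) : ℝ → ℂ)).det ≠ 0) :
    ∃ P : Matrix (Fin n) (Fin n) ℝ, P.PosDef ∧
      ∀ a b : Fin n → ℝ, (a ≠ 0 ∨ b ≠ 0) → quad α (P * C) a b < 0 := by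
  set s := Real.sin (Real.pi / 2 * α) with hs
  set c := Real.cos (Real.pi / 2 * α) with hc
  have hsc : s ^ 2 + c ^ 2 = 1 := Real.sin_sq_add_cos_sq _
  -- The complement of the sector is a convex cone, the set where this sublinear functional is
  -- negative.
  let ρ : ℂ → ℝ := fun z => max (s * z.re - c * z.im) (s * z.re + c * z.im)
  have hadd : ∀ x y, ρ (x + y) ≤ ρ x + ρ y := fun x y => by
    simp only [ρ, Complex.add_re, Complex.add_im]
    refine max_le ?_ ?_
    · have := le_max_left (s * x.re - c * x.im) (s * x.re + c * x.im)
      have := le_max_left (s * y.re - c * y.im) (s * y.re + c * y.im)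
      linarith
    · have := le_max_right (s * x.re - c * x.im) (s * x.re + c * x.im)
      have := le_max_right (s * y.re - c * y.im) (s * y.re + c * y.im)
      linarith
  have hsmul : ∀ (r : ℝ) x, 0 ≤ r → ρ (r * x) = r * ρ x := fun r x hr => by
    simp only [ρ, mul_max_of_nonneg _ _ hr, Complex.re_ofReal_mul, Complex.im_ofReal_mul]
    congr 1 <;> ring
  have hle : ∀ x, ρ x ≤ ‖x‖ := fun x => by
    have hx := Complex.sq_norm x
    rw [Complex.normSq_apply] at hx
    refine max_le ?_ ?_ <;> refine abs_le_of_sq_le_sq' ?_ (norm_nonneg x) |>.2 <;>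
      rw [hx] <;> nlinarith [sq_nonneg (s * x.im + c * x.re), sq_nonneg (s * x.im - c * x.re)]
  have heig : ∀ μ, Module.End.HasEigenvalue (Matrix.toLin' (C.map ((↑) : ℝ → ℂ))) μ → ρ μ < 0 := by
    intro μ hμ
    by_contra! h
    obtain ⟨v, hv⟩ := hμ.exists_hasEigenvector
    refine hC μ (le_max_iff.mp h) (exists_mulVec_eq_zero_iff.mp ⟨v, hv.2, ?_⟩)
    have := hv.apply_eq_smul
    rw [toLin'_apply] at this
    rw [sub_mulVec, this, smul_mulVec, one_mulVec, sub_self]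
  obtain ⟨k, φ, m, hφ, hm, hφm⟩ := exists_coordinates_numericalRange hadd hsmul hle _ _ _ rfl heig
  let ι : (Fin n → ℝ) → (Fin n → ℂ) := fun a i => (a i : ℂ)
  let M : Matrix (Fin k) (Fin n) ℂ := LinearMap.toMatrix' φ
  have hM : ∀ x, φ x = M *ᵥ x := fun x => by simp [M]
  -- The Gram matrix of the coordinates is complex Hermitian; its real part suffices because `C` is
  -- real.
  let P : Matrix (Fin n) (Fin n) ℝ := (Mᴴ * M).map Complex.re
  have hP : ∀ a b : Fin n → ℝ, a ⬝ᵥ P *ᵥ b = (star (φ (ι a)) ⬝ᵥ φ (ι b)).re := by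
    intro a b
    have h1 : star (φ (ι a)) ⬝ᵥ φ (ι b) = star (ι a) ⬝ᵥ (Mᴴ * M) *ᵥ ι b := by
      rw [hM, hM, star_mulVec, ← mulVec_mulVec, dotProduct_mulVec (star (ι a))]
    rw [h1]
    simp [dotProduct, mulVec, ι, P]
  have hpos : ∀ v : Fin n → ℂ, v ≠ 0 → 0 < ∑ i, ‖φ v i‖ ^ 2 := by
    intro v hv
    have h0 : φ v ≠ 0 := fun h => hv (hφ (by rw [h, map_zero]))
    obtain ⟨i, hi⟩ := Function.ne_iff.mp h0
    exact Finset.sum_pos' (fun i _ => by positivity)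
      ⟨i, Finset.mem_univ _, by have := norm_pos_iff.mpr hi; simpa using pow_pos this 2⟩
  have hιC : ∀ a, (C.map ((↑) : ℝ → ℂ)) *ᵥ ι a = ι (C *ᵥ a) := fun a => by
    ext i
    simp [ι, mulVec, dotProduct]
  refine ⟨P, PosDef.of_dotProduct_mulVec_pos ?_ fun x hx => ?_, fun a b hab => ?_⟩
  · ext i j
    have := congrArg Complex.re (congrFun (congrFun (isHermitian_conjTranspose_mul_self M) i) j)
    rw [conjTranspose_apply] at this
    simpa [P] using this
  · rw [star_trivial, hP]
    have hx' : ι x ≠ 0 := fun h => hx (funext fun i => by simpa [ι] using congrFun h i)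
    have := hpos _ hx'
    simp only [dotProduct, Pi.star_apply, Complex.star_def, Complex.conj_mul', Complex.re_sum]
    exact_mod_cast this
  · have hv : ∀ e : ℂ, e ≠ 0 → e.re = 0 → ι a + e • ι b ≠ 0 := fun e he0 he h => by
      have h1 : ∀ i, a i = 0 := fun i => by
        simpa [ι, he] using congrArg Complex.re (congrFun h i)
      have h2 : ∀ i, b i = 0 := fun i => by
        simpa [ι, h1, he0] using congrFun h i
      exact hab.elim (· (funext h1)) (· (funext h2))
    have key : ∀ e : ℂ, e ≠ 0 → e.re = 0 → ρ (star (φ (ι a + e • ι b)) ⬝ᵥ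
        φ (ι (C *ᵥ a) + e • ι (C *ᵥ b))) < 0 := fun e he0 he => by
      have h1 := hφm (ι a + e • ι b)
      rw [toLin'_apply, mulVec_add, mulVec_smul, hιC, hιC] at h1
      have := mul_pos hm (hpos _ (hv e he0 he))
      linarith
    -- The first half plane is used at `a + i b` and the second at `a - i b`; in the sum the
    -- contributions of the imaginary part of `Mᴴ M` cancel, leaving twice the required form.
    have k1 := (le_max_left _ _).trans_lt (key Complex.I Complex.I_ne_zero Complex.I_re)
    have k2 := (le_max_right _ _).trans_lt (key (-Complex.I) (neg_ne_zero.mpr Complex.I_ne_zero)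
      (by simp))
    simp only [map_add, map_smul, star_add, star_smul, add_dotProduct, dotProduct_add,
      smul_dotProduct, dotProduct_smul, smul_eq_mul] at k1 k2
    simp only [quad, ← mulVec_mulVec, hP, ← hs, ← hc]
    simp at k1 k2
    linarith

end SFOS

/-! ### The group inverse of the pencil and explicit solutions of the matrix inequalities -/

namespace SFOS

open Matrix

/-- The pencil `(E, A)` with `A` invertible and `K = A⁻¹ E` of index at most one: `B` is the group
inverse of `K` and `J = K B = B K` the projection along the kernel of `K`. -/
structure IsGroupDecomposition {n : ℕ} (E A K B J : Matrix (Fin n) (Fin n) ℝ) : Prop where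
  isUnit : IsUnit A.det
  eq_mul : E = A * K
  mul_inv : K * B = J
  inv_mul : B * K = J
  proj_mul : J * K = K
  mul_proj : K * J = K
  proj_mul_inv : J * B = B
  inv_mul_proj : B * J = B
  proj_mul_proj : J * J = J

lemma exists_mul_eq_of_range_le {m n k : ℕ} (X : Matrix (Fin m) (Fin n) ℝ)
    (Y : Matrix (Fin m) (Fin k) ℝ) (h : LinearMap.range Y.mulVecLin ≤ LinearMap.range X.mulVecLin) :
    ∃ W : Matrix (Fin n) (Fin k) ℝ, X * W = Y := by
  have h1 : ∀ j, ∃ w, X *ᵥ w = Y.col j := fun j => by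
    have : Y.mulVecLin (Pi.single j 1) ∈ LinearMap.range X.mulVecLin := h ⟨_, rfl⟩
    obtain ⟨w, hw⟩ := this
    exact ⟨w, by simpa using hw⟩
  choose w hw using h1
  refine ⟨(Matrix.of w)ᵀ, ?_⟩
  ext i j
  have := congrFun (hw j) i
  simpa [mulVec, dotProduct, Matrix.mul_apply] using this

lemma exists_right_factor_of_rank {n : ℕ} (K : Matrix (Fin n) (Fin n) ℝ)
    (h : (K * K).rank = K.rank) : ∃ W, K * K * W = K := by
  refine exists_mul_eq_of_range_le _ _ (le_of_eq ?_)
  symm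
  refine Submodule.eq_of_le_of_finrank_eq ?_ h
  rw [mulVecLin_mul]
  exact LinearMap.range_comp_le_range _ _

lemma rank_mul_self_of_index_le_one {n : ℕ} (K : Matrix (Fin n) (Fin n) ℝ)
    (h : ∀ v, K *ᵥ K *ᵥ v = 0 → K *ᵥ v = 0) : (K * K).rank = K.rank := by
  have h1 := LinearMap.finrank_range_add_finrank_ker (K * K).mulVecLin
  have h2 := LinearMap.finrank_range_add_finrank_ker K.mulVecLin
  have h3 : LinearMap.ker (K * K).mulVecLin = LinearMap.ker K.mulVecLin := by
    ext v
    simp only [LinearMap.mem_ker, mulVecLin_apply, ← mulVec_mulVec]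
    exact ⟨h v, fun h => by rw [h, mulVec_zero]⟩
  rw [h3] at h1
  simp only [Matrix.rank]
  omega

/-- Index at most one means `rank K² = rank K`, so `K = K² Y = Z K²`. Then `K Y = Z K` is the
projection, and `Z K Y` is the group inverse. -/
lemma exists_group_inverse {n : ℕ} (K : Matrix (Fin n) (Fin n) ℝ)
    (h : ∀ v, K *ᵥ K *ᵥ v = 0 → K *ᵥ v = 0) :
    ∃ B J : Matrix (Fin n) (Fin n) ℝ, K * B = J ∧ B * K = J ∧ J * K = K ∧ K * J = K ∧
      J * B = B ∧ B * J = B ∧ J * J = J := by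
  have hr := rank_mul_self_of_index_le_one K h
  obtain ⟨Y, hY⟩ := exists_right_factor_of_rank K hr
  obtain ⟨Z', hZ'⟩ := exists_right_factor_of_rank Kᵀ (by
    rw [← transpose_mul, rank_transpose, rank_transpose, hr])
  obtain ⟨Z, hZ⟩ : ∃ Z, Z * (K * K) = K := ⟨Z'ᵀ, by
    simpa [transpose_mul, Matrix.mul_assoc] using congrArg transpose hZ'⟩
  have hKY : K * Y = Z * K := by
    conv_lhs => rw [← hZ]
    rw [Matrix.mul_assoc, hY]
  have h1 : Z * K * K = K := by rw [Matrix.mul_assoc, hZ]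
  have h2 : K * (Z * K) = K := by rw [← hKY, ← Matrix.mul_assoc, hY]
  have h3 : Z * K * (Z * K) = Z * K := by rw [Matrix.mul_assoc, h2]
  have h4 : Z * K * Y = Z * (Z * K) := by rw [Matrix.mul_assoc, hKY]
  have h5 : K * (Z * K * Y) = Z * K := by rw [← Matrix.mul_assoc, h2, hKY]
  have h6 : Z * K * Y * K = Z * K := by rw [h4, Matrix.mul_assoc, h1]
  refine ⟨Z * K * Y, Z * K, h5, h6, h1, h2, ?_, ?_, h3⟩
  · rw [← Matrix.mul_assoc, h3]
  · rw [h4, Matrix.mul_assoc, h3]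

lemma zero_mem_sector (α : ℝ) : (0 : ℂ) ∈ sector α := by simp [sector]

lemma map_ofReal_mul {n : ℕ} (X Y : Matrix (Fin n) (Fin n) ℝ) :
    (X * Y).map ((↑) : ℝ → ℂ) = X.map ((↑) : ℝ → ℂ) * Y.map ((↑) : ℝ → ℂ) := by
  ext i j
  simp [Matrix.mul_apply]

namespace SpectrallyAdmissible

variable {n : ℕ} {E A : Matrix (Fin n) (Fin n) ℝ} {α : ℝ}

lemma isUnit_det (h : SpectrallyAdmissible E A α) : IsUnit A.det := by
  have h0 := h.det_ne_zero 0 (zero_mem_sector α)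
  rw [zero_smul, zero_sub, det_neg] at h0
  have h1 : (A.map ((↑) : ℝ → ℂ)).det = (A.det : ℂ) :=
    (RingHom.map_det Complex.ofRealHom A).symm
  rw [h1] at h0
  exact isUnit_iff_ne_zero.mpr (by simpa using h0)

lemma exists_isGroupDecomposition (h : SpectrallyAdmissible E A α) :
    ∃ K B J, IsGroupDecomposition E A K B J := by
  have hA := h.isUnit_det
  have hE : E = A * (A⁻¹ * E) := by rw [← Matrix.mul_assoc, mul_nonsing_inv A hA, Matrix.one_mul]
  have hEu : ∀ u, E *ᵥ u = A *ᵥ (A⁻¹ * E) *ᵥ u := fun u => by rw [mulVec_mulVec, ← hE]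
  -- For `u = K v` with `K u = 0` one has `E u = 0` and `A u = E v`, so the index condition gives `u
  -- = 0`.
  obtain ⟨B, J, h1, h2, h3, h4, h5, h6, h7⟩ := exists_group_inverse (A⁻¹ * E) (fun v hv => by
    refine h.index_le_one _ v ?_ ?_
    · rw [hEu, hv, mulVec_zero]
    · exact (hEu v).symm)
  exact ⟨_, B, J, hA, hE, h1, h2, h3, h4, h5, h6, h7⟩

end SpectrallyAdmissible

/-- This makes `-1` a harmless eigenvalue to place on the kernel of `K`. -/
lemma neg_one_notMem_sector {α : ℝ} (h₁ : 1 < α) (h₂ : α < 2) : (-1 : ℂ) ∉ sector α := by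
  have := sin_pos_of_order h₁ h₂
  simp [sector]
  linarith

namespace IsGroupDecomposition

variable {n : ℕ} {E A K B J : Matrix (Fin n) (Fin n) ℝ} {α : ℝ}

lemma mul_compl (d : IsGroupDecomposition E A K B J) : K * (1 - J) = 0 := by
  rw [Matrix.mul_sub, Matrix.mul_one, d.mul_proj, sub_self]

lemma compl_mul (d : IsGroupDecomposition E A K B J) : (1 - J) * K = 0 := by
  rw [Matrix.sub_mul, Matrix.one_mul, d.proj_mul, sub_self]

lemma compl_mul_inv (d : IsGroupDecomposition E A K B J) : (1 - J) * B = 0 := by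
  rw [Matrix.sub_mul, Matrix.one_mul, d.proj_mul_inv, sub_self]

lemma compl_mul_proj (d : IsGroupDecomposition E A K B J) : (1 - J) * J = 0 := by
  rw [Matrix.sub_mul, Matrix.one_mul, d.proj_mul_proj, sub_self]

lemma proj_mul_compl (d : IsGroupDecomposition E A K B J) : J * (1 - J) = 0 := by
  rw [Matrix.mul_sub, Matrix.mul_one, d.proj_mul_proj, sub_self]

lemma compl_mul_compl (d : IsGroupDecomposition E A K B J) : (1 - J) * (1 - J) = 1 - J := by
  rw [Matrix.mul_sub, Matrix.mul_one, d.compl_mul_proj, sub_zero]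

/-- The matrix `B - (1 - J)` has the finite eigenvalues of the pencil, and `-1`. -/
lemma det_ne_zero (d : IsGroupDecomposition E A K B J) (h : SpectrallyAdmissible E A α)
    (h₁ : 1 < α) (h₂ : α < 2) : ∀ μ ∈ sector α,
    (μ • (1 : Matrix (Fin n) (Fin n) ℂ) - (B - (1 - J)).map ((↑) : ℝ → ℂ)).det ≠ 0 := by
  intro μ hμ hdet
  obtain ⟨v, hv, hv0⟩ := exists_mulVec_eq_zero_iff.mpr hdet
  rw [sub_mulVec, smul_mulVec, one_mulVec, sub_eq_zero] at hv0
  have e1 : (1 - J) * (B - (1 - J)) = -(1 - J) := by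
    rw [Matrix.mul_sub, d.compl_mul_inv, d.compl_mul_compl, zero_sub]
  have e2 : E * (B - (1 - J)) = A * J := by
    rw [d.eq_mul, Matrix.mul_assoc, Matrix.mul_sub, d.mul_inv, d.mul_compl, sub_zero]
  -- Multiplying the eigenvalue equation by `1 - J` gives `(μ + 1)(1 - J) v = 0`, and `μ ≠ -1`;
  -- hence `v = J v`, and multiplication by `E` returns `μ E v = A v`.
  have v1 : (1 - J).map ((↑) : ℝ → ℂ) *ᵥ v = 0 := by
    have := congrArg ((1 - J).map ((↑) : ℝ → ℂ) *ᵥ ·) hv0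
    simp only [mulVec_mulVec, ← map_ofReal_mul, e1, mulVec_smul] at this
    have hm : (-(1 - J)).map ((↑) : ℝ → ℂ) = -(1 - J).map ((↑) : ℝ → ℂ) := by ext; simp
    rw [hm, neg_mulVec, eq_neg_iff_add_eq_zero] at this
    have h3 : (μ + 1) • ((1 - J).map ((↑) : ℝ → ℂ) *ᵥ v) = 0 := by
      rw [add_smul, one_smul, this]
    refine (smul_eq_zero.mp h3).resolve_left fun h4 => neg_one_notMem_sector h₁ h₂ ?_
    rwa [← eq_neg_of_add_eq_zero_left h4]
  have v2 : J.map ((↑) : ℝ → ℂ) *ᵥ v = v := by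
    have hm : (1 - J).map ((↑) : ℝ → ℂ) = 1 - J.map ((↑) : ℝ → ℂ) := by
      ext i j
      by_cases hij : i = j <;> simp [hij]
    rw [hm, sub_mulVec, one_mulVec, sub_eq_zero] at v1
    exact v1.symm
  refine h.det_ne_zero μ hμ (exists_mulVec_eq_zero_iff.mp ⟨v, hv, ?_⟩)
  have := congrArg (E.map ((↑) : ℝ → ℂ) *ᵥ ·) hv0
  simp only [mulVec_mulVec, ← map_ofReal_mul, e2, mulVec_smul] at this
  rw [map_ofReal_mul, ← mulVec_mulVec, v2] at this
  rw [sub_mulVec, smul_mulVec, this, sub_self]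

lemma mul_C (d : IsGroupDecomposition E A K B J) : (B - (1 - J)) * K = J := by
  rw [Matrix.sub_mul, d.inv_mul, d.compl_mul, sub_zero]

lemma C_mul_inv (d : IsGroupDecomposition E A K B J) :
    (B - (1 - J)) * (K - (1 - J)) = 1 := by
  have : B * (1 - J) = 0 := by
    rw [Matrix.mul_sub, Matrix.mul_one, d.inv_mul_proj, sub_self]
  rw [Matrix.mul_sub, d.mul_C, Matrix.sub_mul, this, d.compl_mul_compl]
  abel

end IsGroupDecomposition

lemma quad_conj {n : ℕ} (α : ℝ) (T X : Matrix (Fin n) (Fin n) ℝ) (a b : Fin n → ℝ) :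
    quad α (Tᵀ * X * T) a b = quad α X (T *ᵥ a) (T *ᵥ b) := by
  have e : ∀ u v, u ⬝ᵥ (Tᵀ * X * T) *ᵥ v = (T *ᵥ u) ⬝ᵥ X *ᵥ (T *ᵥ v) := fun u v => by
    rw [Matrix.mul_assoc, ← mulVec_mulVec, dotProduct_mulVec, vecMul_transpose, mulVec_mulVec]
  simp only [quad, e]

lemma dotProduct_gram_mulVec {n : ℕ} (R : Matrix (Fin n) (Fin n) ℝ) (u v : Fin n → ℝ) :
    u ⬝ᵥ (Rᵀ * R) *ᵥ v = (R *ᵥ u) ⬝ᵥ (R *ᵥ v) := by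
  rw [← mulVec_mulVec, dotProduct_mulVec, vecMul_transpose]

lemma dotProduct_self_nonneg' {n : ℕ} (v : Fin n → ℝ) : 0 ≤ v ⬝ᵥ v :=
  Finset.sum_nonneg fun i _ => mul_self_nonneg (v i)

/-- The forms used in the three matrix inequalities are negative definite. -/
lemma quad_proj_add_compl_neg {n : ℕ} {α κ : ℝ} (hκ : 0 < κ) {X J : Matrix (Fin n) (Fin n) ℝ}
    (hX : ∀ a b : Fin n → ℝ, (a ≠ 0 ∨ b ≠ 0) → quad α X a b < 0) {a b : Fin n → ℝ}
    (hab : a ≠ 0 ∨ b ≠ 0) :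
    2 * quad α X (J *ᵥ a) (J *ᵥ b) - κ * (((1 - J) *ᵥ a) ⬝ᵥ ((1 - J) *ᵥ a) +
      ((1 - J) *ᵥ b) ⬝ᵥ ((1 - J) *ᵥ b)) < 0 := by
  by_cases h : J *ᵥ a ≠ 0 ∨ J *ᵥ b ≠ 0
  · have h1 := hX _ _ h
    have h2 := dotProduct_self_nonneg' ((1 - J) *ᵥ a)
    have h3 := dotProduct_self_nonneg' ((1 - J) *ᵥ b)
    nlinarith
  · push Not at h
    have ha : (1 - J) *ᵥ a = a := by rw [sub_mulVec, one_mulVec, h.1, sub_zero]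
    have hb : (1 - J) *ᵥ b = b := by rw [sub_mulVec, one_mulVec, h.2, sub_zero]
    have h1 : quad α X 0 0 = 0 := by simp [quad]
    rw [h.1, h.2, ha, hb, h1]
    have h2 := dotProduct_self_nonneg' a
    have h3 := dotProduct_self_nonneg' b
    have : 0 < a ⬝ᵥ a + b ⬝ᵥ b := by
      rcases hab with h | h
      · have : a ⬝ᵥ a ≠ 0 := fun h' => h (dotProduct_self_eq_zero.mp h')
        have := lt_of_le_of_ne h2 this.symm
        linarith
      · have : b ⬝ᵥ b ≠ 0 := fun h' => h (dotProduct_self_eq_zero.mp h')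
        have := lt_of_le_of_ne h3 this.symm
        linarith
    have := mul_pos hκ this
    linarith

/-- Spectral admissibility yields solutions of the three matrix inequalities. -/
lemma SpectrallyAdmissible.lmis {n r : ℕ} {E A : Matrix (Fin n) (Fin n) ℝ} {α : ℝ}
    (h₁ : 1 < α) (h₂ : α < 2) (hr : E.rank = r)
    (E₀ : Matrix (Fin n) (Fin (n - r)) ℝ) (hE₀ : E₀.rank = n - r) (hEE₀ : Eᵀ * E₀ = 0)
    (h : SpectrallyAdmissible E A α) :
    (∃ (P : Matrix (Fin n) (Fin n) ℝ) (Q : Matrix (Fin (n - r)) (Fin n) ℝ), P.PosDef ∧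
        NegDef (sym (theta α ⊗ₖ (Eᵀ * P * A) +
          (1 : Matrix (Fin 2) (Fin 2) ℝ) ⊗ₖ (Qᵀ * E₀ᵀ * A)))) ∧
    (∃ P : Matrix (Fin n) (Fin n) ℝ, NegDef (sym (theta α ⊗ₖ (P * A))) ∧
        P * E = Eᵀ * Pᵀ ∧ (P * E).PosSemidef) ∧
    (∃ P Q : Matrix (Fin n) (Fin n) ℝ, P.PosDef ∧ Q.IsSymm ∧
        NegDef (sym (theta α ⊗ₖ (Eᵀ * P * A)) +
          (1 : Matrix (Fin 2) (Fin 2) ℝ) ⊗ₖ (Aᵀ * Q * A)) ∧ (Eᵀ * Q * E).PosSemidef) := by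
  obtain ⟨K, B, J, d⟩ := h.exists_isGroupDecomposition
  obtain ⟨P₁, hP₁, hneg⟩ := exists_posDef_quad_neg α _ (d.det_ne_zero h h₁ h₂)
  set C := B - (1 - J) with hC
  set R := 1 - J with hR
  have hAA : A⁻¹ * A = 1 := nonsing_inv_mul A d.isUnit
  have hAA' : ∀ X : Matrix (Fin n) (Fin n) ℝ, X * A⁻¹ * A = X := fun X => by
    rw [Matrix.mul_assoc, hAA, Matrix.mul_one]
  have hCK : C * K = J := d.mul_C
  have hAE : ∀ X : Matrix (Fin n) (Fin n) ℝ, X * A⁻¹ * E = X * K := fun X => by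
    rw [d.eq_mul, ← Matrix.mul_assoc, hAA']
  have hJC : J * C = C * J := by
    rw [hC, Matrix.mul_sub, Matrix.sub_mul, d.proj_mul_inv, d.inv_mul_proj, d.proj_mul_compl,
      d.compl_mul_proj]
  have hRC : R * C = -R := by
    rw [hC, Matrix.mul_sub, d.compl_mul_inv, d.compl_mul_compl, zero_sub]
  -- `P₂` is block diagonal for the splitting by `J`: the Lyapunov matrix on the range of `J`, and a
  -- Gram matrix on its complement, where `C` acts as `-1`.
  set P₂ := Jᵀ * P₁ * J + Rᵀ * R with hP₂
  have hP₂pos : P₂.PosDef := by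
    refine PosDef.of_dotProduct_mulVec_pos ?_ fun x hx => ?_
    · have hs : P₁ᵀ = P₁ := by
        rw [← conjTranspose_eq_transpose_of_trivial]; exact hP₁.isHermitian
      rw [IsHermitian, conjTranspose_eq_transpose_of_trivial, hP₂]
      simp only [transpose_add, transpose_mul, transpose_transpose, hs, Matrix.mul_assoc]
    · have e : x ⬝ᵥ P₂ *ᵥ x = (J *ᵥ x) ⬝ᵥ P₁ *ᵥ (J *ᵥ x) + (R *ᵥ x) ⬝ᵥ (R *ᵥ x) := by
        rw [hP₂, add_mulVec, dotProduct_add, dotProduct_gram_mulVec, Matrix.mul_assoc,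
          ← mulVec_mulVec, dotProduct_mulVec, vecMul_transpose, mulVec_mulVec]
      rw [star_trivial, e]
      have h2 := dotProduct_self_nonneg' (R *ᵥ x)
      by_cases h0 : J *ᵥ x = 0
      · have hx' : R *ᵥ x = x := by rw [hR, sub_mulVec, one_mulVec, h0, sub_zero]
        rw [hx'] at h2
        rw [h0, hx']
        have : x ⬝ᵥ x ≠ 0 := fun h' => hx (dotProduct_self_eq_zero.mp h')
        simpa using lt_of_le_of_ne h2 this.symm
      · have := hP₁.dotProduct_mulVec_pos h0
        rw [star_trivial] at this
        linarith
  have hP₂C : P₂ * C = Jᵀ * (P₁ * C) * J - Rᵀ * R := by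
    rw [hP₂, Matrix.add_mul, Matrix.mul_assoc _ J, hJC, Matrix.mul_assoc Rᵀ, hRC]
    simp only [Matrix.mul_assoc, Matrix.mul_neg, sub_eq_add_neg]
  have hJP₂C : Jᵀ * (P₂ * C) = Jᵀ * (P₁ * C) * J := by
    have e1 : Jᵀ * Jᵀ = Jᵀ := by rw [← transpose_mul, d.proj_mul_proj]
    have e2 : Jᵀ * Rᵀ = 0 := by rw [← transpose_mul, d.compl_mul_proj, transpose_zero]
    rw [hP₂C, Matrix.mul_sub, ← Matrix.mul_assoc _ Rᵀ, e2, Matrix.zero_mul, sub_zero,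
      ← Matrix.mul_assoc, ← Matrix.mul_assoc, e1]
  -- Conjugation by `C A⁻¹` is chosen because `C A⁻¹ E = C K = J`, so that `Eᵀ P A` reduces to `Jᵀ
  -- P₁ C J`.
  have hP : ((C * A⁻¹)ᴴ * P₂ * (C * A⁻¹)).PosDef := by
    refine hP₂pos.conjTranspose_mul_mul_same ?_
    have hinv : (A * (K - (1 - J))) * (C * A⁻¹) = 1 := by
      have h1 : (K - (1 - J)) * C = 1 := mul_eq_one_comm.mp d.C_mul_inv
      rw [Matrix.mul_assoc, ← Matrix.mul_assoc _ C, h1, Matrix.one_mul, mul_nonsing_inv A d.isUnit]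
    intro x y hxy
    have := congrArg ((A * (K - (1 - J))) *ᵥ ·) hxy
    simpa [mulVec_mulVec, hinv] using this
  have hEPA : Eᵀ * ((C * A⁻¹)ᴴ * P₂ * (C * A⁻¹)) * A = Jᵀ * (P₁ * C) * J := by
    rw [conjTranspose_eq_transpose_of_trivial, ← hJP₂C]
    calc Eᵀ * ((C * A⁻¹)ᵀ * P₂ * (C * A⁻¹)) * A = (Eᵀ * (C * A⁻¹)ᵀ) * P₂ * (C * A⁻¹ * A) := by
          simp only [Matrix.mul_assoc]
      _ = Jᵀ * (P₂ * C) := by rw [← transpose_mul, hAE, hCK, hAA', Matrix.mul_assoc]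
  have hRK : R * K = 0 := d.compl_mul
  have hSsym : (-(Rᵀ * R)).IsSymm := by simp [IsSymm]
  refine ⟨?_, ?_, ?_⟩
  -- The aim is `Qᵀ E₀ᵀ A = -Rᵀ R`. By dimension the range of `E₀` is all of `ker Eᵀ`, and the
  -- required right-hand side lies there since `R A⁻¹ E = R K = 0`.
  · have hrange : ∃ Q : Matrix (Fin (n - r)) (Fin n) ℝ, E₀ * Q = (-(Rᵀ * R) * A⁻¹)ᵀ := by
      refine exists_mul_eq_of_range_le _ _ ?_
      have hle : LinearMap.range E₀.mulVecLin ≤ LinearMap.ker Eᵀ.mulVecLin := by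
        rintro _ ⟨v, rfl⟩
        rw [LinearMap.mem_ker, mulVecLin_apply, mulVecLin_apply, mulVec_mulVec, hEE₀, zero_mulVec]
      have heq : LinearMap.range E₀.mulVecLin = LinearMap.ker Eᵀ.mulVecLin := by
        refine Submodule.eq_of_le_of_finrank_eq hle ?_
        have h3 := LinearMap.finrank_range_add_finrank_ker Eᵀ.mulVecLin
        have h4 : Module.finrank ℝ (LinearMap.range Eᵀ.mulVecLin) = r := by
          rw [← hr, ← rank_transpose E]; rfl
        have h5 : Module.finrank ℝ (LinearMap.range E₀.mulVecLin) = n - r := hE₀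
        rw [Module.finrank_fin_fun] at h3
        omega
      rw [heq]
      rintro _ ⟨v, rfl⟩
      have h0 : -(Rᵀ * R) * A⁻¹ * E = 0 := by
        rw [hAE, Matrix.neg_mul, Matrix.mul_assoc, hRK, Matrix.mul_zero, neg_zero]
      have h0' := congrArg transpose h0
      rw [transpose_mul, transpose_zero] at h0'
      rw [LinearMap.mem_ker, mulVecLin_apply, mulVecLin_apply, mulVec_mulVec, h0', zero_mulVec]
    obtain ⟨Q, hQ⟩ := hrange
    refine ⟨_, Q, hP, ?_⟩
    have hQ' : Qᵀ * E₀ᵀ * A = -(Rᵀ * R) := by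
      rw [← transpose_mul, hQ, transpose_transpose, hAA']
    rw [hEPA, hQ', sym_theta_add, negDef_iff _ _ _ (isSymm_sym _)]
    intro a b hab
    have := quad_proj_add_compl_neg (J := J) two_pos hneg hab
    rw [quad_conj]
    simp only [dotProduct_sym_mulVec, neg_mulVec, dotProduct_neg, dotProduct_gram_mulVec]
    linarith
  -- Here `P A = P₂ C`, with an `R`-block entering through the sine only because `Rᵀ R` is
  -- symmetric, and `P E = P₂ C K = Jᵀ P₁ J`.
  · refine ⟨P₂ * C * A⁻¹, ?_, ?_⟩
    · have := (negDef_iff α (P₂ * C * A⁻¹ * A) 0 (by simp [IsSymm])).mpr ?_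
      · simpa using this
      intro a b hab
      have h1 := quad_proj_add_compl_neg (J := J)
        (mul_pos two_pos (sin_pos_of_order h₁ h₂)) hneg hab
      have h2 : quad α (P₂ * C * A⁻¹ * A) a b = quad α (P₁ * C) (J *ᵥ a) (J *ᵥ b) -
          Real.sin (Real.pi / 2 * α) * ((R *ᵥ a) ⬝ᵥ (R *ᵥ a) + (R *ᵥ b) ⬝ᵥ (R *ᵥ b)) := by
        rw [hAA', hP₂C, ← quad_conj]
        simp only [quad, sub_mulVec, dotProduct_sub, dotProduct_gram_mulVec,
          dotProduct_comm (R *ᵥ b) (R *ᵥ a)]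
        ring
      rw [h2]
      simp only [zero_mulVec, dotProduct_zero]
      linarith
    · have hPE : P₂ * C * A⁻¹ * E = Jᵀ * P₁ * J := by
        rw [hAE, hP₂C, Matrix.sub_mul, Matrix.mul_assoc _ R, hRK, Matrix.mul_zero, sub_zero,
          Matrix.mul_assoc, d.proj_mul, Matrix.mul_assoc, Matrix.mul_assoc, hCK, Matrix.mul_assoc]
      have hps : (P₂ * C * A⁻¹ * E).PosSemidef := by
        rw [hPE]
        simpa using hP₁.posSemidef.conjTranspose_mul_mul_same J
      refine ⟨?_, hps⟩
      have := hps.isHermitian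
      rw [IsHermitian, conjTranspose_eq_transpose_of_trivial, transpose_mul] at this
      exact this.symm
  · have hAT : Aᵀ * (A⁻¹)ᵀ = 1 := by rw [← transpose_mul, hAA, transpose_one]
    -- With this `Q`, `Aᵀ Q A = -Rᵀ R` supplies negativity off the range of `J`, while `Eᵀ Q E = 0`
    -- because `R K = 0`.
    refine ⟨_, (A⁻¹)ᵀ * -(Rᵀ * R) * A⁻¹, hP, ?_, ?_, ?_⟩
    · rw [IsSymm, transpose_mul, transpose_mul, hSsym, transpose_transpose, Matrix.mul_assoc]
    · have hQ' : Aᵀ * ((A⁻¹)ᵀ * -(Rᵀ * R) * A⁻¹) * A = -(Rᵀ * R) := by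
        rw [← Matrix.mul_assoc, hAA', ← Matrix.mul_assoc, hAT, Matrix.one_mul]
      rw [hEPA, hQ', negDef_iff _ _ _ hSsym]
      intro a b hab
      have := quad_proj_add_compl_neg (J := J) one_pos hneg hab
      rw [quad_conj]
      simp only [neg_mulVec, dotProduct_neg, dotProduct_gram_mulVec]
      linarith
    · have : Eᵀ * ((A⁻¹)ᵀ * -(Rᵀ * R) * A⁻¹) * E = 0 := by
        rw [Matrix.mul_assoc, hAE, Matrix.mul_assoc _ _ K, Matrix.neg_mul, Matrix.mul_assoc, hRK]
        simp
      rw [this]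
      exact PosSemidef.zero

end SFOS

/-! ### Riemann-Liouville integrals and their semigroup law -/

namespace SFOS

open MeasureTheory Set Filter Topology

section RiemannLiouville

variable {V W : Type*} [NormedAddCommGroup V] [NormedSpace ℝ V] [NormedAddCommGroup W]
  [NormedSpace ℝ W]

/-- The Riemann-Liouville integral of order `β`. -/
noncomputable def rlInt (β : ℝ) (f : ℝ → V) (t : ℝ) : V :=
  (Real.Gamma β)⁻¹ • ∫ τ in (0 : ℝ)..t, (t - τ) ^ (β - 1) • f τ

lemma fracIntegral_eq_rlInt {n : ℕ} (α : ℝ) (f : ℝ → Fin n → ℝ) (t : ℝ) :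
    fracIntegral α f t = rlInt α f t := rfl

lemma caputoDeriv_eq_rlInt {n : ℕ} (α : ℝ) (f : ℝ → Fin n → ℝ) (t : ℝ) :
    caputoDeriv α f t = rlInt (2 - α) (iteratedDeriv 2 f) t := by
  rw [caputoDeriv, rlInt, show 2 - α - 1 = 1 - α by ring]

/-- Endpoints are left out because the differential equation and the derivatives of solutions are
known only for positive times. -/
lemma integral_congr_Ioo {f g : ℝ → V} {t : ℝ} (ht : 0 ≤ t) (h : ∀ τ ∈ Ioo 0 t, f τ = g τ) :
    ∫ τ in (0 : ℝ)..t, f τ = ∫ τ in (0 : ℝ)..t, g τ := by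
  rw [intervalIntegral.integral_of_le ht, intervalIntegral.integral_of_le ht,
    integral_Ioc_eq_integral_Ioo, integral_Ioc_eq_integral_Ioo]
  exact setIntegral_congr_fun measurableSet_Ioo h

lemma rlInt_congr {β : ℝ} {f g : ℝ → V} {t : ℝ} (ht : 0 ≤ t) (h : ∀ τ ∈ Ioo 0 t, f τ = g τ) :
    rlInt β f t = rlInt β g t := by
  rw [rlInt, rlInt, integral_congr_Ioo ht fun τ hτ => by rw [h τ hτ]]

/-- The kernel `(t - τ)^(β - 1)` may be integrated against `f` on `(0, t)`. -/
def RLIntegrable (β : ℝ) (f : ℝ → V) (t : ℝ) : Prop :=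
  IntervalIntegrable (fun τ => (t - τ) ^ (β - 1) • f τ) volume 0 t

lemma rlInt_clm [CompleteSpace V] [CompleteSpace W] (L : V →L[ℝ] W) {β t : ℝ} {f : ℝ → V}
    (hf : RLIntegrable β f t) : rlInt β (fun τ => L (f τ)) t = L (rlInt β f t) := by
  rw [rlInt, rlInt, map_smul, ← L.intervalIntegral_comp_comm hf]
  simp only [map_smul]

lemma rlInt_add {β t : ℝ} {f g : ℝ → V} (hf : RLIntegrable β f t) (hg : RLIntegrable β g t) :
    rlInt β (fun τ => f τ + g τ) t = rlInt β f t + rlInt β g t := by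
  rw [rlInt, rlInt, rlInt, ← smul_add, ← intervalIntegral.integral_add hf hg]
  simp only [smul_add]

lemma rlInt_one {f : ℝ → V} {t : ℝ} : rlInt 1 f t = ∫ τ in (0 : ℝ)..t, f τ := by
  simp [rlInt]

lemma intervalIntegrable_rpow_sub {β : ℝ} (hβ : 0 < β) (t : ℝ) :
    IntervalIntegrable (fun τ : ℝ => (t - τ) ^ (β - 1)) volume 0 t := by
  have := (intervalIntegral.intervalIntegrable_rpow' (a := 0) (b := t) (r := β - 1)
    (by linarith)).comp_sub_left t
  simpa using this.symm

/-- A locally integrable function that is continuous on `(0, ∞)` is integrable against the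
kernel. -/
lemma rlIntegrable_of_continuousOn {β t : ℝ} (hβ : 0 < β) (ht : 0 < t) {f : ℝ → V}
    (hi : IntegrableOn f (Ioc 0 t)) (hf : ContinuousOn f (Ioi 0)) : RLIntegrable β f t := by
  have h2 : 0 < t / 2 := by linarith
  -- The two possible singularities are separated at `t / 2`: the kernel is continuous to the left
  -- of it, and `f` to the right.
  have h1 : IntervalIntegrable (fun τ => (t - τ) ^ (β - 1) • f τ) volume 0 (t / 2) := by
    have hfi : IntervalIntegrable f volume 0 (t / 2) := by
      rw [intervalIntegrable_iff_integrableOn_Ioc_of_le h2.le]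
      exact hi.mono_set (Ioc_subset_Ioc_right (by linarith))
    refine hfi.continuousOn_smul ?_
    rw [uIcc_of_le h2.le]
    refine ContinuousOn.rpow_const (by fun_prop) fun τ hτ => Or.inl ?_
    have := hτ.2
    linarith
  refine h1.trans ?_
  have hk : IntervalIntegrable (fun τ : ℝ => (t - τ) ^ (β - 1)) volume (t / 2) t :=
    (intervalIntegrable_rpow_sub hβ t).mono_set (by
      rw [uIcc_of_le (by linarith), uIcc_of_le ht.le]; exact Icc_subset_Icc_left h2.le)
  refine hk.smul_continuousOn (hf.mono ?_)
  rw [uIcc_of_le (by linarith)]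
  exact fun τ hτ => lt_of_lt_of_le h2 hτ.1

lemma integral_rpow_mul_rpow {a b σ t : ℝ} (ha : 0 < a) (hb : 0 < b) (h : σ < t) :
    ∫ τ in σ..t, (t - τ) ^ (a - 1) * (τ - σ) ^ (b - 1) =
      (t - σ) ^ (a + b - 1) * (Real.Gamma a * Real.Gamma b / Real.Gamma (a + b)) := by
  have hs : 0 < t - σ := sub_pos.mpr h
  have h1 : ∫ τ in σ..t, (t - τ) ^ (a - 1) * (τ - σ) ^ (b - 1) =
      ∫ x in (0 : ℝ)..(t - σ), (t - σ - x) ^ (a - 1) * x ^ (b - 1) := by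
    have := intervalIntegral.integral_comp_sub_right (a := σ) (b := t)
      (fun x => (t - σ - x) ^ (a - 1) * x ^ (b - 1)) σ
    rw [sub_self] at this
    rw [← this]
    congr 1
    ext x
    congr 2
    ring
  rw [h1]
  have hc := Complex.betaIntegral_scaled b a hs
  have hg := Complex.Gamma_mul_Gamma_eq_betaIntegral (s := b) (t := a) (by simpa) (by simpa)
  have hne : Complex.Gamma (b + a) ≠ 0 := Complex.Gamma_ne_zero_of_re_pos (by simpa using by linarith)
  have hB : Complex.betaIntegral b a = Complex.Gamma b * Complex.Gamma a / Complex.Gamma (b + a) := by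
    rw [hg]
    field_simp
  rw [hB] at hc
  apply Complex.ofReal_injective
  rw [← intervalIntegral.integral_ofReal]
  push_cast
  rw [Complex.ofReal_cpow hs.le, ← Complex.Gamma_ofReal, ← Complex.Gamma_ofReal,
    ← Complex.Gamma_ofReal]
  push_cast
  rw [add_comm (a : ℂ), mul_comm (Complex.Gamma a), ← Complex.ofReal_sub, ← hc]
  refine integral_congr_Ioo hs.le fun x hx => ?_
  rw [Complex.ofReal_cpow (by linarith [hx.2]), Complex.ofReal_cpow hx.1.le, mul_comm]
  push_cast
  ring

/-- A function that is not integrable has integral `0` by convention, whereas the Beta integral is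
positive. -/
lemma intervalIntegrable_rpow_mul_rpow {a b σ t : ℝ} (ha : 0 < a) (hb : 0 < b) (h : σ < t) :
    IntervalIntegrable (fun τ : ℝ => (t - τ) ^ (a - 1) * (τ - σ) ^ (b - 1)) volume σ t := by
  refine intervalIntegral.intervalIntegrable_of_integral_ne_zero ?_
  rw [integral_rpow_mul_rpow ha hb h]
  have := Real.Gamma_pos_of_pos ha
  have := Real.Gamma_pos_of_pos hb
  have := Real.Gamma_pos_of_pos (add_pos ha hb)
  have := Real.rpow_pos_of_pos (sub_pos.mpr h) (a + b - 1)
  positivity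

/-- The semigroup law of the Riemann-Liouville integrals. -/
lemma rlInt_rlInt {a b t : ℝ} (ha : 0 < a) (hb : 0 < b) (hab : 1 ≤ a + b) (ht : 0 < t) {f : ℝ → V}
    (hf : IntegrableOn f (Ioc 0 t)) : rlInt a (rlInt b f) t = rlInt (a + b) f t := by
  by_cases hV : CompleteSpace V
  swap
  · simp [rlInt, intervalIntegral, integral, hV]
  set μ := volume.restrict (Ioc 0 t) with hμ
  -- The kernel of the double integral, cut off to the triangle `σ < τ`; Fubini and the Beta
  -- integral in `τ` then give the law.
  let k : ℝ → ℝ → ℝ := fun τ σ => if σ < τ then (t - τ) ^ (a - 1) * (τ - σ) ^ (b - 1) else 0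
  let G : ℝ → ℝ → V := fun τ σ => k τ σ • f σ
  have hkm : Measurable (Function.uncurry k) := by
    refine Measurable.ite (measurableSet_lt measurable_snd measurable_fst) ?_ measurable_const
    exact ((measurable_const.sub measurable_fst).pow_const _).mul
      ((measurable_fst.sub measurable_snd).pow_const _)
  have hk0 : ∀ σ τ, 0 ≤ σ → τ ∈ Ioc 0 t → 0 ≤ k τ σ := fun σ τ hσ hτ => by
    simp only [k]
    split_ifs with h
    · exact mul_nonneg (Real.rpow_nonneg (by linarith [hτ.2]) _) (Real.rpow_nonneg (by linarith) _)
    · exact le_rfl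
  have hmeas : AEStronglyMeasurable (Function.uncurry G) (μ.prod μ) :=
    hkm.aestronglyMeasurable.smul hf.aestronglyMeasurable.comp_snd
  have hkind : ∀ σ ∈ Ioo 0 t, ∀ τ, τ ∈ Ioc 0 t → k τ σ =
      (Ioc σ t).indicator (fun τ => (t - τ) ^ (a - 1) * (τ - σ) ^ (b - 1)) τ := fun σ hσ τ hτ => by
    by_cases h : σ < τ
    · rw [indicator_of_mem (show τ ∈ Ioc σ t from ⟨h, hτ.2⟩)]
      simp [k, h]
    · rw [indicator_of_notMem (fun h' => h h'.1)]
      simp [k, h]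
  have hkint : ∀ σ ∈ Ioo 0 t, Integrable (fun τ => k τ σ) μ ∧ ∫ τ, k τ σ ∂μ =
      (t - σ) ^ (a + b - 1) * (Real.Gamma a * Real.Gamma b / Real.Gamma (a + b)) := by
    intro σ hσ
    have hsub : Ioc σ t ⊆ Ioc 0 t := Ioc_subset_Ioc_left hσ.1.le
    have hcongr : (fun τ => k τ σ) =ᵐ[μ]
        (Ioc σ t).indicator (fun τ => (t - τ) ^ (a - 1) * (τ - σ) ^ (b - 1)) :=
      (ae_restrict_iff' measurableSet_Ioc).mpr (Eventually.of_forall fun τ hτ => hkind σ hσ τ hτ)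
    constructor
    · rw [integrable_congr hcongr, integrable_indicator_iff measurableSet_Ioc, hμ,
        IntegrableOn, Measure.restrict_restrict measurableSet_Ioc, inter_eq_left.mpr hsub]
      exact (intervalIntegrable_iff_integrableOn_Ioc_of_le hσ.2.le).mp
        (intervalIntegrable_rpow_mul_rpow ha hb hσ.2)
    · rw [integral_congr_ae hcongr, integral_indicator measurableSet_Ioc, hμ,
        Measure.restrict_restrict measurableSet_Ioc, inter_eq_left.mpr hsub,
        ← intervalIntegral.integral_of_le hσ.2.le, integral_rpow_mul_rpow ha hb hσ.2]
  have haeIoo : ∀ᵐ σ ∂μ, σ ∈ Ioo 0 t := by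
    rw [hμ, ← restrict_Ioo_eq_restrict_Ioc]
    exact ae_restrict_mem measurableSet_Ioo
  have hGint : Integrable (Function.uncurry G) (μ.prod μ) := by
    rw [integrable_prod_iff' hmeas]
    constructor
    · filter_upwards [haeIoo] with σ hσ
      exact (hkint σ hσ).1.smul_const (f σ)
    -- Since `a + b ≥ 1`, the factor `(t - σ)^(a+b-1)` is continuous up to `σ = t`, so integrability
    -- of `f` is enough.
    · have hbd : IntegrableOn (fun σ => ((t - σ) ^ (a + b - 1) *
          (Real.Gamma a * Real.Gamma b / Real.Gamma (a + b))) * ‖f σ‖) (Ioc 0 t) := by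
        rw [← intervalIntegrable_iff_integrableOn_Ioc_of_le ht.le]
        refine IntervalIntegrable.continuousOn_mul
          ((intervalIntegrable_iff_integrableOn_Ioc_of_le ht.le).mpr hf.norm) ?_
        exact (ContinuousOn.rpow_const (by fun_prop) fun x _ => Or.inr (by linarith)).mul
          continuousOn_const
      refine hbd.congr ?_
      filter_upwards [haeIoo] with σ hσ
      rw [← (hkint σ hσ).2, ← integral_mul_const]
      refine setIntegral_congr_fun measurableSet_Ioc fun τ hτ => ?_
      simp only [Function.uncurry, G, norm_smul, Real.norm_of_nonneg (hk0 σ τ hσ.1.le hτ)]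
  have hswap := integral_integral_swap hGint
  have hL : ∫ τ, ∫ σ, G τ σ ∂μ ∂μ =
      Real.Gamma b • ∫ τ in (0 : ℝ)..t, (t - τ) ^ (a - 1) • rlInt b f τ := by
    rw [intervalIntegral.integral_of_le ht.le, ← integral_smul]
    refine setIntegral_congr_fun measurableSet_Ioc fun τ hτ => ?_
    have hsub : Ioc 0 τ ⊆ Ioc 0 t := Ioc_subset_Ioc_right hτ.2
    have hGi : ∫ σ, G τ σ ∂μ = (t - τ) ^ (a - 1) • ∫ σ in (0 : ℝ)..τ, (τ - σ) ^ (b - 1) • f σ := by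
      have hae : (fun σ => G τ σ) =ᵐ[μ]
          (Ioo 0 τ).indicator fun σ => (t - τ) ^ (a - 1) • (τ - σ) ^ (b - 1) • f σ := by
        refine (ae_restrict_iff' measurableSet_Ioc).mpr (Eventually.of_forall fun σ hσ => ?_)
        by_cases h : σ < τ
        · rw [indicator_of_mem (show σ ∈ Ioo 0 τ from ⟨hσ.1, h⟩)]
          simp [G, k, h, mul_smul]
        · rw [indicator_of_notMem (fun h' => h h'.2)]
          simp [G, k, h]
      rw [integral_congr_ae hae, integral_indicator measurableSet_Ioo, hμ,
        Measure.restrict_restrict measurableSet_Ioo,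
        inter_eq_left.mpr (Ioo_subset_Ioc_self.trans hsub), integral_smul,
        intervalIntegral.integral_of_le hτ.1.le, integral_Ioc_eq_integral_Ioo]
    have hgb := (Real.Gamma_pos_of_pos hb).ne'
    simp only [hGi, rlInt]
    rw [smul_comm ((t - τ) ^ (a - 1)) (Real.Gamma b)⁻¹, smul_inv_smul₀ hgb]
  have hR : ∫ σ, ∫ τ, G τ σ ∂μ ∂μ = (Real.Gamma a * Real.Gamma b / Real.Gamma (a + b)) •
      ∫ σ in (0 : ℝ)..t, (t - σ) ^ (a + b - 1) • f σ := by
    rw [intervalIntegral.integral_of_le ht.le, ← integral_smul]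
    refine integral_congr_ae ?_
    filter_upwards [haeIoo] with σ hσ
    simp only [G]
    rw [integral_smul_const, (hkint σ hσ).2, ← mul_smul, mul_comm]
  rw [hL, hR] at hswap
  have h1 := (Real.Gamma_pos_of_pos ha).ne'
  have h2 := (Real.Gamma_pos_of_pos hb).ne'
  rw [rlInt, rlInt]
  have h3 := congrArg (fun x => ((Real.Gamma a)⁻¹ * (Real.Gamma b)⁻¹) • x) hswap
  simp only [← mul_smul] at h3
  rw [show (Real.Gamma a)⁻¹ * (Real.Gamma b)⁻¹ * Real.Gamma b = (Real.Gamma a)⁻¹ by field_simp,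
    show (Real.Gamma a)⁻¹ * (Real.Gamma b)⁻¹ * (Real.Gamma a * Real.Gamma b / Real.Gamma (a + b)) =
      (Real.Gamma (a + b))⁻¹ by field_simp] at h3
  exact h3

end RiemannLiouville

end SFOS

/-! ### Linear Volterra equations in exponentially weighted norms -/

namespace SFOS

open MeasureTheory Set Filter Topology

section Volterra

variable {V : Type*} [NormedAddCommGroup V] [NormedSpace ℝ V]

lemma integral_rpow_mul_exp_le {α σ t : ℝ} (hα : 0 < α) (hσ : 0 < σ) (ht : 0 ≤ t) :
    ∫ τ in (0 : ℝ)..t, (t - τ) ^ (α - 1) * Real.exp (σ * τ) ≤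
      Real.Gamma α * σ⁻¹ ^ α * Real.exp (σ * t) := by
  have h1 : ∫ τ in (0 : ℝ)..t, (t - τ) ^ (α - 1) * Real.exp (σ * τ) =
      Real.exp (σ * t) * ∫ u in (0 : ℝ)..t, u ^ (α - 1) * Real.exp (-(σ * u)) := by
    have := intervalIntegral.integral_comp_sub_left (a := 0) (b := t)
      (fun u => u ^ (α - 1) * Real.exp (-(σ * u))) t
    rw [sub_self, sub_zero] at this
    rw [← this, ← intervalIntegral.integral_const_mul]
    congr 1
    ext τ
    rw [mul_left_comm, ← Real.exp_add]
    congr 2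
    ring
  have h2 := Real.integral_rpow_mul_exp_neg_mul_Ioi hα hσ
  have hint : IntegrableOn (fun u : ℝ => u ^ (α - 1) * Real.exp (-(σ * u))) (Ioi 0) := by
    refine not_imp_comm.mp integral_undef (ne_of_gt ?_)
    rw [h2]
    have := Real.Gamma_pos_of_pos hα
    positivity
  have h3 : ∫ u in (0 : ℝ)..t, u ^ (α - 1) * Real.exp (-(σ * u)) ≤
      ∫ u in Ioi (0 : ℝ), u ^ (α - 1) * Real.exp (-(σ * u)) := by
    rw [intervalIntegral.integral_of_le ht]
    refine setIntegral_mono_set hint ?_ Ioc_subset_Ioi_self.eventuallyLE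
    refine (ae_restrict_iff' measurableSet_Ioi).mpr (Eventually.of_forall fun u hu => ?_)
    exact mul_nonneg (Real.rpow_nonneg (le_of_lt hu) _) (Real.exp_pos _).le
  rw [h1]
  rw [h2, one_div] at h3
  calc _ ≤ Real.exp (σ * t) * (σ⁻¹ ^ α * Real.Gamma α) :=
        mul_le_mul_of_nonneg_left h3 (Real.exp_pos _).le
    _ = _ := by ring

/-- In the norm weighted by `e^(-σt)` fractional integration has norm at most `σ^(-α)`, which is
small for large `σ`. Both the Gronwall bound and the convergence of the Picard iteration rest on
this. -/
lemma norm_rlInt_le {α σ t M : ℝ} (hα : 0 < α) (hσ : 0 < σ) (ht : 0 ≤ t) (hM : 0 ≤ M)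
    {f : ℝ → V} (hf : ∀ τ ∈ Ioo 0 t, ‖f τ‖ ≤ M * Real.exp (σ * τ)) :
    ‖rlInt α f t‖ ≤ M * σ⁻¹ ^ α * Real.exp (σ * t) := by
  have hΓ := Real.Gamma_pos_of_pos hα
  rw [rlInt, norm_smul, norm_inv, Real.norm_of_nonneg hΓ.le]
  have hbi : IntervalIntegrable (fun τ : ℝ => (t - τ) ^ (α - 1) * Real.exp (σ * τ)) volume 0 t :=
    (intervalIntegrable_rpow_sub hα t).mul_continuousOn (by fun_prop)
  have h1 : ‖∫ τ in (0 : ℝ)..t, (t - τ) ^ (α - 1) • f τ‖ ≤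
      ∫ τ in (0 : ℝ)..t, M * ((t - τ) ^ (α - 1) * Real.exp (σ * τ)) := by
    refine intervalIntegral.norm_integral_le_of_norm_le ht ?_ (hbi.const_mul M)
    filter_upwards [compl_mem_ae_iff.mpr (measure_singleton t)] with τ hτt hτ
    have hτ' : τ ∈ Ioo 0 t := ⟨hτ.1, lt_of_le_of_ne hτ.2 hτt⟩
    have hp : 0 ≤ (t - τ) ^ (α - 1) := Real.rpow_nonneg (by linarith [hτ.2]) _
    rw [norm_smul, Real.norm_of_nonneg hp, mul_left_comm]
    exact mul_le_mul_of_nonneg_left (hf τ hτ') hp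
  rw [intervalIntegral.integral_const_mul] at h1
  have h2 := mul_le_mul_of_nonneg_left (integral_rpow_mul_exp_le hα hσ ht) hM
  rw [inv_mul_le_iff₀ hΓ]
  calc _ ≤ _ := h1.trans h2
    _ = _ := by ring

lemma rlInt_zero_right {α : ℝ} (f : ℝ → V) : rlInt α f 0 = 0 := by simp [rlInt]

/-- A Gronwall bound in an exponentially weighted norm. -/
lemma norm_le_of_volterra {α σ c : ℝ} (hα : 0 < α) (hσ : 0 < σ) {L : V →L[ℝ] V}
    (hL : ‖L‖ * σ⁻¹ ^ α ≤ 1 / 2) {y p : ℝ → V} (hy : ContinuousOn y (Ici 0))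
    (hp : ∀ t, 0 ≤ t → ‖p t‖ ≤ c * Real.exp (σ * t))
    (heq : ∀ t, 0 ≤ t → y t = p t + rlInt α (fun τ => L (y τ)) t) :
    ∀ t, 0 ≤ t → ‖y t‖ ≤ 2 * c * Real.exp (σ * t) := by
  intro T hT
  -- At a maximum `m` of the weighted norm on `[0, T]` the equation yields `m ≤ c + m / 2`.
  obtain ⟨s, hs, hmax⟩ := isCompact_Icc.exists_isMaxOn (nonempty_Icc.mpr hT)
    (f := fun t => Real.exp (-(σ * t)) * ‖y t‖)
    ((by fun_prop : Continuous fun t => Real.exp (-(σ * t))).continuousOn.mul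
      (hy.mono Icc_subset_Ici_self).norm)
  set m := Real.exp (-(σ * s)) * ‖y s‖ with hm
  have hm0 : 0 ≤ m := by positivity
  have hym : ∀ t ∈ Icc 0 T, ‖y t‖ ≤ m * Real.exp (σ * t) := fun t ht => by
    have h := hmax ht
    simp only [mem_ofPred_eq] at h
    calc ‖y t‖ = (Real.exp (-(σ * t)) * ‖y t‖) * Real.exp (σ * t) := by
          rw [mul_right_comm, ← Real.exp_add]; simp
      _ ≤ m * Real.exp (σ * t) := mul_le_mul_of_nonneg_right h (Real.exp_pos _).le
  have h1 : ‖rlInt α (fun τ => L (y τ)) s‖ ≤ (‖L‖ * m) * σ⁻¹ ^ α * Real.exp (σ * s) := by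
    refine norm_rlInt_le hα hσ hs.1 (by positivity) fun τ hτ => ?_
    rw [mul_assoc]
    exact (L.le_opNorm _).trans (mul_le_mul_of_nonneg_left
      (hym τ ⟨hτ.1.le, hτ.2.le.trans hs.2⟩) (norm_nonneg _))
  have h2 : ‖y s‖ ≤ (c + 1 / 2 * m) * Real.exp (σ * s) := by
    have h3 : (‖L‖ * m) * σ⁻¹ ^ α * Real.exp (σ * s) ≤ 1 / 2 * m * Real.exp (σ * s) := by
      have := mul_le_mul_of_nonneg_right hL (mul_nonneg hm0 (Real.exp_pos (σ * s)).le)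
      calc _ = ‖L‖ * σ⁻¹ ^ α * (m * Real.exp (σ * s)) := by ring
        _ ≤ _ := this
        _ = _ := by ring
    have h4 : ‖y s‖ ≤ ‖p s‖ + ‖rlInt α (fun τ => L (y τ)) s‖ := by
      conv_lhs => rw [heq s hs.1]
      exact norm_add_le _ _
    have := hp s hs.1
    linarith
  have h5 : m ≤ c + 1 / 2 * m := by
    calc m ≤ Real.exp (-(σ * s)) * ((c + 1 / 2 * m) * Real.exp (σ * s)) :=
          mul_le_mul_of_nonneg_left h2 (Real.exp_pos _).le
      _ = c + 1 / 2 * m := by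
          rw [mul_left_comm, ← Real.exp_add]; simp
  calc ‖y T‖ ≤ m * Real.exp (σ * T) := hym T ⟨hT, le_rfl⟩
    _ ≤ _ := mul_le_mul_of_nonneg_right (by linarith) (Real.exp_pos _).le

lemma exists_weight {α : ℝ} (hα : 0 < α) (b : ℝ) :
    ∃ σ₀ : ℝ, 0 < σ₀ ∧ ∀ σ, σ₀ ≤ σ → b * σ⁻¹ ^ α ≤ 1 / 2 := by
  have h : Tendsto (fun σ : ℝ => b * σ⁻¹ ^ α) atTop (𝓝 (b * 0)) := by
    refine Tendsto.const_mul b ?_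
    have h0 := (Real.continuousAt_rpow_const 0 α (Or.inr hα.le)).tendsto
    rw [Real.zero_rpow hα.ne'] at h0
    exact h0.comp tendsto_inv_atTop_zero
  rw [mul_zero] at h
  obtain ⟨σ₀, h0⟩ := eventually_atTop.mp (h.eventually (ge_mem_nhds (by norm_num : (0 : ℝ) < 1 / 2)))
  exact ⟨max σ₀ 1, by positivity, fun σ hσ => h0 σ ((le_max_left _ _).trans hσ)⟩

/-- The Riemann-Liouville integral of a function on the line, in a form that is continuous on the
line. -/
noncomputable def rlExt (α : ℝ) (f : ℝ → V) (t : ℝ) : V :=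
  ((Real.Gamma α)⁻¹ * t ^ α) • ∫ u in (0 : ℝ)..1, (1 - u) ^ (α - 1) • f (t * u)

lemma rlExt_eq {α : ℝ} (hα : 0 < α) (f : ℝ → V) {t : ℝ} (ht : 0 ≤ t) :
    rlExt α f t = rlInt α f t := by
  rcases ht.eq_or_lt with rfl | ht
  · simp [rlInt, rlExt, Real.zero_rpow hα.ne']
  · have h := intervalIntegral.smul_integral_comp_mul_left (a := 0) (b := 1)
      (fun τ => (t - τ) ^ (α - 1) • f τ) t
    rw [mul_zero, mul_one] at h
    rw [rlInt, rlExt, ← h, mul_smul]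
    congr 1
    rw [← intervalIntegral.integral_smul, ← intervalIntegral.integral_smul]
    refine integral_congr_Ioo zero_le_one fun u hu => ?_
    rw [show t - t * u = t * (1 - u) by ring, Real.mul_rpow ht.le (by linarith [hu.2]),
      smul_smul, smul_smul]
    congr 1
    rw [show α = 1 + (α - 1) by ring, Real.rpow_add ht, Real.rpow_one]
    simp only [add_sub_cancel_left]
    ring

lemma continuous_rlExt {α : ℝ} (hα : 1 ≤ α) {f : ℝ → V} (hf : Continuous f) :
    Continuous (rlExt α f) := by
  refine Continuous.smul (continuous_const.mul
    (Real.continuous_rpow_const (by linarith))) ?_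
  refine intervalIntegral.continuous_parametric_intervalIntegral_of_continuous' ?_ 0 1
  refine Continuous.smul ?_ (hf.comp (by fun_prop))
  exact (Real.continuous_rpow_const (by linarith : 0 ≤ α - 1)).comp (by fun_prop)

/-- Linear Volterra equations of the second kind are solvable. -/
lemma exists_volterra_solution [CompleteSpace V] {α : ℝ} (hα : 1 ≤ α) (L : V →L[ℝ] V) {f : ℝ → V}
    (hf : Continuous f) :
    ∃ w : ℝ → V, Continuous w ∧ ∀ t, 0 ≤ t → w t = f t + L (rlInt α w t) := by
  have hα0 : 0 < α := by linarith
  obtain ⟨σ, hσ, hw⟩ := exists_weight hα0 ‖L‖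
  specialize hw σ le_rfl
  -- The terms `(L I^α)^k f` of the Neumann series; with the weight chosen above, each step halves
  -- the weighted bound.
  let w : ℕ → ℝ → V := fun k => (fun g t => L (rlExt α g t))^[k] f
  have hws : ∀ k, w (k + 1) = fun t => L (rlExt α (w k) t) := fun k =>
    Function.iterate_succ_apply' _ k f
  have hwc : ∀ k, Continuous (w k) := fun k => by
    induction k with
    | zero => exact hf
    | succ k ih =>
      rw [hws]
      exact L.continuous.comp (continuous_rlExt hα ih)
  have hbd : ∀ T, 0 ≤ T → ∃ M, 0 ≤ M ∧ ∀ k, ∀ t ∈ Icc 0 T,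
      ‖w k t‖ ≤ M * (1 / 2) ^ k * Real.exp (σ * t) := by
    intro T hT
    obtain ⟨M, hM⟩ := isCompact_Icc.exists_bound_of_continuousOn (s := Icc 0 T) hf.continuousOn
    have hM0 : 0 ≤ M := (norm_nonneg _).trans (hM 0 ⟨le_rfl, hT⟩)
    refine ⟨M, hM0, fun k => ?_⟩
    induction k with
    | zero =>
      intro t ht
      have h1 : 1 ≤ Real.exp (σ * t) := Real.one_le_exp (mul_nonneg hσ.le ht.1)
      have h2 := hM t ht
      simp only [pow_zero, mul_one]
      exact h2.trans (le_mul_of_one_le_right hM0 h1)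
    | succ k ih =>
      intro t ht
      rw [hws]
      simp only [rlExt_eq hα0 _ ht.1]
      have h1 := norm_rlInt_le hα0 hσ ht.1 (by positivity)
        (fun τ hτ => ih τ ⟨hτ.1.le, hτ.2.le.trans ht.2⟩)
      refine (L.le_opNorm _).trans ?_
      calc ‖L‖ * ‖rlInt α (w k) t‖ ≤ ‖L‖ * (M * (1 / 2) ^ k * σ⁻¹ ^ α * Real.exp (σ * t)) :=
            mul_le_mul_of_nonneg_left h1 (norm_nonneg _)
        _ = (‖L‖ * σ⁻¹ ^ α) * (M * (1 / 2) ^ k * Real.exp (σ * t)) := by ring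
        _ ≤ 1 / 2 * (M * (1 / 2) ^ k * Real.exp (σ * t)) :=
            mul_le_mul_of_nonneg_right hw (by positivity)
        _ = _ := by ring
  have hgeo : ∀ M : ℝ, Summable fun k : ℕ => M * (1 / 2 : ℝ) ^ k := fun M =>
    (summable_geometric_of_lt_one (by norm_num) (by norm_num)).mul_left M
  -- The bounds hold only for nonnegative times; freezing the argument at `0` makes the sum
  -- continuous on the whole line.
  let S : ℝ → V := fun t => ∑' k, w k (max t 0)
  have hSsum : ∀ t, 0 ≤ t → HasSum (fun k => w k t) (S t) := by
    intro t ht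
    obtain ⟨M, hM0, hM⟩ := hbd t ht
    have : Summable fun k => w k t := by
      refine Summable.of_norm_bounded ((hgeo M).mul_right (Real.exp (σ * t))) fun k => ?_
      exact hM k t ⟨ht, le_rfl⟩
    simpa [S, max_eq_left ht] using this.hasSum
  have hSc : Continuous S := by
    rw [continuous_iff_continuousAt]
    intro t₀
    set T := max t₀ 0 + 1
    have hT : 0 ≤ T := by positivity
    obtain ⟨M, hM0, hM⟩ := hbd T hT
    have hon : ContinuousOn S (Iio T) := by
      refine continuousOn_tsum (u := fun k => M * (1 / 2) ^ k * Real.exp (σ * T))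
        (fun k => ((hwc k).comp (by fun_prop)).continuousOn)
        ((hgeo M).mul_right _) fun k t ht => ?_
      have hmT : max t 0 ≤ T := max_le (le_of_lt ht) hT
      refine (hM k _ ⟨le_max_right _ _, hmT⟩).trans ?_
      gcongr
    refine hon.continuousAt (Iio_mem_nhds ?_)
    have := le_max_left t₀ 0
    simp only [T]
    linarith
  refine ⟨S, hSc, fun t ht => ?_⟩
  obtain ⟨M, hM0, hM⟩ := hbd t ht
  have hint : HasSum (fun k => rlInt α (w k) t) (rlInt α S t) := by
    refine HasSum.const_smul _ ?_
    refine intervalIntegral.hasSum_integral_of_dominated_convergence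
      (bound := fun k τ => (M * (1 / 2) ^ k) * ((t - τ) ^ (α - 1) * Real.exp (σ * τ))) ?_ ?_ ?_ ?_ ?_
    · intro k
      refine Continuous.aestronglyMeasurable (Continuous.smul ?_ (hwc k))
      exact (Real.continuous_rpow_const (by linarith : 0 ≤ α - 1)).comp (by fun_prop)
    · intro k
      refine Eventually.of_forall fun τ hτ => ?_
      rw [uIoc_of_le ht] at hτ
      have hp : 0 ≤ (t - τ) ^ (α - 1) := Real.rpow_nonneg (by linarith [hτ.2]) _
      rw [norm_smul, Real.norm_of_nonneg hp, mul_left_comm]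
      exact mul_le_mul_of_nonneg_left (hM k τ ⟨hτ.1.le, hτ.2⟩) hp
    · exact Eventually.of_forall fun τ _ => (hgeo M).mul_right _
    · simp only [tsum_mul_right]
      refine IntervalIntegrable.const_mul ?_ _
      exact (intervalIntegrable_rpow_sub hα0 t).mul_continuousOn (by fun_prop)
    · refine Eventually.of_forall fun τ hτ => ?_
      rw [uIoc_of_le ht] at hτ
      exact (hSsum τ hτ.1.le).const_smul _
  have h1 := L.hasSum hint
  have h2 := hSsum t ht
  -- Applying `L I^α` termwise shifts the series by one, which is the fixed point equation.
  have h3 : HasSum (fun k => w (k + 1) t) (L (rlInt α S t)) := by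
    simpa only [hws, rlExt_eq hα0 _ ht] using h1
  have h4 := (hasSum_nat_add_iff' (f := fun k => w k t) 1).mpr h2
  rw [Finset.sum_range_one] at h4
  have h5 := h4.unique h3
  rw [← h5]
  simp [w]

end Volterra

end SFOS

/-! ### Caputo equations, regularity and freedom from impulses -/

namespace SFOS

open MeasureTheory Set Filter Topology

section Caputo

variable {V W : Type*} [NormedAddCommGroup V] [NormedSpace ℝ V] [NormedAddCommGroup W]
  [NormedSpace ℝ W]

lemma iteratedDeriv_two_clm (L : V →L[ℝ] W) {f : ℝ → V} {t : ℝ} (hf : ContDiffAt ℝ 2 f t) :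
    iteratedDeriv 2 (fun τ => L (f τ)) t = L (iteratedDeriv 2 f t) := by
  have := L.iteratedFDeriv_comp_left hf (i := 2) le_rfl
  simp only [iteratedDeriv]
  rw [show (fun τ => L (f τ)) = L ∘ f from rfl, this]
  rfl

lemma iteratedDeriv_two_eq (f : ℝ → V) : iteratedDeriv 2 f = deriv (deriv f) := by
  rw [iteratedDeriv_succ, iteratedDeriv_one]

lemma continuousOn_iteratedDeriv_two {f : ℝ → V} (hf : ContDiffOn ℝ 2 f (Ioi 0)) :
    ContinuousOn (iteratedDeriv 2 f) (Ioi 0) := by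
  rw [iteratedDeriv_two_eq]
  have h1 : ContDiffOn ℝ 1 (deriv f) (Ioi 0) :=
    hf.deriv_of_isOpen isOpen_Ioi (by norm_num)
  exact h1.continuousOn_deriv_of_isOpen isOpen_Ioi le_rfl

/-- A function is recovered from its second derivative. -/
lemma rlInt_rlInt_iteratedDeriv_two [CompleteSpace V] {α t : ℝ} (h₁ : 0 < α) (h₂ : α < 2)
    (ht : 0 < t) {x : ℝ → V} (hx₁ : ContDiffOn ℝ 1 x (Ici 0)) (hx₂ : ContDiffOn ℝ 2 x (Ioi 0))
    (hi : ∀ T : ℝ, 0 < T → IntegrableOn (iteratedDeriv 2 x) (Ioc 0 T)) :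
    rlInt α (rlInt (2 - α) (iteratedDeriv 2 x)) t =
      x t - (x 0 + t • derivWithin x (Ici 0) 0) := by
  set v := derivWithin x (Ici 0) with hv
  have hvc : ContinuousOn v (Ici 0) := hx₁.continuousOn_derivWithin (uniqueDiffOn_Ici 0) le_rfl
  have hvd : ∀ τ, 0 < τ → v τ = deriv x τ := fun τ hτ =>
    derivWithin_of_mem_nhds (Ici_mem_nhds hτ)
  have hv' : ∀ τ, 0 < τ → HasDerivAt v (iteratedDeriv 2 x τ) τ := fun τ hτ => by
    have h1 : ContDiffOn ℝ 1 (deriv x) (Ioi 0) :=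
      hx₂.deriv_of_isOpen isOpen_Ioi (by norm_num)
    have h2 : DifferentiableAt ℝ (deriv x) τ :=
      (h1.differentiableOn one_ne_zero).differentiableAt (Ioi_mem_nhds hτ)
    rw [iteratedDeriv_two_eq]
    refine h2.hasDerivAt.congr_of_eventuallyEq ?_
    filter_upwards [Ioi_mem_nhds hτ] with σ hσ using hvd σ hσ
  have hx' : ∀ τ, 0 < τ → HasDerivAt x (v τ) τ := fun τ hτ => by
    rw [hvd τ hτ]
    exact ((hx₁.differentiableOn one_ne_zero).differentiableAt (Ici_mem_nhds hτ)).hasDerivAt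
  have e1 : ∀ τ, 0 < τ → rlInt 1 (iteratedDeriv 2 x) τ = v τ - v 0 := fun τ hτ => by
    rw [rlInt_one]
    exact intervalIntegral.integral_eq_sub_of_hasDerivAt_of_le hτ.le
      (hvc.mono Icc_subset_Ici_self) (fun σ hσ => hv' σ hσ.1)
      ((intervalIntegrable_iff_integrableOn_Ioc_of_le hτ.le).mpr (hi τ hτ))
  have hvi : IntervalIntegrable v volume 0 t :=
    (hvc.mono (by rw [uIcc_of_le ht.le]; exact Icc_subset_Ici_self)).intervalIntegrable
  -- `I^α I^(2-α) = I² = I¹ I¹`, after which the fundamental theorem of calculus is applied twice.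
  rw [rlInt_rlInt h₁ (by linarith) (by linarith) ht (hi t ht),
    show α + (2 - α) = 1 + 1 by ring, ← rlInt_rlInt one_pos one_pos (by norm_num) ht (hi t ht),
    rlInt_congr (g := fun τ => v τ - v 0) ht.le (fun τ hτ => e1 τ hτ.1), rlInt_one,
    intervalIntegral.integral_sub hvi intervalIntegrable_const,
    intervalIntegral.integral_eq_sub_of_hasDerivAt_of_le ht.le
      (hx₁.continuousOn.mono Icc_subset_Ici_self) (fun σ hσ => hx' σ hσ.1) hvi]
  simp [sub_sub]

/-- The function with a prescribed continuous second derivative and value `0` at `0`. -/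
lemma exists_iteratedDeriv_two_eq [CompleteSpace V] {w : ℝ → V} (hw : Continuous w) (y₁ : V) :
    ∃ y : ℝ → V, ContDiff ℝ 2 y ∧ iteratedDeriv 2 y = w ∧
      ∀ t, 0 < t → y t = t • y₁ + rlInt 2 w t := by
  let v : ℝ → V := fun s => y₁ + ∫ τ in (0 : ℝ)..s, w τ
  have hv : ∀ s, HasDerivAt v (w s) s := fun s =>
    (intervalIntegral.integral_hasDerivAt_right (hw.intervalIntegrable _ _)
      (hw.stronglyMeasurableAtFilter _ _) hw.continuousAt).const_add y₁
  have hvc : Continuous v := continuous_iff_continuousAt.mpr fun s => (hv s).continuousAt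
  let y : ℝ → V := fun t => ∫ s in (0 : ℝ)..t, v s
  have hy : ∀ t, HasDerivAt y (v t) t := fun t =>
    intervalIntegral.integral_hasDerivAt_right (hvc.intervalIntegrable _ _)
      (hvc.stronglyMeasurableAtFilter _ _) hvc.continuousAt
  have hdy : deriv y = v := funext fun t => (hy t).deriv
  have hdv : deriv v = w := funext fun t => (hv t).deriv
  have hv1 : ContDiff ℝ 1 v := contDiff_one_iff_deriv.mpr
    ⟨fun s => (hv s).differentiableAt, by rw [hdv]; exact hw⟩
  refine ⟨y, ?_, ?_, fun t ht => ?_⟩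
  · rw [show (2 : WithTop ℕ∞) = 1 + 1 by norm_num, contDiff_succ_iff_deriv]
    exact ⟨fun t => (hy t).differentiableAt, by simp, by rw [hdy]; exact hv1⟩
  · rw [iteratedDeriv_two_eq, hdy, hdv]
  · have hwi : Continuous fun s => ∫ τ in (0 : ℝ)..s, w τ := by
      have : (fun s => ∫ τ in (0 : ℝ)..s, w τ) = fun s => v s - y₁ := by
        ext s; simp [v]
      rw [this]
      exact hvc.sub continuous_const
    have h1 : rlInt 2 w t = ∫ s in (0 : ℝ)..t, ∫ τ in (0 : ℝ)..s, w τ := by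
      rw [show (2 : ℝ) = 1 + 1 by norm_num, ← rlInt_rlInt one_pos one_pos (by norm_num) ht
        hw.integrableOn_Ioc, rlInt_one]
      simp only [rlInt_one]
    rw [h1]
    simp only [y, v]
    rw [intervalIntegral.integral_add intervalIntegrable_const (hwi.intervalIntegrable _ _)]
    simp

lemma rlInt_const [CompleteSpace V] {β t : ℝ} (hβ : 0 < β) (ht : 0 < t) (v : V) :
    rlInt β (fun _ => v) t = ((Real.Gamma (β + 1))⁻¹ * t ^ β) • v := by
  have h : ∫ τ in (0 : ℝ)..t, (t - τ) ^ (β - 1) = t ^ β / β := by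
    rw [intervalIntegral.integral_comp_sub_left (fun u => u ^ (β - 1)) t, sub_self, sub_zero,
      integral_rpow (Or.inl (by linarith)), sub_add_cancel, Real.zero_rpow hβ.ne', sub_zero]
  rw [rlInt, intervalIntegral.integral_smul_const, h, smul_smul, Real.Gamma_add_one hβ.ne']
  congr 1
  have := (Real.Gamma_pos_of_pos hβ).ne'
  field_simp

lemma rlIntegrable_of_continuous {β t : ℝ} (hβ : 0 < β) (ht : 0 < t) {f : ℝ → V}
    (hf : Continuous f) : RLIntegrable β f t :=
  rlIntegrable_of_continuousOn hβ ht hf.integrableOn_Ioc hf.continuousOn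

/-- Solvability of `D^α y = L y + I² G` with `y(0) = 0` and `y'(0) = y₁`. -/
lemma exists_caputo_solution [CompleteSpace V] {α : ℝ} (h₁ : 1 < α) (h₂ : α < 2) (L : V →L[ℝ] V)
    {G : ℝ → V} (hG : Continuous G) (y₁ : V) :
    ∃ y : ℝ → V, ContDiff ℝ 2 y ∧ (∀ t, 0 < t → y t = t • y₁ + rlInt 2 (iteratedDeriv 2 y) t) ∧
      ∀ t, 0 < t → rlInt (2 - α) (iteratedDeriv 2 y) t = L (y t) + rlInt 2 G t := by
  have hα0 : 0 < α := by linarith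
  have hβ : 0 < 2 - α := by linarith
  -- The second derivative `w = y''` is sought from `w = I^α G + q + L I^α w`, where `q = I^(α-1)(L
  -- y₁)`. Applying `I^(2-α)` turns the right side into `I² G + t L y₁ + L I² w = L y + I² G`. With
  -- `y(0) = 0` no singular term `t^(α-2)` appears, so `w` is continuous.
  let q : ℝ → V := fun t => ((Real.Gamma (α - 1 + 1))⁻¹ * t ^ (α - 1)) • L y₁
  have hq : Continuous q := (continuous_const.mul
    (Real.continuous_rpow_const (by linarith))).smul continuous_const
  have hr := continuous_rlExt h₁.le hG
  obtain ⟨w, hw, hweq⟩ := exists_volterra_solution h₁.le L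
    (f := fun t => rlExt α G t + q t) (hr.add hq)
  obtain ⟨y, hy, hyw, hyt⟩ := exists_iteratedDeriv_two_eq hw y₁
  refine ⟨y, hy, by rwa [hyw], fun t ht => ?_⟩
  have hwr := continuous_rlExt h₁.le hw
  have hRI : ∀ {f : ℝ → V}, Continuous f → RLIntegrable (2 - α) f t := fun hf =>
    rlIntegrable_of_continuous hβ ht hf
  have hext : ∀ {f : ℝ → V}, Continuous f →
      rlInt (2 - α) (rlExt α f) t = rlInt 2 f t := fun {f} hf => by
    rw [rlInt_congr (g := rlInt α f) ht.le (fun τ hτ => rlExt_eq hα0 f hτ.1.le),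
      rlInt_rlInt hβ hα0 (by linarith) ht hf.integrableOn_Ioc]
    congr 1
    ring
  have hqe : rlInt (2 - α) q t = t • L y₁ := by
    rw [rlInt_congr (g := rlInt (α - 1) fun _ => L y₁) ht.le
      (fun τ hτ => (rlInt_const (by linarith) hτ.1 _).symm),
      rlInt_rlInt hβ (by linarith) (by linarith) ht continuous_const.integrableOn_Ioc,
      show 2 - α + (α - 1) = 1 by ring, rlInt_one]
    simp
  rw [hyw, rlInt_congr (g := fun τ => (rlExt α G τ + q τ) + L (rlExt α w τ)) ht.le
    (fun τ hτ => by rw [hweq τ hτ.1.le, rlExt_eq hα0 w hτ.1.le]),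
    rlInt_add (f := fun τ => rlExt α G τ + q τ) (g := fun τ => L (rlExt α w τ))
      (hRI (hr.add hq)) (hRI (L.continuous.comp hwr)), rlInt_add (hRI hr) (hRI hq),
    rlInt_clm L (hRI hwr), hext hG, hext hw, hqe, hyt t ht, map_add, map_smul]
  abel

end Caputo

/-- Multiplication by a matrix as a continuous linear map. -/
noncomputable def mulVecCLM {n : ℕ} (M : Matrix (Fin n) (Fin n) ℝ) :
    (Fin n → ℝ) →L[ℝ] (Fin n → ℝ) := M.mulVecLin.toContinuousLinearMap

@[simp] lemma mulVecCLM_apply {n : ℕ} (M : Matrix (Fin n) (Fin n) ℝ) (v : Fin n → ℝ) :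
    mulVecCLM M v = M.mulVec v := rfl

section Solutions

variable {n : ℕ} {E A : Matrix (Fin n) (Fin n) ℝ} {α : ℝ}

lemma mulVec_caputoDeriv (h₂ : α < 2) (M : Matrix (Fin n) (Fin n) ℝ) {x : ℝ → Fin n → ℝ}
    (hx : ContDiffOn ℝ 2 x (Ioi 0))
    (hi : ∀ T : ℝ, 0 < T → IntegrableOn (iteratedDeriv 2 x) (Ioc 0 T)) {t : ℝ} (ht : 0 < t) :
    M.mulVec (caputoDeriv α x t) =
      rlInt (2 - α) (fun τ => M.mulVec (iteratedDeriv 2 x τ)) t := by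
  rw [caputoDeriv_eq_rlInt, ← mulVecCLM_apply, ← rlInt_clm (mulVecCLM M)
    (rlIntegrable_of_continuousOn (by linarith) ht (hi t ht) (continuousOn_iteratedDeriv_two hx))]
  rfl

lemma isSolution_of_contDiff {g x : ℝ → Fin n → ℝ} (hx : ContDiff ℝ 2 x)
    (h : ∀ t : ℝ, 0 < t → E.mulVec (caputoDeriv α x t) = A.mulVec (x t) + g t) :
    IsSolution E A α g x :=
  ⟨(hx.of_le (by norm_num)).contDiffOn, hx.contDiffOn, fun T _ => by
    have : Continuous (iteratedDeriv 2 x) := hx.continuous_iteratedDeriv 2 le_rfl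
    exact this.integrableOn_Ioc, h⟩

lemma IsSolution.sub (h₂ : α < 2) {g x y : ℝ → Fin n → ℝ} (hx : IsSolution E A α g x)
    (hy : IsSolution E A α g y) : IsSolution E A α 0 (fun t => x t - y t) := by
  have hd : ∀ τ, 0 < τ → iteratedDeriv 2 (fun t => x t - y t) τ =
      iteratedDeriv 2 x τ - iteratedDeriv 2 y τ := fun τ hτ =>
    iteratedDeriv_fun_sub (hx.contDiffOn_two.contDiffAt (Ioi_mem_nhds hτ))
      (hy.contDiffOn_two.contDiffAt (Ioi_mem_nhds hτ))
  refine ⟨hx.contDiffOn_one.sub hy.contDiffOn_one, hx.contDiffOn_two.sub hy.contDiffOn_two,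
    fun T hT => ?_, fun t ht => ?_⟩
  · exact ((hx.integrable T hT).sub (hy.integrable T hT)).congr_fun
      (fun τ hτ => (hd τ hτ.1).symm) measurableSet_Ioc
  · have hi : ∀ {z : ℝ → Fin n → ℝ}, IsSolution E A α g z →
        RLIntegrable (2 - α) (iteratedDeriv 2 z) t := fun hz =>
      rlIntegrable_of_continuousOn (by linarith) ht (hz.integrable t ht)
        (continuousOn_iteratedDeriv_two hz.contDiffOn_two)
    have hc : caputoDeriv α (fun t => x t - y t) t = caputoDeriv α x t - caputoDeriv α y t := by
      rw [caputoDeriv_eq_rlInt, caputoDeriv_eq_rlInt, caputoDeriv_eq_rlInt,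
        rlInt_congr ht.le (fun τ hτ => hd τ hτ.1), rlInt, rlInt, rlInt, ← smul_sub,
        ← intervalIntegral.integral_sub (hi hx) (hi hy)]
      simp only [smul_sub]
    rw [hc, Matrix.mulVec_sub, hx.equation t ht, hy.equation t ht, Matrix.mulVec_sub]
    simp

namespace IsGroupDecomposition

variable {K B J : Matrix (Fin n) (Fin n) ℝ}

open Matrix in
/-- Solutions of the autonomous system solve a Volterra equation with the matrix `B - (1 - J)`. -/
lemma solution_eq_volterra (d : IsGroupDecomposition E A K B J) (h₁ : 1 < α) (h₂ : α < 2)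
    {x : ℝ → Fin n → ℝ} (hx : IsSolution E A α 0 x) :
    ∀ t, 0 ≤ t → x t = (x 0 + t • derivWithin x (Ici 0) 0) +
      rlInt α (fun τ => mulVecCLM (B - (1 - J)) (x τ)) t := by
  have hα0 : 0 < α := by linarith
  have hK : ∀ t, 0 < t → K *ᵥ caputoDeriv α x t = x t := fun t ht => by
    have h := hx.equation t ht
    rw [d.eq_mul, ← mulVec_mulVec, Pi.zero_apply, add_zero] at h
    have := congrArg (A⁻¹ *ᵥ ·) h
    simpa only [mulVec_mulVec, nonsing_inv_mul A d.isUnit, one_mulVec,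
      ← Matrix.mul_assoc, Matrix.one_mul] using this
  -- From `K D^α x = x` the solution stays in the range of `J`, hence so do its second derivative
  -- and its Caputo derivative; there `B` inverts `K`, and `C` agrees with `B`.
  have hJ : ∀ t, 0 < t → J *ᵥ x t = x t := fun t ht => by
    rw [← hK t ht, mulVec_mulVec, d.proj_mul]
  have hJ2 : ∀ τ, 0 < τ → J *ᵥ iteratedDeriv 2 x τ = iteratedDeriv 2 x τ := fun τ hτ => by
    have h1 : (fun t => mulVecCLM J (x t)) =ᶠ[𝓝 τ] x := by
      filter_upwards [Ioi_mem_nhds hτ] with σ hσ using hJ σ hσ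
    rw [← h1.iteratedDeriv_eq 2, iteratedDeriv_two_clm (mulVecCLM J)
      (hx.contDiffOn_two.contDiffAt (Ioi_mem_nhds hτ)), mulVecCLM_apply, mulVec_mulVec,
      d.proj_mul_proj]
  have hcap : ∀ t, 0 < t → caputoDeriv α x t = (B - (1 - J)) *ᵥ x t := fun t ht => by
    have h1 : J *ᵥ caputoDeriv α x t = caputoDeriv α x t := by
      rw [mulVec_caputoDeriv h₂ J hx.contDiffOn_two hx.integrable ht, caputoDeriv_eq_rlInt]
      exact rlInt_congr ht.le fun τ hτ => hJ2 τ hτ.1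
    rw [sub_mulVec, sub_mulVec, one_mulVec, hJ t ht, sub_self, sub_zero, ← h1, ← d.inv_mul,
      ← mulVec_mulVec, hK t ht]
  intro t ht
  rcases ht.eq_or_lt with rfl | ht
  · simp [rlInt_zero_right]
  have h := rlInt_rlInt_iteratedDeriv_two hα0 h₂ ht hx.contDiffOn_one hx.contDiffOn_two
    hx.integrable
  rw [rlInt_congr (g := fun τ => mulVecCLM (B - (1 - J)) (x τ)) ht.le (fun τ hτ => by
    rw [← caputoDeriv_eq_rlInt, hcap τ hτ.1, mulVecCLM_apply])] at h
  rw [h]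
  abel

lemma solution_eq_zero (d : IsGroupDecomposition E A K B J) (h₁ : 1 < α) (h₂ : α < 2)
    {x : ℝ → Fin n → ℝ} (hx : IsSolution E A α 0 x) (h0 : x 0 = 0)
    (h0' : derivWithin x (Ici 0) 0 = 0) : ∀ t, 0 ≤ t → x t = 0 := by
  have hα0 : 0 < α := by linarith
  obtain ⟨σ, hσ, hw⟩ := exists_weight hα0 ‖mulVecCLM (B - (1 - J))‖
  intro t ht
  have := norm_le_of_volterra (c := 0) (p := fun _ => 0) hα0 hσ (hw σ le_rfl)
    hx.contDiffOn_one.continuousOn (by simp) (fun t ht => by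
      have := d.solution_eq_volterra h₁ h₂ hx t ht
      rwa [h0, h0', smul_zero, add_zero] at this) t ht
  simpa using this

open Matrix in
-- With `h = A⁻¹ g` the equation reads `K D^α x = x + h`. On the kernel of `K` it is algebraic, and
-- on the range of `J` it becomes `D^α y = C y + B h`; hence `x = J y - (1 - J) h`. Uniqueness is
-- the Gronwall bound for the difference of two solutions.
lemma regular (d : IsGroupDecomposition E A K B J) (h₁ : 1 < α) (h₂ : α < 2) :
    Regular E A α := by
  intro g hg hg0
  constructor
  · have hh : ContDiff ℝ 2 fun t => mulVecCLM A⁻¹ (g t) :=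
      (mulVecCLM A⁻¹).contDiff.comp (contDiff_infty.mp hg 2)
    set h : ℝ → Fin n → ℝ := fun t => mulVecCLM A⁻¹ (g t) with hh_def
    have hF : ContDiff ℝ 2 fun t => mulVecCLM B (h t) := (mulVecCLM B).contDiff.comp hh
    set F : ℝ → Fin n → ℝ := fun t => mulVecCLM B (h t) with hF_def
    have hF0 : ∀ t ≤ 0, F t = 0 := fun t ht => by simp [hF_def, hh_def, hg0 t ht]
    have hFd : Differentiable ℝ F := hF.differentiable two_ne_zero
    -- The derivative at `0` is computed from the left, where `F` vanishes. Together with `F(0) = 0`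
    -- this gives `F = I² F''` for positive times, the form of forcing that `exists_caputo_solution`
    -- accepts.
    have hF' : derivWithin F (Ici 0) 0 = 0 := by
      rw [(hFd 0).derivWithin (uniqueDiffOn_Ici 0 0 self_mem_Ici),
        ← (hFd 0).derivWithin (uniqueDiffOn_Iic 0 0 self_mem_Iic)]
      rw [derivWithin_congr (s := Iic 0) (f := fun _ => (0 : Fin n → ℝ)) (fun t ht => hF0 t ht) (hF0 0 le_rfl)]
      simp
    have hG : Continuous (iteratedDeriv 2 F) := hF.continuous_iteratedDeriv 2 le_rfl
    have hFI : ∀ t, 0 < t → rlInt 2 (iteratedDeriv 2 F) t = F t := fun t ht => by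
      have := rlInt_rlInt_iteratedDeriv_two (x := F) one_pos one_lt_two ht
        (hF.of_le (by norm_num)).contDiffOn hF.contDiffOn (fun T _ => hG.integrableOn_Ioc)
      rw [hF', hF0 0 le_rfl, rlInt_rlInt one_pos (by norm_num) (by norm_num) ht
        hG.integrableOn_Ioc] at this
      simpa [show (1 : ℝ) + (2 - 1) = 2 by norm_num] using this
    obtain ⟨y, hy, -, hyc⟩ := exists_caputo_solution h₁ h₂ (mulVecCLM (B - (1 - J))) hG 0
    have hyw : Continuous (iteratedDeriv 2 y) := hy.continuous_iteratedDeriv 2 le_rfl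
    let x : ℝ → Fin n → ℝ := fun t => mulVecCLM J (y t) - mulVecCLM (1 - J) (h t)
    have hxJ : ContDiff ℝ 2 fun t => mulVecCLM J (y t) := (mulVecCLM J).contDiff.comp hy
    have hxR : ContDiff ℝ 2 fun t => mulVecCLM (1 - J) (h t) :=
      (mulVecCLM (1 - J)).contDiff.comp hh
    have hx : ContDiff ℝ 2 x := hxJ.sub hxR
    have hx2 : ∀ τ, iteratedDeriv 2 x τ =
        J *ᵥ iteratedDeriv 2 y τ - (1 - J) *ᵥ iteratedDeriv 2 h τ := fun τ => by
      rw [iteratedDeriv_fun_sub hxJ.contDiffAt hxR.contDiffAt,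
        iteratedDeriv_two_clm _ hy.contDiffAt, iteratedDeriv_two_clm _ hh.contDiffAt,
        mulVecCLM_apply, mulVecCLM_apply]
    refine ⟨x, isSolution_of_contDiff hx fun t ht => ?_⟩
    have hxi : Continuous (iteratedDeriv 2 x) := hx.continuous_iteratedDeriv 2 le_rfl
    have hKC : K * (B - (1 - J)) = J := by
      rw [Matrix.mul_sub, d.mul_inv, d.mul_compl, sub_zero]
    have hKx : K *ᵥ caputoDeriv α x t = J *ᵥ y t + J *ᵥ h t := by
      rw [mulVec_caputoDeriv h₂ K hx.contDiffOn (fun T _ => hxi.integrableOn_Ioc) ht,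
        rlInt_congr (g := fun τ => mulVecCLM K (iteratedDeriv 2 y τ)) ht.le (fun τ _ => by
          rw [hx2, mulVec_sub, mulVec_mulVec, mulVec_mulVec, d.mul_proj, d.mul_compl,
            zero_mulVec, sub_zero, mulVecCLM_apply]),
        rlInt_clm _ (rlIntegrable_of_continuous (by linarith) ht hyw), hyc t ht, hFI t ht,
        map_add, hF_def]
      simp only [mulVecCLM_apply, mulVec_mulVec, hKC, d.mul_inv]
    have hAh : A *ᵥ h t = g t := by
      simp only [hh_def, mulVecCLM_apply]
      rw [mulVec_mulVec, mul_nonsing_inv A d.isUnit, one_mulVec]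
    have hEx : E *ᵥ caputoDeriv α x t = A *ᵥ (K *ᵥ caputoDeriv α x t) := by
      rw [mulVec_mulVec, ← d.eq_mul]
    rw [hEx, hKx, ← hAh, ← mulVec_add A]
    congr 1
    simp only [x, mulVecCLM_apply, sub_mulVec, one_mulVec]
    abel
  · intro x y hx hy h0 h0' t ht
    have hd := hx.sub h₂ hy
    have e : derivWithin (fun t => x t - y t) (Ici 0) 0 = 0 := by
      rw [derivWithin_fun_sub (hx.contDiffOn_one.differentiableOn one_ne_zero 0 self_mem_Ici)
        (hy.contDiffOn_one.differentiableOn one_ne_zero 0 self_mem_Ici), h0', sub_self]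
    exact sub_eq_zero.mp (d.solution_eq_zero h₁ h₂ hd (by simp [h0]) e t ht)

open Matrix in
-- The response is `J w` with `w = J (x₀ + t x₁) + B I^α w`. Since `E J = E` and `E B = A J`, the
-- part of the data in the kernel of `K` never enters the integrated equation.
lemma impulseFree (d : IsGroupDecomposition E A K B J) (h₁ : 1 < α) :
    ImpulseFree E A α := by
  intro x₀ x₁
  have hα0 : 0 < α := by linarith
  obtain ⟨w, hw, hweq⟩ := exists_volterra_solution h₁.le (mulVecCLM B)
    (f := fun t => mulVecCLM J (x₀ + t • x₁)) (by fun_prop)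
  have hx : Continuous fun t => mulVecCLM J (w t) := (mulVecCLM J).continuous.comp hw
  refine ⟨fun t => mulVecCLM J (w t), fun T _ => hx.integrableOn_Ioc,
    (ae_restrict_iff' measurableSet_Ioi).mpr (Eventually.of_forall fun t ht => ?_)⟩
  have hwi := rlIntegrable_of_continuous hα0 ht hw
  have h1 : fracIntegral α (fun τ => A *ᵥ mulVecCLM J (w τ)) t = A *ᵥ J *ᵥ rlInt α w t := by
    rw [fracIntegral_eq_rlInt]
    simpa using rlInt_clm ((mulVecCLM A).comp (mulVecCLM J)) hwi
  rw [h1, hweq t (le_of_lt ht)]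
  simp only [mulVecCLM_apply, mulVec_add, mulVec_mulVec, ← Matrix.mul_assoc]
  have e1 : E * J = E := by rw [d.eq_mul, Matrix.mul_assoc, d.mul_proj]
  have e2 : E * B = A * J := by rw [d.eq_mul, Matrix.mul_assoc, d.mul_inv]
  rw [e1, e1, e2]

end IsGroupDecomposition

end Solutions

end SFOS

/-! ### Regularity and freedom from impulses bound the index -/

namespace SFOS

open MeasureTheory Set Filter Topology

section Index

variable {n : ℕ} {E A : Matrix (Fin n) (Fin n) ℝ} {α : ℝ}

open Matrix in
/-- If the pencil has index larger than one, then so has its transpose. -/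
lemma exists_functional_of_index {v w : Fin n → ℝ} (hv : v ≠ 0) (hEv : E *ᵥ v = 0)
    (hAv : A *ᵥ v = E *ᵥ w) :
    ∃ φ z : Module.Dual ℝ (Fin n → ℝ), φ ≠ 0 ∧ (∀ y, φ (E *ᵥ y) = 0) ∧
      ∀ y, φ (A *ᵥ y) = z (E *ᵥ y) := by
  let R := LinearMap.range E.mulVecLin
  let N := LinearMap.ker E.mulVecLin
  -- `A` induces a map from `ker E` to the cokernel of `E`, spaces of equal dimension. The vector
  -- `v` lies in its kernel, so it is not surjective and some nonzero functional on the cokernel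
  -- kills its range.
  let ψ : N →ₗ[ℝ] ((Fin n → ℝ) ⧸ R) := R.mkQ.comp (A.mulVecLin.comp N.subtype)
  have hfr : Module.finrank ℝ N = Module.finrank ℝ ((Fin n → ℝ) ⧸ R) := by
    have h1 := LinearMap.finrank_range_add_finrank_ker E.mulVecLin
    have h2 := R.finrank_quotient_add_finrank
    change _ + Module.finrank ℝ R = _ at h2
    change Module.finrank ℝ R + Module.finrank ℝ N = _ at h1
    omega
  have hinj : ¬ Function.Injective ψ := fun h => by
    have h0 : ψ ⟨v, by simpa [N] using hEv⟩ = 0 := by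
      simp only [ψ, LinearMap.comp_apply, Submodule.mkQ_apply, Submodule.Quotient.mk_eq_zero]
      exact ⟨w, by simpa using hAv.symm⟩
    exact hv (congrArg Subtype.val (h (h0.trans (map_zero ψ).symm)))
  have hsurj : LinearMap.range ψ < ⊤ := by
    rw [lt_top_iff_ne_top]
    intro h
    exact hinj ((LinearMap.injective_iff_surjective_of_finrank_eq_finrank hfr).mpr
      (LinearMap.range_eq_top.mp h))
  obtain ⟨f, hf0, hf⟩ := Submodule.exists_le_ker_of_lt_top _ hsurj
  have hφA : ∀ y ∈ N, f (R.mkQ (A *ᵥ y)) = 0 := fun y hy => hf ⟨⟨y, hy⟩, rfl⟩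
  -- The functional `φ A` vanishes on `ker E`, hence factors through `E`.
  have hz : (f.comp R.mkQ).comp A.mulVecLin ∈ LinearMap.range E.mulVecLin.dualMap := by
    rw [LinearMap.range_dualMap_eq_dualAnnihilator_ker, Submodule.mem_dualAnnihilator]
    exact hφA
  obtain ⟨z, hz⟩ := hz
  refine ⟨f.comp R.mkQ, z, fun h => hf0 ?_, fun y => ?_, fun y => ?_⟩
  · refine LinearMap.ext fun q => ?_
    obtain ⟨y, rfl⟩ := R.mkQ_surjective q
    exact LinearMap.congr_fun h y
  · have : R.mkQ (E *ᵥ y) = 0 := by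
      rw [Submodule.mkQ_apply, Submodule.Quotient.mk_eq_zero]
      exact ⟨y, rfl⟩
    rw [LinearMap.comp_apply, this, map_zero]
  · exact (LinearMap.congr_fun hz y).symm

lemma rlIntegrable_of_integrableOn {V : Type*} [NormedAddCommGroup V] [NormedSpace ℝ V] {f : ℝ → V}
    {t : ℝ} (hα : 1 ≤ α) (ht : 0 ≤ t) (hf : IntegrableOn f (Ioc 0 t)) : RLIntegrable α f t :=
  ((intervalIntegrable_iff_integrableOn_Ioc_of_le ht).mpr hf).continuousOn_smul
    ((Real.continuous_rpow_const (by linarith)).comp (by fun_prop)).continuousOn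

/-- For `α > 1` the kernel on `(0, t)` is at most `t^(α-1)`, so integrability of `f` suffices. -/
lemma tendsto_rlInt_zero {f : ℝ → ℝ} (hα : 1 < α) (hf : IntegrableOn f (Ioc 0 1)) :
    Tendsto (rlInt α f) (𝓝[>] 0) (𝓝 0) := by
  have hα0 : 0 < α := by linarith
  have hΓ := Real.Gamma_pos_of_pos hα0
  set M := ∫ τ in Ioc (0 : ℝ) 1, ‖f τ‖
  have hbd : ∀ t ∈ Ioo (0 : ℝ) 1, ‖rlInt α f t‖ ≤ (Real.Gamma α)⁻¹ * (t ^ (α - 1) * M) := by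
    intro t ht
    have hsub : Ioc 0 t ⊆ Ioc (0 : ℝ) 1 := Ioc_subset_Ioc_right ht.2.le
    rw [rlInt, norm_smul, norm_inv, Real.norm_of_nonneg hΓ.le]
    refine mul_le_mul_of_nonneg_left ?_ (inv_nonneg.mpr hΓ.le)
    have hfi : IntervalIntegrable f volume 0 t :=
      (intervalIntegrable_iff_integrableOn_Ioc_of_le ht.1.le).mpr (hf.mono_set hsub)
    have h1 : ‖∫ τ in (0 : ℝ)..t, (t - τ) ^ (α - 1) • f τ‖ ≤
        ∫ τ in (0 : ℝ)..t, t ^ (α - 1) * ‖f τ‖ := by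
      refine intervalIntegral.norm_integral_le_of_norm_le ht.1.le
        (Eventually.of_forall fun τ hτ => ?_) (hfi.norm.const_mul _)
      have : 0 ≤ t - τ := by linarith [hτ.2]
      rw [norm_smul, Real.norm_of_nonneg (Real.rpow_nonneg this _)]
      gcongr
      linarith [hτ.1]
    refine h1.trans ?_
    rw [intervalIntegral.integral_const_mul, intervalIntegral.integral_of_le ht.1.le]
    refine mul_le_mul_of_nonneg_left ?_ (Real.rpow_nonneg ht.1.le _)
    exact setIntegral_mono_set hf.norm (Eventually.of_forall fun τ => norm_nonneg _)
      hsub.eventuallyLE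
  have hlim : Tendsto (fun t : ℝ => (Real.Gamma α)⁻¹ * (t ^ (α - 1) * M)) (𝓝[>] 0) (𝓝 0) := by
    have h0 : Tendsto (fun t : ℝ => t ^ (α - 1)) (𝓝[>] 0) (𝓝 0) := by
      have := (Real.continuousAt_rpow_const 0 (α - 1) (Or.inr (by linarith))).tendsto
      rw [Real.zero_rpow (by linarith)] at this
      exact this.mono_left nhdsWithin_le_nhds
    simpa using (h0.mul_const M).const_mul (Real.Gamma α)⁻¹
  refine squeeze_zero_norm' ?_ hlim
  filter_upwards [Ioo_mem_nhdsGT (zero_lt_one' ℝ)] with t ht using hbd t ht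

lemma rlInt_pos_of_le {f : ℝ → ℝ} {m t : ℝ} (hα : 1 ≤ α) (ht : 0 < t) (hm : 0 < m)
    (hf : IntegrableOn f (Ioc 0 t)) (h : ∀ᵐ τ ∂(volume.restrict (Ioc 0 t)), m ≤ f τ) :
    0 < rlInt α f t := by
  have hα0 : 0 < α := by linarith
  have h1 : 0 < rlInt α (fun _ => m) t := by
    rw [rlInt_const hα0 ht, smul_eq_mul]
    have := Real.Gamma_pos_of_pos (by linarith : 0 < α + 1)
    have := Real.rpow_pos_of_pos ht α
    positivity
  refine h1.trans_le ?_
  refine mul_le_mul_of_nonneg_left ?_ (inv_nonneg.mpr (Real.Gamma_pos_of_pos hα0).le)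
  refine intervalIntegral.integral_mono_ae_restrict ht.le
    (rlIntegrable_of_integrableOn hα ht.le (integrableOn_const (by simp)))
    (rlIntegrable_of_integrableOn hα ht.le hf) ?_
  rw [restrict_Ioc_eq_restrict_Icc] at h
  filter_upwards [h, ae_restrict_mem measurableSet_Icc] with τ h1 h2
  exact mul_le_mul_of_nonneg_left h1 (Real.rpow_nonneg (by linarith [h2.2]) _)

open Matrix in
/-- The responses to arbitrary initial data force `z E = 0` when `φ E = 0` and `φ A = z E`. -/
lemma ImpulseFree.functional_eq_zero (h₁ : 1 < α) (h : ImpulseFree E A α)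
    {φ z : Module.Dual ℝ (Fin n → ℝ)} (hφE : ∀ y, φ (E *ᵥ y) = 0)
    (hφA : ∀ y, φ (A *ᵥ y) = z (E *ᵥ y)) (x₀ : Fin n → ℝ) : z (E *ᵥ x₀) = 0 := by
  by_contra hc
  set c := z (E *ᵥ x₀) with hc_def
  obtain ⟨x, hxi, hx⟩ := h x₀ 0
  let zE : (Fin n → ℝ) →L[ℝ] ℝ := (z.comp E.mulVecLin).toContinuousLinearMap
  let zA : (Fin n → ℝ) →L[ℝ] ℝ := (z.comp A.mulVecLin).toContinuousLinearMap
  have hRL : ∀ t, 0 < t → RLIntegrable α x t := fun t ht =>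
    rlIntegrable_of_integrableOn h₁.le ht.le (hxi t ht)
  have hfrac : ∀ t, 0 < t → fracIntegral α (fun τ => A *ᵥ x τ) t = A *ᵥ rlInt α x t :=
    fun t ht => by
      rw [fracIntegral_eq_rlInt]
      exact rlInt_clm (mulVecCLM A) (hRL t ht)
  -- Applying `φ` to the integrated equation annihilates both `E`-terms and leaves `I^α (z E x) =
  -- 0`.
  have e1 : ∀ᵐ t ∂(volume.restrict (Ioi (0 : ℝ))), rlInt α (fun τ => zE (x τ)) t = 0 := by
    filter_upwards [hx, ae_restrict_mem measurableSet_Ioi] with t h1 ht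
    rw [rlInt_clm zE (hRL t ht)]
    have h2 := congrArg φ h1
    rw [hfrac t ht, map_add, hφE, hφE, hφA, zero_add] at h2
    exact h2.symm
  have e2 : ∀ᵐ t ∂(volume.restrict (Ioi (0 : ℝ))),
      zE (x t) = c + rlInt α (fun τ => zA (x τ)) t := by
    filter_upwards [hx, ae_restrict_mem measurableSet_Ioi] with t h1 ht
    rw [rlInt_clm zA (hRL t ht)]
    have h2 := congrArg z h1
    rw [hfrac t ht, map_add, smul_zero, add_zero] at h2
    exact h2
  have hlim := tendsto_rlInt_zero h₁ (zA.integrable_comp (hxi 1 one_pos))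
  -- Applying `z` shows that `z E x` tends to `c` at `0`. If `c ≠ 0`, then `c · z E x` is bounded
  -- below by a positive constant near `0`, contradicting the vanishing of its fractional integral.
  have hev : ∀ᶠ t in 𝓝[>] 0, c * c / 2 ≤ c * (c + rlInt α (fun τ => zA (x τ)) t) := by
    have h1 : Tendsto (fun t => c * (c + rlInt α (fun τ => zA (x τ)) t)) (𝓝[>] 0)
        (𝓝 (c * (c + 0))) := (hlim.const_add c).const_mul c
    refine h1.eventually (le_mem_nhds ?_)
    have := mul_self_pos.mpr hc
    linarith
  obtain ⟨δ, hδ, hsub⟩ := mem_nhdsGT_iff_exists_Ioo_subset.mp hev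
  have hδ : 0 < δ := hδ
  obtain ⟨t, ht, ht0⟩ : ∃ t ∈ Ioo 0 δ, rlInt α (fun τ => zE (x τ)) t = 0 := by
    have h1 := ae_restrict_of_ae_restrict_of_subset (s := Ioo 0 δ) Ioo_subset_Ioi_self e1
    have hne : volume.restrict (Ioo 0 δ) ≠ 0 := by
      rw [Ne, Measure.restrict_eq_zero, Real.volume_Ioo]
      simpa using hδ
    have : (ae (volume.restrict (Ioo 0 δ))).NeBot := ae_neBot.mpr hne
    obtain ⟨t, h2, h3⟩ := (h1.and (ae_restrict_mem measurableSet_Ioo)).exists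
    exact ⟨t, h3, h2⟩
  have hpos : 0 < rlInt α (fun τ => c * zE (x τ)) t := by
    refine rlInt_pos_of_le (m := c * c / 2) h₁.le ht.1 ?_ ?_ ?_
    · have := mul_self_pos.mpr hc
      linarith
    · exact (zE.integrable_comp (hxi t ht.1)).const_mul c
    · filter_upwards [ae_restrict_of_ae_restrict_of_subset Ioc_subset_Ioi_self e2,
        ae_restrict_mem measurableSet_Ioc] with τ h1 h2
      rw [h1]
      exact hsub ⟨h2.1, h2.2.trans_lt ht.2⟩
  have hmul : rlInt α (fun τ => c * zE (x τ)) t = c * rlInt α (fun τ => zE (x τ)) t := by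
    simp only [rlInt, smul_eq_mul, mul_left_comm _ c, intervalIntegral.integral_const_mul]
  rw [hmul, ht0, mul_zero] at hpos
  exact lt_irrefl _ hpos

open Matrix in
-- Once `z E = 0`, applying `φ` to `E D^α x = A x + g` leaves `φ g = 0`, an impossible constraint on
-- the forcing. The test forcing is a smooth function flat at `0` times a vector with `φ c ≠ 0`.
lemma index_le_one_of_regular_impulseFree (h₁ : 1 < α) (hR : Regular E A α)
    (hI : ImpulseFree E A α) (v w : Fin n → ℝ) (hEv : E *ᵥ v = 0) (hAv : A *ᵥ v = E *ᵥ w) :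
    v = 0 := by
  by_contra hv
  obtain ⟨φ, z, hφ, hφE, hφA⟩ := exists_functional_of_index hv hEv hAv
  have hzE := hI.functional_eq_zero h₁ hφE hφA
  obtain ⟨c, hc⟩ : ∃ c, φ c ≠ 0 := by
    by_contra! h
    exact hφ (LinearMap.ext h)
  obtain ⟨x, hx⟩ := (hR (fun t => expNegInvGlue t • c) (expNegInvGlue.contDiff.smul contDiff_const)
    (fun t ht => by rw [expNegInvGlue.zero_of_nonpos ht, zero_smul])).1
  have h := congrArg φ (hx.equation 1 one_pos)
  rw [hφE, map_add, hφA, hzE, zero_add, map_smul, smul_eq_mul] at h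
  exact mul_ne_zero (expNegInvGlue.pos_of_pos one_pos).ne' hc h.symm

end Index

end SFOS

/-! ### Fractional powers, Laplace transforms and instability -/

namespace SFOS

open MeasureTheory Set Filter Topology

section Sector

variable {α : ℝ}

lemma cpow_re_im {s : ℂ} (hs : s ≠ 0) (α : ℝ) :
    (s ^ (α : ℂ)).re = ‖s‖ ^ α * Real.cos (α * s.arg) ∧
      (s ^ (α : ℂ)).im = ‖s‖ ^ α * Real.sin (α * s.arg) := by
  have h0 : 0 < ‖s‖ := norm_pos_iff.mpr hs
  have h1 : (Complex.log s * α).re = Real.log ‖s‖ * α := by simp [Complex.log_re]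
  have h2 : (Complex.log s * α).im = α * s.arg := by simp [Complex.log_im, mul_comm]
  rw [Complex.cpow_def_of_ne_zero hs, Complex.exp_re, Complex.exp_im, h1, h2,
    Real.rpow_def_of_pos h0]
  exact ⟨rfl, rfl⟩

/-- The argument is multiplied by `α`, so its absolute value stays at most `απ/2 < π`; membership is
the sign of `sin(απ/2 ∓ α arg s)`. -/
lemma cpow_mem_sector (h₁ : 1 < α) (h₂ : α < 2) {s : ℂ} (hs : 0 ≤ s.re) :
    s ^ (α : ℂ) ∈ sector α := by
  by_cases h0 : s = 0
  · rw [h0, Complex.zero_cpow (by exact_mod_cast (by linarith : α ≠ 0))]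
    exact zero_mem_sector α
  obtain ⟨hre, him⟩ := cpow_re_im h0 α
  have harg := abs_le.mp (Complex.abs_arg_le_pi_div_two_iff.mpr hs)
  have hr : 0 ≤ ‖s‖ ^ α := Real.rpow_nonneg (norm_nonneg s) α
  have hpi := Real.pi_pos
  simp only [sector, mem_ofPred_eq, hre, him]
  rcases le_total 0 s.arg with h | h
  · left
    have : 0 ≤ Real.sin (Real.pi / 2 * α - α * s.arg) :=
      Real.sin_nonneg_of_nonneg_of_le_pi (by nlinarith) (by nlinarith)
    rw [Real.sin_sub] at this
    have := mul_nonneg hr this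
    linarith
  · right
    have : 0 ≤ Real.sin (Real.pi / 2 * α + α * s.arg) :=
      Real.sin_nonneg_of_nonneg_of_le_pi (by nlinarith) (by nlinarith)
    rw [Real.sin_add] at this
    have := mul_nonneg hr this
    linarith

lemma exists_cpow_eq_of_mem_sector (h₁ : 1 < α) (h₂ : α < 2) {μ : ℂ} (hμ : μ ∈ sector α)
    (h0 : μ ≠ 0) : ∃ s : ℂ, s ≠ 0 ∧ 0 ≤ s.re ∧ s ^ (α : ℂ) = μ := by
  have hpi := Real.pi_pos
  have hα0 : (α : ℂ) ≠ 0 := by exact_mod_cast (by linarith : α ≠ 0)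
  have hr : 0 < ‖μ‖ := norm_pos_iff.mpr h0
  have harg1 := Complex.neg_pi_lt_arg μ
  have harg2 := Complex.arg_le_pi μ
  have hre : μ.re = ‖μ‖ * Real.cos μ.arg := (Complex.norm_mul_cos_arg μ).symm
  have him : μ.im = ‖μ‖ * Real.sin μ.arg := (Complex.norm_mul_sin_arg μ).symm
  -- If `|arg μ|` exceeded `απ/2`, then both `sin(απ/2 ± arg μ)` would be negative, and `μ` would
  -- lie in neither half plane.
  have key : |μ.arg| ≤ Real.pi / 2 * α := by
    by_contra! habs
    have h1 : Real.sin (Real.pi / 2 * α - μ.arg) < 0 := by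
      rcases lt_abs.mp habs with h | h
      · exact Real.sin_neg_of_neg_of_neg_pi_lt (by linarith) (by nlinarith)
      · rw [← Real.sin_sub_two_pi]
        exact Real.sin_neg_of_neg_of_neg_pi_lt (by nlinarith) (by nlinarith)
    have h2 : Real.sin (Real.pi / 2 * α + μ.arg) < 0 := by
      rcases lt_abs.mp habs with h | h
      · rw [← Real.sin_sub_two_pi]
        exact Real.sin_neg_of_neg_of_neg_pi_lt (by nlinarith) (by nlinarith)
      · exact Real.sin_neg_of_neg_of_neg_pi_lt (by linarith) (by nlinarith)
    rw [Real.sin_sub] at h1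
    rw [Real.sin_add] at h2
    simp only [sector, mem_ofPred_eq, hre, him] at hμ
    have h1' := mul_neg_of_pos_of_neg hr h1
    have h2' := mul_neg_of_pos_of_neg hr h2
    rcases hμ with h | h <;> linarith
  obtain ⟨k1, k2⟩ := abs_le.mp key
  have him' : (Complex.log μ * ((α⁻¹ : ℝ) : ℂ)).im = α⁻¹ * μ.arg := by
    simp [Complex.log_im, mul_comm]
  have hle : α⁻¹ * μ.arg ≤ Real.pi / 2 := by
    rw [inv_mul_le_iff₀ (by linarith)]
    linarith
  have hge : -(Real.pi / 2) ≤ α⁻¹ * μ.arg := by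
    have : α⁻¹ * -μ.arg ≤ Real.pi / 2 := by
      rw [inv_mul_le_iff₀ (by linarith)]
      linarith
    linarith
  refine ⟨μ ^ ((α⁻¹ : ℝ) : ℂ), ?_, ?_, ?_⟩
  · simp [Complex.cpow_eq_zero_iff, h0]
  · rw [(cpow_re_im h0 α⁻¹).1]
    exact mul_nonneg (Real.rpow_nonneg hr.le _) (Real.cos_nonneg_of_mem_Icc ⟨hge, hle⟩)
  · rw [← Complex.cpow_mul _ (by rw [him']; linarith) (by rw [him']; linarith), ← Complex.ofReal_mul,
      inv_mul_cancel₀ (by linarith)]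
    simp

end Sector

section Laplace

/-- The integral representation of `Γ(a) s^(-a)` in the right half plane. -/
lemma integral_rpow_mul_cexp {a : ℝ} (ha : 0 < a) {s : ℂ} (hs : 0 < s.re) :
    IntegrableOn (fun t : ℝ => ((t ^ (a - 1) : ℝ) : ℂ) * Complex.exp (-(s * t))) (Ioi 0) ∧
      ∫ t in Ioi (0 : ℝ), ((t ^ (a - 1) : ℝ) : ℂ) * Complex.exp (-(s * t)) =
        Real.Gamma a * (s ^ (a : ℂ))⁻¹ := by
  have hreal : ∀ {b r : ℝ}, 0 < b → 0 < r →
      IntegrableOn (fun t : ℝ => t ^ (b - 1) * Real.exp (-(r * t))) (Ioi 0) := by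
    intro b r hb hr
    refine not_imp_comm.mp integral_undef (ne_of_gt ?_)
    rw [Real.integral_rpow_mul_exp_neg_mul_Ioi hb hr]
    have := Real.Gamma_pos_of_pos hb
    positivity
  have hmeas : ∀ (b : ℝ) (z : ℂ), AEStronglyMeasurable
      (fun t : ℝ => ((t ^ (b - 1) : ℝ) : ℂ) * Complex.exp (-(z * t)))
      (volume.restrict (Ioi 0)) := fun b z => by
    refine Measurable.aestronglyMeasurable ?_
    exact (Complex.measurable_ofReal.comp (measurable_id.pow_const _)).mul
      (Complex.measurable_exp.comp (by fun_prop))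
  have hnorm : ∀ (b : ℝ) (z : ℂ), ∀ t ∈ Ioi (0 : ℝ),
      ‖((t ^ (b - 1) : ℝ) : ℂ) * Complex.exp (-(z * t))‖ =
        t ^ (b - 1) * Real.exp (-(z.re * t)) := fun b z t ht => by
    rw [norm_mul, Complex.norm_real, Real.norm_of_nonneg (Real.rpow_nonneg (le_of_lt ht) _),
      Complex.norm_exp]
    simp
  have hint : ∀ {b : ℝ} {z : ℂ}, 0 < b → 0 < z.re → IntegrableOn
      (fun t : ℝ => ((t ^ (b - 1) : ℝ) : ℂ) * Complex.exp (-(z * t))) (Ioi 0) := by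
    intro b z hb hz
    refine (hreal hb hz).mono' (hmeas b z) ?_
    filter_upwards [ae_restrict_mem measurableSet_Ioi] with t ht
    exact (hnorm b z t ht).le
  refine ⟨hint ha hs, ?_⟩
  -- Identity theorem: both sides are holomorphic in the right half plane and agree at the real
  -- points `1 + 1/(k+1)`, which accumulate at `1`.
  let U : Set ℂ := {z | 0 < z.re}
  have hU : IsOpen U := isOpen_lt continuous_const Complex.continuous_re
  let G : ℂ → ℂ := fun z => ∫ t in Ioi (0 : ℝ), ((t ^ (a - 1) : ℝ) : ℂ) * Complex.exp (-(z * t))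
  have hG : DifferentiableOn ℂ G U := by
    intro z hz
    have hz : 0 < z.re := hz
    have := hasDerivAt_integral_of_dominated_loc_of_deriv_le
      (μ := volume.restrict (Ioi (0 : ℝ)))
      (F := fun (w : ℂ) (t : ℝ) => ((t ^ (a - 1) : ℝ) : ℂ) * Complex.exp (-(w * t)))
      (F' := fun (w : ℂ) (t : ℝ) => ((t ^ (a - 1) : ℝ) : ℂ) * (Complex.exp (-(w * t)) * -(t : ℂ)))
      (x₀ := z) (s := Metric.ball z (z.re / 2))
      (bound := fun t => t ^ ((a + 1) - 1) * Real.exp (-(z.re / 2 * t)))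
      (Metric.ball_mem_nhds z (by positivity))
      (Eventually.of_forall fun w => hmeas a w) (hint ha hz) ?_ ?_
      (hreal (by linarith) (by linarith)) ?_
    · exact this.2.differentiableAt.differentiableWithinAt
    · refine Measurable.aestronglyMeasurable ?_
      exact (Complex.measurable_ofReal.comp (measurable_id.pow_const _)).mul
        ((Complex.measurable_exp.comp (by fun_prop)).mul (by fun_prop))
    · filter_upwards [ae_restrict_mem measurableSet_Ioi] with t ht w hw
      have ht : 0 < t := ht
      have hw' : z.re / 2 ≤ w.re := by
        have h1 : |(w - z).re| ≤ ‖w - z‖ := Complex.abs_re_le_norm _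
        have h2 : ‖w - z‖ < z.re / 2 := by simpa [dist_eq_norm] using hw
        have h3 := (abs_le.mp (h1.trans h2.le)).1
        rw [Complex.sub_re] at h3
        linarith
      rw [← mul_assoc, norm_mul, hnorm a w t ht, norm_neg, Complex.norm_real,
        Real.norm_of_nonneg ht.le, mul_right_comm]
      have e : t ^ (a - 1) * t = t ^ (a + 1 - 1) := by
        rw [show a + 1 - 1 = (a - 1) + 1 by ring, Real.rpow_add ht, Real.rpow_one]
      rw [e]
      gcongr
    · filter_upwards with t w _
      have h1 : HasDerivAt (fun w : ℂ => -(w * (t : ℂ))) (-(t : ℂ)) w := by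
        simpa using ((hasDerivAt_id w).mul_const (t : ℂ)).fun_neg
      exact (h1.cexp).const_mul _
  have hR : DifferentiableOn ℂ (fun z : ℂ => (Real.Gamma a : ℂ) * (z ^ (a : ℂ))⁻¹) U := by
    intro z hz
    have hz : 0 < z.re := hz
    have hz0 : z ≠ 0 := fun h => by simp [h] at hz
    refine (DifferentiableAt.const_mul (DifferentiableAt.inv ?_ ?_) _).differentiableWithinAt
    · exact differentiableAt_id.cpow_const (Or.inl hz)
    · simp [Complex.cpow_eq_zero_iff, hz0]
  have hconn : IsPreconnected U := (convex_halfSpace_re_gt 0).isPreconnected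
  have hfreq : ∃ᶠ z in 𝓝[≠] (1 : ℂ), G z = (Real.Gamma a : ℂ) * (z ^ (a : ℂ))⁻¹ := by
    have hseq : Tendsto (fun k : ℕ => (1 : ℂ) + (1 / ((k : ℝ) + 1) : ℝ)) atTop (𝓝[≠] 1) := by
      rw [tendsto_nhdsWithin_iff]
      constructor
      · have h1 := (Complex.continuous_ofReal.tendsto 0).comp
          (tendsto_one_div_add_atTop_nhds_zero_nat (𝕜 := ℝ))
        simpa using h1.const_add (1 : ℂ)
      · refine Eventually.of_forall fun k => ?_
        have : (0 : ℝ) < 1 / ((k : ℝ) + 1) := by positivity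
        simp only [mem_compl_iff, mem_singleton_iff, add_eq_left, Complex.ofReal_eq_zero]
        exact this.ne'
    refine hseq.frequently (Eventually.frequently (Eventually.of_forall fun k => ?_))
    set r : ℝ := 1 + 1 / ((k : ℝ) + 1)
    have hr : 0 < r := by positivity
    have hrc : (1 : ℂ) + (1 / ((k : ℝ) + 1) : ℝ) = (r : ℂ) := by simp [r]
    rw [hrc]
    have h1 := Real.integral_rpow_mul_exp_neg_mul_Ioi ha hr
    have h2 : G r = ((∫ t in Ioi (0 : ℝ), t ^ (a - 1) * Real.exp (-(r * t)) : ℝ) : ℂ) := by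
      rw [← integral_complex_ofReal]
      simp [G]
    rw [h2, h1, one_div, Real.inv_rpow hr.le]
    push_cast
    rw [Complex.ofReal_cpow hr.le, mul_comm]
  exact (hG.analyticOnNhd hU).eqOn_of_preconnected_of_frequently_eq (hR.analyticOnNhd hU) hconn
    (show (1 : ℂ) ∈ U by simp [U]) hfreq hs

variable {V : Type*} [NormedAddCommGroup V]

lemma exists_bound_of_tendsto_zero {ψ : ℝ → V} (hψ : ContinuousOn ψ (Ici 0))
    (hlim : Tendsto ψ atTop (𝓝 0)) : ∃ M, ∀ t ∈ Ici (0 : ℝ), ‖ψ t‖ ≤ M := by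
  obtain ⟨T, hT⟩ := eventually_atTop.mp (hlim.eventually (Metric.ball_mem_nhds 0 one_pos))
  obtain ⟨M, hM⟩ := (isCompact_Icc (a := 0) (b := T)).exists_bound_of_continuousOn
    (hψ.mono Icc_subset_Ici_self)
  refine ⟨max M 1, fun t ht => ?_⟩
  rcases le_total t T with h | h
  · exact (hM t ⟨ht, h⟩).trans (le_max_left _ _)
  · have := hT t h
    rw [dist_zero_right] at this
    exact this.le.trans (le_max_right _ _)

variable [NormedSpace ℂ V]

/-- The Laplace transform. -/
noncomputable def laplace (f : ℝ → V) (s : ℂ) : V :=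
  ∫ t in Ioi (0 : ℝ), Complex.exp (-(s * t)) • f t

/-- The convolution theorem on the half line: the factor `e^(-sx)` splits as `e^(-st) e^(-s(x-t))`
between `f` and the kernel. -/
lemma laplace_rlInt [CompleteSpace V] {a : ℝ} (ha : 0 < a) {s : ℂ} (hs : 0 < s.re) {f : ℝ → V}
    (hf : IntegrableOn (fun t : ℝ => Complex.exp (-(s * t)) • f t) (Ioi 0)) :
    laplace (rlInt a f) s = (s ^ (a : ℂ))⁻¹ • laplace f s := by
  obtain ⟨hgi, hg⟩ := integral_rpow_mul_cexp ha hs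
  have hΓ := (Real.Gamma_pos_of_pos ha).ne'
  have h := integral_posConvolution hf hgi (ContinuousLinearMap.lsmul ℝ ℂ (E := V)).flip
  have h1 : ∀ x : ℝ, ∫ t in (0 : ℝ)..x, (ContinuousLinearMap.lsmul ℝ ℂ (E := V)).flip
      (Complex.exp (-(s * t)) • f t)
      ((((x - t) ^ (a - 1) : ℝ) : ℂ) * Complex.exp (-(s * ((x - t : ℝ) : ℂ)))) =
      Real.Gamma a • Complex.exp (-(s * x)) • rlInt a f x := fun x => by
    rw [rlInt, smul_comm (Complex.exp (-(s * x))) ((Real.Gamma a)⁻¹), smul_inv_smul₀ hΓ,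
      ← intervalIntegral.integral_smul]
    congr 1
    ext t
    rw [ContinuousLinearMap.flip_apply, ContinuousLinearMap.lsmul_apply, smul_smul, mul_assoc,
      ← Complex.exp_add, mul_smul, smul_comm, ← Complex.coe_smul]
    congr 3
    push_cast
    ring
  simp only [h1] at h
  rw [integral_smul, hg, ContinuousLinearMap.flip_apply, ContinuousLinearMap.lsmul_apply,
    mul_smul, Complex.coe_smul] at h
  exact smul_right_injective V hΓ h

lemma laplace_ofReal {s : ℂ} (hs : 0 < s.re) :
    IntegrableOn (fun t : ℝ => Complex.exp (-(s * t)) • (t : ℂ)) (Ioi 0) ∧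
      laplace (fun t : ℝ => (t : ℂ)) s = (s ^ (2 : ℂ))⁻¹ := by
  obtain ⟨h1, h2⟩ := integral_rpow_mul_cexp two_pos hs
  have e : ∀ t : ℝ, ((t ^ ((2 : ℝ) - 1) : ℝ) : ℂ) * Complex.exp (-(s * t)) =
      Complex.exp (-(s * t)) • (t : ℂ) := fun t => by
    rw [show (2 : ℝ) - 1 = 1 by norm_num, Real.rpow_one, smul_eq_mul, mul_comm]
  simp only [e] at h1 h2
  refine ⟨h1, ?_⟩
  rw [laplace, h2]
  simp

lemma laplace_one {s : ℂ} (hs : 0 < s.re) :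
    IntegrableOn (fun t : ℝ => Complex.exp (-(s * t)) • (1 : ℂ)) (Ioi 0) ∧
      laplace (fun _ : ℝ => (1 : ℂ)) s = s⁻¹ := by
  obtain ⟨h1, h2⟩ := integral_rpow_mul_cexp one_pos hs
  have e : ∀ t : ℝ, ((t ^ ((1 : ℝ) - 1) : ℝ) : ℂ) * Complex.exp (-(s * t)) =
      Complex.exp (-(s * t)) • (1 : ℂ) := fun t => by simp
  simp only [e] at h1 h2
  refine ⟨h1, ?_⟩
  rw [laplace, h2]
  simp

/-- The Abelian theorem for functions tending to zero. -/
lemma tendsto_mul_integral_exp {ψ : ℝ → ℝ} (hψ : ContinuousOn ψ (Ici 0))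
    (hlim : Tendsto ψ atTop (𝓝 0)) :
    Tendsto (fun σ : ℝ => σ * ∫ t in Ioi (0 : ℝ), Real.exp (-(σ * t)) * ψ t) (𝓝[>] 0) (𝓝 0) := by
  obtain ⟨M, hM⟩ := exists_bound_of_tendsto_zero hψ hlim
  -- Substituting `u = σ t` removes the factor `σ`; the integrand then tends to `0` under an
  -- exponential bound.
  have hsub : ∀ σ ∈ Ioi (0 : ℝ), σ * ∫ t in Ioi (0 : ℝ), Real.exp (-(σ * t)) * ψ t =
      ∫ u in Ioi (0 : ℝ), Real.exp (-u) * ψ (σ⁻¹ * u) := fun σ hσ => by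
    have hσ : 0 < σ := hσ
    have := integral_comp_mul_left_Ioi (fun u => Real.exp (-u) * ψ (σ⁻¹ * u)) 0 hσ
    rw [mul_zero, smul_eq_mul] at this
    rw [eq_inv_mul_iff_mul_eq₀ hσ.ne'] at this
    rw [← this]
    simp [inv_mul_cancel_left₀ hσ.ne']
  have hdct : Tendsto (fun σ : ℝ => ∫ u in Ioi (0 : ℝ), Real.exp (-u) * ψ (σ⁻¹ * u)) (𝓝[>] 0)
      (𝓝 (∫ _u in Ioi (0 : ℝ), (0 : ℝ))) := by
    refine tendsto_integral_filter_of_dominated_convergence (fun u => Real.exp (-u) * M) ?_ ?_ ?_ ?_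
    · filter_upwards [self_mem_nhdsWithin] with σ hσ
      have hσ : 0 < σ := hσ
      refine ContinuousOn.aestronglyMeasurable ?_ measurableSet_Ioi
      refine ContinuousOn.mul (by fun_prop) (hψ.comp (by fun_prop) fun u hu => ?_)
      have hu : 0 < u := hu
      exact mem_Ici.mpr (by positivity)
    · filter_upwards [self_mem_nhdsWithin] with σ hσ
      have hσ : 0 < σ := hσ
      filter_upwards [ae_restrict_mem measurableSet_Ioi] with u hu
      have hu : 0 < u := hu
      rw [norm_mul, Real.norm_of_nonneg (Real.exp_pos _).le]
      exact mul_le_mul_of_nonneg_left (hM _ (mem_Ici.mpr (by positivity))) (Real.exp_pos _).le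
    · have := integrableOn_exp_neg_Ioi 0
      exact this.mul_const M
    · filter_upwards [ae_restrict_mem measurableSet_Ioi] with u hu
      have hu : 0 < u := hu
      have h1 : Tendsto (fun σ : ℝ => σ⁻¹ * u) (𝓝[>] 0) atTop :=
        tendsto_inv_nhdsGT_zero.atTop_mul_const hu
      simpa using (hlim.comp h1).const_mul (Real.exp (-u))
  rw [integral_zero] at hdct
  refine hdct.congr' ?_
  filter_upwards [self_mem_nhdsWithin] with σ hσ using (hsub σ hσ).symm

/-- The solution of `D^α φ = μ φ` with `φ(0) = 0` and `φ'(0) = 1` does not tend to zero when `μ`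
lies in the sector. -/
lemma not_tendsto_zero_of_mem_sector {α : ℝ} (h₁ : 1 < α) (h₂ : α < 2) {μ : ℂ}
    (hμ : μ ∈ sector α) {φ : ℝ → ℂ} (hφ : Continuous φ)
    (heq : ∀ t, 0 < t → φ t = t + μ * rlInt α φ t) : ¬ Tendsto φ atTop (𝓝 0) := by
  intro hlim
  have hα0 : 0 < α := by linarith
  by_cases hμ0 : μ = 0
  · have h1 := hlim.norm
    have h2 : Tendsto (fun t : ℝ => ‖φ t‖) atTop atTop := by
      refine tendsto_id.congr' ?_
      filter_upwards [eventually_gt_atTop 0] with t ht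
      rw [heq t ht, hμ0]
      simp [abs_of_pos ht]
    exact not_tendsto_nhds_of_tendsto_atTop h2 _ h1
  -- The transform satisfies `(s^α - μ) φ̂(s) = s^(α-2)`, which would force a pole at this `α`-th
  -- root of `μ` in the closed right half plane; the Abelian theorem forbids it.
  obtain ⟨s₀, hs0, hsre, hsμ⟩ := exists_cpow_eq_of_mem_sector h₁ h₂ hμ hμ0
  have hnlim : Tendsto (fun t => ‖φ t‖) atTop (𝓝 0) := by simpa using hlim.norm
  have hAbel := tendsto_mul_integral_exp hφ.norm.continuousOn hnlim
  obtain ⟨M, hM⟩ := exists_bound_of_tendsto_zero hφ.continuousOn hlim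
  have hexpn : ∀ (s : ℂ) (t : ℝ), ‖Complex.exp (-(s * t))‖ = Real.exp (-(s.re * t)) := fun s t => by
    rw [Complex.norm_exp]
    simp
  have hint : ∀ s : ℂ, 0 < s.re →
      IntegrableOn (fun t : ℝ => Complex.exp (-(s * t)) • φ t) (Ioi 0) := fun s hs => by
    have h1 : IntegrableOn (fun t : ℝ => Real.exp (-(s.re * t)) * M) (Ioi 0) := by
      have := integrableOn_exp_mul_Ioi (neg_neg_of_pos hs) 0
      simp only [neg_mul] at this
      exact this.mul_const M
    refine h1.mono' (Continuous.aestronglyMeasurable (by fun_prop)) ?_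
    filter_upwards [ae_restrict_mem measurableSet_Ioi] with t ht
    rw [norm_smul, hexpn]
    exact mul_le_mul_of_nonneg_left (hM t (mem_Ici.mpr (le_of_lt ht))) (Real.exp_pos _).le
  have hlap : ∀ s : ℂ, 0 < s.re →
      (s ^ (α : ℂ) - μ) * laplace φ s = s ^ ((α : ℂ) - 2) := fun s hs => by
    have hne : s ≠ 0 := fun h => by simp [h] at hs
    have hpow : s ^ (α : ℂ) ≠ 0 := by simp [Complex.cpow_eq_zero_iff, hne]
    obtain ⟨ht1, ht2⟩ := laplace_ofReal hs
    have hr := laplace_rlInt hα0 hs (hint s hs)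
    have h1 : laplace φ s = (s ^ (2 : ℂ))⁻¹ + μ * ((s ^ (α : ℂ))⁻¹ * laplace φ s) := by
      rw [← ht2, ← smul_eq_mul (s ^ (α : ℂ))⁻¹, ← hr, laplace, laplace, laplace,
        ← integral_const_mul]
      have hsum : IntegrableOn (fun t : ℝ => μ * Complex.exp (-(s * t)) • rlInt α φ t) (Ioi 0) := by
        refine ((hint s hs).sub ht1).congr_fun (fun t ht => ?_) measurableSet_Ioi
        simp only [Pi.sub_apply, smul_eq_mul]
        rw [heq t ht]
        ring
      rw [← integral_add ht1 hsum]
      refine setIntegral_congr_fun measurableSet_Ioi fun t ht => ?_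
      simp only [smul_eq_mul]
      rw [heq t ht]
      ring
    rw [sub_mul]
    nth_rewrite 1 [h1]
    rw [Complex.cpow_sub _ _ hne]
    field_simp
    ring
  have hσlap : Tendsto (fun σ : ℝ => (σ : ℂ) * laplace φ (s₀ + σ)) (𝓝[>] 0) (𝓝 0) := by
    refine squeeze_zero_norm' ?_ hAbel
    filter_upwards [self_mem_nhdsWithin] with σ hσ
    have hσ : 0 < σ := hσ
    rw [norm_mul, Complex.norm_real, Real.norm_of_nonneg hσ.le]
    refine mul_le_mul_of_nonneg_left ?_ hσ.le
    refine norm_integral_le_of_norm_le ?_ ?_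
    · have h1 := (hint (σ : ℂ) (by simpa using hσ)).norm
      refine h1.congr (Eventually.of_forall fun t => ?_)
      simp only [norm_smul, hexpn, Complex.ofReal_re]
    · filter_upwards [ae_restrict_mem measurableSet_Ioi] with t ht
      have ht : 0 < t := ht
      rw [norm_smul, hexpn]
      refine mul_le_mul_of_nonneg_right (Real.exp_le_exp.mpr ?_) (norm_nonneg _)
      simp only [Complex.add_re, Complex.ofReal_re]
      nlinarith [mul_nonneg hsre ht.le]
  have hslit : s₀ ∈ Complex.slitPlane := by
    rcases hsre.lt_or_eq with h | h
    · exact Or.inl h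
    · exact Or.inr fun him => hs0 (Complex.ext h.symm him)
  have hcoe : Tendsto (fun σ : ℝ => (σ : ℂ)) (𝓝[>] 0) (𝓝[≠] 0) := by
    rw [tendsto_nhdsWithin_iff]
    refine ⟨?_, ?_⟩
    · have := Complex.continuous_ofReal.tendsto 0
      rw [Complex.ofReal_zero] at this
      exact this.mono_left nhdsWithin_le_nhds
    · filter_upwards [self_mem_nhdsWithin] with σ hσ
      simpa using (ne_of_gt hσ)
  have hslope := ((hasDerivAt_id s₀).cpow_const (c := (α : ℂ)) hslit).tendsto_slope_zero.comp hcoe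
  have hprod := hslope.mul hσlap
  rw [mul_zero] at hprod
  have hrhs : Tendsto (fun σ : ℝ => (s₀ + σ) ^ ((α : ℂ) - 2)) (𝓝[>] 0)
      (𝓝 (s₀ ^ ((α : ℂ) - 2))) := by
    have h1 : ContinuousAt (fun z : ℂ => z ^ ((α : ℂ) - 2)) (s₀ + (0 : ℂ)) :=
      continuousAt_cpow_const (by rwa [add_zero])
    have h2 : Tendsto (fun σ : ℝ => s₀ + (σ : ℂ)) (𝓝[>] 0) (𝓝 (s₀ + 0)) :=
      (hcoe.mono_right nhdsWithin_le_nhds).const_add s₀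
    have := h1.tendsto.comp h2
    rwa [add_zero] at this
  -- Along `s₀ + σ`, the left side is the difference quotient of `s^α` times `σ φ̂`, and the second
  -- factor tends to `0`; but `s₀^(α-2) ≠ 0`.
  have heqs : s₀ ^ ((α : ℂ) - 2) = 0 := by
    refine tendsto_nhds_unique hrhs (hprod.congr' ?_)
    filter_upwards [self_mem_nhdsWithin] with σ hσ
    have hσ : 0 < σ := hσ
    have hσ' : (σ : ℂ) ≠ 0 := by exact_mod_cast hσ.ne'
    have hl := hlap (s₀ + σ) (by simp; linarith)
    rw [← hl, ← hsμ]
    simp only [Function.comp_apply, id_eq, smul_eq_mul]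
    field_simp
  rw [Complex.cpow_eq_zero_iff] at heqs
  exact hs0 heqs.1

end Laplace

section Instability

variable {n : ℕ} {E A : Matrix (Fin n) (Fin n) ℝ} {α : ℝ}

open Matrix in
-- If `D^α φ = μ φ` with `φ(0) = 0`, `φ'(0) = 1`, and `v` is an eigenvector for `μ`, then `Re(c φ
-- v)` is a real solution for every complex `c`. All these solutions start from the initial value
-- `0`, and their decay would force `φ → 0`.
lemma Stable.det_ne_zero (h₁ : 1 < α) (h₂ : α < 2) (h : Stable E A α) : ∀ μ ∈ sector α,
    (μ • E.map ((↑) : ℝ → ℂ) - A.map ((↑) : ℝ → ℂ)).det ≠ 0 := by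
  intro μ hμ hdet
  have hα0 : 0 < α := by linarith
  obtain ⟨v, hv, hv0⟩ := exists_mulVec_eq_zero_iff.mpr hdet
  rw [sub_mulVec, smul_mulVec, sub_eq_zero] at hv0
  let Lμ : ℂ →L[ℝ] ℂ := ContinuousLinearMap.mul ℝ ℂ μ
  obtain ⟨φ, hφ, hφt, hφc⟩ := exists_caputo_solution h₁ h₂ Lμ (G := fun _ => 0)
    continuous_const 1
  have hw : Continuous (iteratedDeriv 2 φ) := hφ.continuous_iteratedDeriv 2 le_rfl
  have hφc' : ∀ t, 0 < t → rlInt (2 - α) (iteratedDeriv 2 φ) t = μ * φ t := fun t ht => by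
    rw [hφc t ht]
    simp [rlInt, Lμ]
  have hvolt : ∀ t, 0 < t → φ t = t + μ * rlInt α φ t := fun t ht => by
    have h1 : rlInt 2 (iteratedDeriv 2 φ) t = μ * rlInt α φ t := by
      rw [show (2 : ℝ) = α + (2 - α) by ring,
        ← rlInt_rlInt hα0 (by linarith) (by linarith) ht hw.integrableOn_Ioc,
        rlInt_congr (g := fun τ => Lμ (φ τ)) ht.le (fun τ hτ => hφc' τ hτ.1),
        rlInt_clm Lμ (rlIntegrable_of_continuous hα0 ht hφ.continuous)]
      rfl
    rw [← h1]
    simpa using hφt t ht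
  refine not_tendsto_zero_of_mem_sector h₁ h₂ hμ hφ.continuous hvolt ?_
  obtain ⟨j, hj⟩ := Function.ne_iff.mp hv
  have hlim : ∀ c : ℂ, Tendsto (fun t => (φ t * (c * v j)).re) atTop (𝓝 0) := by
    intro c
    let Lc : ℂ →L[ℝ] (Fin n → ℝ) := ContinuousLinearMap.pi fun i =>
      Complex.reCLM.comp ((ContinuousLinearMap.mul ℝ ℂ).flip (c * v i))
    have hLc : ∀ z i, Lc z i = (z * (c * v i)).re := fun z i => rfl
    have hM : ∀ (M : Matrix (Fin n) (Fin n) ℝ) z i,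
        (M *ᵥ Lc z) i = (z * c * (M.map ((↑) : ℝ → ℂ) *ᵥ v) i).re := fun M z i => by
      simp only [mulVec, dotProduct, hLc, Finset.mul_sum, Complex.re_sum, map_apply]
      refine Finset.sum_congr rfl fun k _ => ?_
      rw [show z * c * ((M i k : ℂ) * v k) = (M i k : ℂ) * (z * (c * v k)) by ring,
        Complex.re_ofReal_mul]
    have hx : ContDiff ℝ 2 fun t => Lc (φ t) := Lc.contDiff.comp hφ
    have hsol : IsSolution E A α 0 fun t => Lc (φ t) := by
      refine isSolution_of_contDiff hx fun t ht => ?_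
      have hcap : caputoDeriv α (fun t => Lc (φ t)) t = Lc (μ * φ t) := by
        rw [caputoDeriv_eq_rlInt, rlInt_congr (g := fun τ => Lc (iteratedDeriv 2 φ τ)) ht.le
          (fun τ _ => iteratedDeriv_two_clm Lc hφ.contDiffAt),
          rlInt_clm Lc (rlIntegrable_of_continuous (by linarith) ht hw), hφc' t ht]
      rw [hcap, Pi.zero_apply, add_zero]
      ext i
      rw [hM, hM, ← congrFun hv0 i, Pi.smul_apply, smul_eq_mul]
      congr 1
      ring
    have h0 := h _ ⟨_, hsol, rfl⟩ _ hsol rfl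
    have h1 := (tendsto_zero_iff_norm_tendsto_zero.mpr h0)
    exact (tendsto_pi_nhds.mp h1) j
  -- The choices `c = 1` and `c = -i` recover the real and imaginary parts of `φ v_j`.
  have h1 := hlim 1
  have h2 := hlim (-Complex.I)
  have h3 : Tendsto (fun t => φ t * v j) atTop (𝓝 0) := by
    have := ((Complex.continuous_ofReal.tendsto 0).comp h1).add
      (((Complex.continuous_ofReal.tendsto 0).comp h2).mul_const Complex.I)
    simp only [Complex.ofReal_zero, zero_mul, add_zero] at this
    refine this.congr fun t => ?_
    simp only [Function.comp_apply]
    apply Complex.ext <;> simp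
    ring
  have h4 := h3.mul_const (v j)⁻¹
  rw [zero_mul] at h4
  refine h4.congr fun t => ?_
  have : v j ≠ 0 := hj
  field_simp

end Instability

end SFOS

/-! ### Laplace inversion on the imaginary axis -/

namespace SFOS

open MeasureTheory Set Filter Topology

section Inversion

variable {V : Type*} [NormedAddCommGroup V] [NormedSpace ℂ V]

/-- Integrals along vertical lines in the closed right half plane agree. -/
lemma integral_vertical_eq [CompleteSpace V] {G : ℂ → V} {D : ℝ → ℝ} {σ : ℝ} (hσ : 0 < σ)
    (hG : ∀ s : ℂ, 0 ≤ s.re → s ≠ 0 → DifferentiableAt ℂ G s)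
    (hD : ∀ s : ℂ, 0 ≤ s.re → s.re ≤ σ → s.im ≠ 0 → ‖G s‖ ≤ D s.im)
    (hDi : Integrable D) (hDtop : Tendsto D atTop (𝓝 0)) (hDbot : Tendsto D atBot (𝓝 0)) :
    ∫ ω : ℝ, G (σ + ω * Complex.I) = ∫ ω : ℝ, G (ω * Complex.I) := by
  have hne : ∀ᵐ ω : ℝ, ω ≠ 0 := compl_mem_ae_iff.mpr (measure_singleton 0)
  have hcont : ∀ a : ℝ, 0 ≤ a → ContinuousOn (fun ω : ℝ => G (a + ω * Complex.I)) {0}ᶜ := by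
    intro a ha ω hω
    have h0 : ((a : ℂ) + ω * Complex.I) ≠ 0 := fun h => hω (by simpa using congrArg Complex.im h)
    exact (ContinuousAt.comp (f := fun ω : ℝ => (a : ℂ) + ω * Complex.I)
      (hG _ (by simpa using ha) h0).continuousAt (by fun_prop)).continuousWithinAt
  have hmeas : ∀ a : ℝ, 0 ≤ a → AEStronglyMeasurable (fun ω : ℝ => G (a + ω * Complex.I)) := by
    intro a ha
    have := (hcont a ha).aestronglyMeasurable (μ := volume) (measurableSet_singleton _).compl
    rwa [Measure.restrict_eq_self_of_ae_mem (s := {0}ᶜ) hne] at this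
  have hbd : ∀ a : ℝ, 0 ≤ a → a ≤ σ → ∀ᵐ ω : ℝ, ‖G (a + ω * Complex.I)‖ ≤ D ω := by
    intro a ha ha'
    filter_upwards [hne] with ω hω
    simpa using hD (a + ω * Complex.I) (by simpa using ha) (by simpa using ha') (by simpa using hω)
  have hint : ∀ a : ℝ, 0 ≤ a → a ≤ σ → Integrable fun ω : ℝ => G (a + ω * Complex.I) :=
    fun a ha ha' => hDi.mono' (hmeas a ha) (hbd a ha ha')
  have hshift : ∀ a : ℝ, 0 < a → a ≤ σ →
      ∫ ω : ℝ, G (σ + ω * Complex.I) = ∫ ω : ℝ, G (a + ω * Complex.I) := by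
    intro a ha ha'
    -- Cauchy's theorem on rectangles to the right of the imaginary axis; the horizontal sides
    -- vanish in the limit because `D` tends to `0`.
    have hrect : ∀ R : ℝ, (∫ x in a..σ, G (x + ((-R : ℝ) : ℂ) * Complex.I)) -
        (∫ x in a..σ, G (x + (R : ℂ) * Complex.I)) +
        Complex.I • (∫ y in (-R)..R, G (σ + y * Complex.I)) -
        Complex.I • (∫ y in (-R)..R, G (a + y * Complex.I)) = 0 := fun R => by
      have := Complex.integral_boundary_rect_eq_zero_of_differentiableOn G
        (a + ((-R : ℝ) : ℂ) * Complex.I) (σ + (R : ℂ) * Complex.I) (fun s hs => ?_)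
      · simpa using this
      · have hs1 := hs.1
        simp only [mem_preimage, Complex.add_re, Complex.ofReal_re, Complex.mul_re, Complex.I_re,
          mul_zero, Complex.ofReal_im, Complex.I_im, mul_one, sub_self, add_zero, uIcc_of_le ha']
          at hs1
        have hs2 : 0 < s.re := ha.trans_le hs1.1
        exact (hG s hs2.le (fun h => by simp [h] at hs2)).differentiableWithinAt
    have hhor : ∀ l : Filter ℝ, Tendsto D l (𝓝 0) → (∀ᶠ R in l, R ≠ 0) →
        Tendsto (fun R : ℝ => ∫ x in a..σ, G (x + (R : ℂ) * Complex.I)) l (𝓝 0) := by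
      intro l hl hl0
      have hl' : Tendsto (fun R => D R * |σ - a|) l (𝓝 0) := by simpa using hl.mul_const |σ - a|
      refine squeeze_zero_norm' ?_ hl'
      filter_upwards [hl0] with R hR
      refine intervalIntegral.norm_integral_le_of_norm_le_const fun x hx => ?_
      rw [uIoc_of_le ha'] at hx
      simpa using hD (x + (R : ℂ) * Complex.I) (by simpa using (ha.trans hx.1).le)
        (by simpa using hx.2) (by simpa using hR)
    have hver : ∀ b : ℝ, 0 ≤ b → b ≤ σ → Tendsto
        (fun R : ℝ => ∫ y in (-R)..R, G (b + y * Complex.I)) atTop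
        (𝓝 (∫ ω : ℝ, G (b + ω * Complex.I))) := fun b hb hb' =>
      intervalIntegral_tendsto_integral (hint b hb hb') tendsto_neg_atTop_atBot tendsto_id
    have h1 := hhor atTop hDtop (eventually_ne_atTop 0)
    have h2 := (hhor atBot hDbot (eventually_ne_atBot 0)).comp tendsto_neg_atTop_atBot
    have hlim := ((h2.sub h1).add ((hver σ hσ.le le_rfl).const_smul Complex.I)).sub
      ((hver a ha.le ha').const_smul Complex.I)
    have hzero := hlim.congr (f₂ := fun _ => (0 : V)) (fun R => hrect R)
    have h3 := tendsto_nhds_unique hzero tendsto_const_nhds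
    rw [sub_self, zero_add, ← smul_sub] at h3
    exact sub_eq_zero.mp ((smul_eq_zero.mp h3).resolve_left Complex.I_ne_zero)
  -- The line is moved onto the axis by dominated convergence; the possible singularity at the
  -- origin affects only `ω = 0`.
  have hlim : Tendsto (fun a : ℝ => ∫ ω : ℝ, G (a + ω * Complex.I)) (𝓝[>] 0)
      (𝓝 (∫ ω : ℝ, G (ω * Complex.I))) := by
    refine tendsto_integral_filter_of_dominated_convergence D ?_ ?_ hDi ?_
    · filter_upwards [self_mem_nhdsWithin] with a ha using hmeas a (le_of_lt ha)
    · filter_upwards [Ioo_mem_nhdsGT hσ] with a ha using hbd a ha.1.le ha.2.le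
    · filter_upwards [hne] with ω hω
      have h0 : (ω : ℂ) * Complex.I ≠ 0 := by simpa using hω
      have hc := (hG (ω * Complex.I) (by simp) h0).continuousAt
      have ht : Tendsto (fun a : ℝ => (a : ℂ) + ω * Complex.I) (𝓝[>] 0) (𝓝 (ω * Complex.I)) := by
        have : Continuous fun a : ℝ => (a : ℂ) + ω * Complex.I := by fun_prop
        simpa using (this.tendsto 0).mono_left nhdsWithin_le_nhds
      exact hc.tendsto.comp ht
  refine tendsto_nhds_unique (tendsto_const_nhds.congr' ?_) hlim
  filter_upwards [Ioo_mem_nhdsGT hσ] with a ha using hshift a ha.1 ha.2.le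

open scoped FourierTransform in
/-- A function tends to zero if its Laplace transform extends to the punctured closed right half
plane with an integrable bound. -/
lemma tendsto_zero_of_laplace [CompleteSpace V] {Z : ℝ → V} {F : ℂ → V} {D : ℝ → ℝ} {σ₀ M : ℝ}
    (hσ₀ : 0 < σ₀) (hZ : Continuous Z) (hZ0 : ∀ t ≤ 0, Z t = 0)
    (hZM : ∀ t, 0 ≤ t → ‖Z t‖ ≤ M * Real.exp (σ₀ * t))
    (hlap : ∀ s : ℂ, σ₀ < s.re → laplace Z s = F s)
    (hF : ∀ s : ℂ, 0 ≤ s.re → s ≠ 0 → DifferentiableAt ℂ F s)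
    (hD : ∀ s : ℂ, 0 ≤ s.re → s.im ≠ 0 → ‖F s‖ ≤ D s.im)
    (hDi : Integrable D) (hDtop : Tendsto D atTop (𝓝 0)) (hDbot : Tendsto D atBot (𝓝 0)) :
    Tendsto Z atTop (𝓝 0) := by
  set σ := σ₀ + 1
  have hσ : 0 < σ := by positivity
  let u : ℝ → V := fun t => Complex.exp (-(σ * t)) • Z t
  have hu : Continuous u := by fun_prop
  have hM0 : 0 ≤ M := by
    have := (norm_nonneg _).trans (hZM 0 le_rfl)
    simpa using this
  have huint : Integrable u := by
    have h1 : IntegrableOn u (Ioi 0) := by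
      have h2 : IntegrableOn (fun t : ℝ => M * Real.exp (-1 * t)) (Ioi 0) :=
        (integrableOn_exp_mul_Ioi (by norm_num) 0).const_mul M
      refine h2.mono' hu.aestronglyMeasurable ?_
      filter_upwards [ae_restrict_mem measurableSet_Ioi] with t ht
      rw [norm_smul, Complex.norm_exp]
      have h3 := mul_le_mul_of_nonneg_left (hZM t (le_of_lt ht)) (Real.exp_pos (-(σ * t))).le
      have h4 : Real.exp (-(σ * t)) * (M * Real.exp (σ₀ * t)) = M * Real.exp (-1 * t) := by
        rw [mul_left_comm, ← Real.exp_add]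
        congr 2
        simp only [σ]
        ring
      rw [h4] at h3
      simpa using h3
    have h2 : IntegrableOn u (Iic 0) :=
      integrableOn_zero.congr_fun (fun t ht => by simp [u, hZ0 t ht]) measurableSet_Iic
    rw [← integrableOn_univ, ← Iic_union_Ioi (a := (0 : ℝ))]
    exact h2.union h1
  have hfour : ∀ ξ : ℝ, 𝓕 u ξ = F (σ + (2 * Real.pi * ξ : ℝ) * Complex.I) := fun ξ => by
    rw [Real.fourier_real_eq_integral_exp_smul, ← hlap _ (by simp [σ]), laplace]
    rw [← integral_indicator measurableSet_Ioi]
    congr 1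
    ext t
    by_cases ht : t ∈ Ioi (0 : ℝ)
    · rw [indicator_of_mem ht]
      simp only [u, smul_smul, ← Complex.exp_add]
      congr 2
      push_cast
      ring
    · rw [indicator_of_notMem ht]
      simp [u, hZ0 t (not_lt.mp ht)]
  have h2pi : (2 * Real.pi) ≠ 0 := by positivity
  have hbd : ∀ a : ℝ, 0 ≤ a → ∀ᵐ ω : ℝ, ‖F (a + ω * Complex.I)‖ ≤ D ω := by
    intro a ha
    have hne : ∀ᵐ ω : ℝ, ω ≠ 0 := compl_mem_ae_iff.mpr (measure_singleton 0)
    filter_upwards [hne] with ω hω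
    simpa using hD (a + ω * Complex.I) (by simpa using ha) (by simpa using hω)
  have hFσc : Continuous fun ω : ℝ => F (σ + ω * Complex.I) := by
    refine continuous_iff_continuousAt.mpr fun ω => ?_
    refine ContinuousAt.comp (f := fun ω : ℝ => (σ : ℂ) + ω * Complex.I)
      (hF _ (by simpa using hσ.le) (fun h => ?_)).continuousAt (by fun_prop)
    have := congrArg Complex.re h
    simp at this
    exact hσ.ne' this
  have hFint : Integrable (𝓕 u) := by
    have h1 : Integrable fun ω : ℝ => F (σ + ω * Complex.I) :=
      hDi.mono' hFσc.aestronglyMeasurable (hbd σ hσ.le)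
    exact (h1.comp_mul_left' h2pi).congr (Eventually.of_forall fun ξ => (hfour ξ).symm)
  have hinv := hu.fourierInv_fourier_eq huint hFint
  -- Fourier inversion on the line of real part `σ` is shifted to the axis, where `e^(st)` has
  -- modulus one. Thus `Z` is itself a Fourier transform and the Riemann-Lebesgue lemma applies.
  have hrep : ∀ t, 0 ≤ t → Z t = 𝓕 (fun ξ : ℝ => F ((2 * Real.pi * ξ : ℝ) * Complex.I)) (-t) := by
    intro t ht
    have h1 : u t = ∫ ξ : ℝ, Complex.exp ((2 * Real.pi * ξ : ℝ) * Complex.I * t) •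
        F (σ + (2 * Real.pi * ξ : ℝ) * Complex.I) := by
      rw [← congrFun hinv t, Real.fourierInv_eq']
      congr 1
      ext ξ
      rw [hfour]
      congr 2
      simp
      ring
    let G : ℂ → V := fun s => Complex.exp (s * t) • F s
    have hvert := integral_vertical_eq (G := G) (D := fun ω => Real.exp (σ * t) * D ω) hσ
      (fun s hs hs0 => DifferentiableAt.smul (by fun_prop) (hF s hs hs0)) (fun s hs hs' him => by
        rw [norm_smul, Complex.norm_exp]
        refine mul_le_mul (Real.exp_le_exp.mpr ?_) (hD s hs him) (norm_nonneg _)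
          (Real.exp_pos _).le
        simp
        nlinarith)
      (hDi.const_mul _) (by simpa using hDtop.const_mul (Real.exp (σ * t)))
      (by simpa using hDbot.const_mul (Real.exp (σ * t)))
    have h2 := Measure.integral_comp_mul_left (fun ω : ℝ => G (σ + ω * Complex.I)) (2 * Real.pi)
    have h3 := Measure.integral_comp_mul_left (fun ω : ℝ => G (ω * Complex.I)) (2 * Real.pi)
    rw [hvert, ← h3] at h2
    have h4 : Z t = Complex.exp (σ * t) • u t := by
      simp only [u, smul_smul, ← Complex.exp_add]
      simp
    rw [h4, h1, ← integral_smul, Real.fourier_real_eq_integral_exp_smul]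
    have h5 : ∀ ξ : ℝ, Complex.exp (σ * t) • Complex.exp ((2 * Real.pi * ξ : ℝ) * Complex.I * t) •
        F (σ + (2 * Real.pi * ξ : ℝ) * Complex.I) =
        G (σ + (2 * Real.pi * ξ : ℝ) * Complex.I) := fun ξ => by
      simp only [G, smul_smul, ← Complex.exp_add]
      congr 2
      ring
    simp only [h5]
    rw [h2]
    congr 1
    ext ξ
    simp only [G]
    congr 2
    push_cast
    ring
  have hRL := (Real.zero_at_infty_fourier
    (fun ξ : ℝ => F ((2 * Real.pi * ξ : ℝ) * Complex.I))).comp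
    ((tendsto_neg_atTop_atBot (G := ℝ)).mono_right atBot_le_cocompact)
  refine hRL.congr' ?_
  filter_upwards [eventually_ge_atTop 0] with t ht using (hrep t ht).symm

end Inversion

end SFOS

/-! ### Decay of solutions when the spectrum avoids the sector -/

namespace SFOS

open MeasureTheory Set Filter Topology

section Decay

/-- Near infinity the resolvent is `O(1/|μ|)`, and on the bounded part of `S` it is continuous on a
compact set. -/
lemma exists_resolvent_bound {𝔸 : Type*} [NormedRing 𝔸] [NormedAlgebra ℂ 𝔸] [CompleteSpace 𝔸]
    (T : 𝔸) {S : Set ℂ} (hS : IsClosed S) (hT : S ⊆ resolventSet ℂ T) :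
    ∃ k : ℝ, 0 ≤ k ∧ ∀ μ ∈ S, ‖resolvent T μ‖ ≤ k / (1 + ‖μ‖) := by
  obtain ⟨C, hC⟩ := (spectrum.resolvent_isBigO_inv (𝕜 := ℂ) T).bound
  rw [(atTop_basis_Ioi (α := ℝ)).cobounded_of_norm.eventually_iff] at hC
  obtain ⟨r, -, hr⟩ := hC
  have hcomp : IsCompact (S ∩ Metric.closedBall 0 (max r 1)) :=
    (isCompact_closedBall _ _).inter_left hS
  have hcont : ContinuousOn (fun μ => (1 + ‖μ‖) * ‖resolvent T μ‖)
      (S ∩ Metric.closedBall 0 (max r 1)) := fun μ hμ =>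
    ((continuousAt_const.add continuousAt_id.norm).mul
      (spectrum.hasDerivAt_resolvent_const_left (hT hμ.1)).continuousAt.norm).continuousWithinAt
  obtain ⟨m, hm⟩ := hcomp.exists_bound_of_continuousOn hcont
  refine ⟨max m (2 * |C|), by positivity, fun μ hμ => ?_⟩
  have hpos : 0 < 1 + ‖μ‖ := by positivity
  rw [le_div_iff₀ hpos, mul_comm]
  by_cases h : ‖μ‖ ≤ max r 1
  · have := hm μ ⟨hμ, by simpa using h⟩
    rw [Real.norm_of_nonneg (by positivity)] at this
    exact this.trans (le_max_left _ _)
  · push Not at h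
    have h1 : 1 < ‖μ‖ := (le_max_right _ _).trans_lt h
    have h2 := hr (show μ ∈ _ from (le_max_left _ _).trans_lt h)
    rw [norm_inv] at h2
    refine le_trans ?_ (le_max_right _ _)
    have h3 : C * ‖μ‖⁻¹ ≤ |C| * ‖μ‖⁻¹ := by
      gcongr
      exact le_abs_self C
    calc (1 + ‖μ‖) * ‖resolvent T μ‖ ≤ (2 * ‖μ‖) * (|C| * ‖μ‖⁻¹) := by
          gcongr
          · linarith
          · exact h2.trans h3
      _ = 2 * |C| := by field_simp

/-- At the origin `|ω|^(α-2)` is integrable because `α > 1`, and at infinity the quotient is bounded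
by `ω^(-2)`. -/
lemma integrable_rpow_div {α : ℝ} (h₁ : 1 < α) (h₂ : α < 2) :
    Integrable fun ω : ℝ => |ω| ^ (α - 2) / (1 + |ω| ^ α) := by
  set f : ℝ → ℝ := fun ω => |ω| ^ (α - 2) / (1 + |ω| ^ α) with hf
  have hfm : Measurable f := (measurable_id.abs.pow_const _).div
    (measurable_const.add (measurable_id.abs.pow_const _))
  have hf0 : ∀ ω, 0 ≤ f ω := fun ω => by positivity
  have h1 : IntegrableOn f (Ioc 0 1) := by
    have h := (intervalIntegrable_iff_integrableOn_Ioc_of_le zero_le_one).mp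
      (intervalIntegral.intervalIntegrable_rpow' (a := 0) (b := 1) (r := α - 2) (by linarith))
    refine h.mono' hfm.aestronglyMeasurable ?_
    filter_upwards [ae_restrict_mem measurableSet_Ioc] with ω hω
    rw [Real.norm_of_nonneg (hf0 ω), hf]
    simp only [abs_of_pos hω.1]
    refine div_le_self (Real.rpow_nonneg hω.1.le _) ?_
    have := Real.rpow_nonneg hω.1.le α
    linarith
  have h2 : IntegrableOn f (Ioi 1) := by
    refine (integrableOn_Ioi_rpow_of_lt (by norm_num : (-2 : ℝ) < -1) one_pos).mono'
      hfm.aestronglyMeasurable ?_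
    filter_upwards [ae_restrict_mem measurableSet_Ioi] with ω hω
    have hω : 0 < ω := one_pos.trans hω
    rw [Real.norm_of_nonneg (hf0 ω), hf]
    simp only [abs_of_pos hω]
    have hp := Real.rpow_pos_of_pos hω α
    rw [div_le_iff₀ (by positivity)]
    have e : ω ^ (-2 : ℝ) * ω ^ α = ω ^ (α - 2) := by
      rw [← Real.rpow_add hω]
      congr 1
      ring
    have := Real.rpow_nonneg hω.le (-2)
    linarith
  have h3 : IntegrableOn f (Ioi 0) := by
    rw [← Ioc_union_Ioi_eq_Ioi (zero_le_one' ℝ)]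
    exact h1.union h2
  have h4 : Integrable ((Ioi 0).indicator f) := (integrable_indicator_iff measurableSet_Ioi).mpr h3
  refine (h4.add h4.comp_neg).congr (Eventually.of_forall fun ω => ?_)
  rcases lt_trichotomy ω 0 with h | rfl | h
  · simp [indicator, h, h.le, hf]
  · have : (0 : ℝ) ^ (α - 2) = 0 := Real.zero_rpow (by linarith)
    simp [hf, this]
  · simp [indicator, h, h.le, hf]

lemma tendsto_rpow_div_zero {α : ℝ} (h₂ : α < 2) :
    Tendsto (fun ω : ℝ => |ω| ^ (α - 2) / (1 + |ω| ^ α)) (cocompact ℝ) (𝓝 0) := by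
  have h1 : Tendsto (fun u : ℝ => u ^ (α - 2)) atTop (𝓝 0) := by
    have := tendsto_rpow_neg_atTop (y := 2 - α) (by linarith)
    simpa using this
  have h2 : Tendsto (fun ω : ℝ => |ω| ^ (α - 2)) (cocompact ℝ) (𝓝 0) :=
    h1.comp (tendsto_norm_cocompact_atTop (E := ℝ))
  refine squeeze_zero (fun ω => by positivity) (fun ω => ?_) h2
  refine div_le_self (by positivity) ?_
  have : 0 ≤ |ω| ^ α := by positivity
  linarith

lemma isClosed_sector (α : ℝ) : IsClosed (sector α) := by
  have h1 : Continuous fun μ : ℂ => Real.sin (Real.pi / 2 * α) * μ.re -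
      Real.cos (Real.pi / 2 * α) * μ.im := by fun_prop
  have h2 : Continuous fun μ : ℂ => Real.sin (Real.pi / 2 * α) * μ.re +
      Real.cos (Real.pi / 2 * α) * μ.im := by fun_prop
  exact (isClosed_le continuous_const h1).union (isClosed_le continuous_const h2)

variable {V : Type*} [NormedAddCommGroup V] [NormedSpace ℂ V]

/-- Solutions of `x = x₀ + t x₁ + I^α T x` tend to zero when the spectrum of `T` avoids the
sector. -/
lemma tendsto_zero_of_volterra [CompleteSpace V] {α : ℝ} (h₁ : 1 < α) (h₂ : α < 2) (T : V →L[ℂ] V)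
    (hT : sector α ⊆ resolventSet ℂ T) {x : ℝ → V} (hx : ContinuousOn x (Ici 0)) (x₀ x₁ : V)
    (heq : ∀ t, 0 ≤ t → x t = (x₀ + t • x₁) + rlInt α (fun τ => T (x τ)) t) :
    Tendsto x atTop (𝓝 0) := by
  have hα0 : 0 < α := by linarith
  have hx0 : x 0 = x₀ := by simpa [rlInt_zero_right] using heq 0 le_rfl
  obtain ⟨σ', hσ', hw⟩ := exists_weight hα0 ‖T.restrictScalars ℝ‖
  set σ := max σ' 1
  have hσ1 : 1 ≤ σ := le_max_right _ _
  have hσ : 0 < σ := by linarith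
  have hexp1 : ∀ t, 0 ≤ t → 1 ≤ Real.exp (σ * t) := fun t ht =>
    Real.one_le_exp (by positivity)
  have hgrow : ∀ t, 0 ≤ t → ‖x t‖ ≤ 2 * (‖x₀‖ + ‖x₁‖) * Real.exp (σ * t) := by
    refine norm_le_of_volterra (L := T.restrictScalars ℝ) hα0 hσ (hw σ (le_max_left _ _)) hx
      (fun t ht => ?_) heq
    have h1 : t ≤ Real.exp (σ * t) := by
      have := Real.add_one_le_exp (σ * t)
      nlinarith
    have h2 : ‖x₀ + t • x₁‖ ≤ ‖x₀‖ + t * ‖x₁‖ := by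
      refine (norm_add_le _ _).trans_eq ?_
      rw [norm_smul, Real.norm_of_nonneg ht]
    have h3 := mul_le_mul_of_nonneg_right h1 (norm_nonneg x₁)
    have h4 := mul_le_mul_of_nonneg_right (hexp1 t ht) (norm_nonneg x₀)
    linarith
  have hint : ∀ s : ℂ, σ < s.re →
      IntegrableOn (fun t : ℝ => Complex.exp (-(s * t)) • x t) (Ioi 0) := by
    intro s hs
    have h1 : IntegrableOn (fun t : ℝ => 2 * (‖x₀‖ + ‖x₁‖) * Real.exp (-(s.re - σ) * t)) (Ioi 0) :=
      (integrableOn_exp_mul_Ioi (by linarith) 0).const_mul _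
    refine h1.mono' (ContinuousOn.aestronglyMeasurable ?_ measurableSet_Ioi) ?_
    · exact ContinuousOn.smul (by fun_prop) (hx.mono Ioi_subset_Ici_self)
    · filter_upwards [ae_restrict_mem measurableSet_Ioi] with t ht
      rw [norm_smul, Complex.norm_exp]
      have h3 := mul_le_mul_of_nonneg_left (hgrow t (le_of_lt ht)) (Real.exp_pos (-(s.re * t))).le
      have h4 : Real.exp (-(s.re * t)) * (2 * (‖x₀‖ + ‖x₁‖) * Real.exp (σ * t)) =
          2 * (‖x₀‖ + ‖x₁‖) * Real.exp (-(s.re - σ) * t) := by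
        rw [mul_left_comm, ← Real.exp_add]
        congr 2
        ring
      rw [h4] at h3
      simpa using h3
  have hlapx : ∀ s : ℂ, σ < s.re → laplace x s =
      s⁻¹ • x₀ + (s ^ (2 : ℂ))⁻¹ • x₁ + (s ^ (α : ℂ))⁻¹ • T (laplace x s) := by
    intro s hs
    have hs0 : 0 < s.re := hσ.trans hs
    have hTi : IntegrableOn (fun t : ℝ => Complex.exp (-(s * t)) • T (x t)) (Ioi 0) := by
      have := T.integrable_comp (hint s hs)
      simp only [map_smul] at this
      exact this
    have hTl : laplace (fun t => T (x t)) s = T (laplace x s) := by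
      rw [laplace, laplace, ← T.integral_comp_comm (hint s hs)]
      simp only [map_smul]
    obtain ⟨ha1, ha2⟩ := laplace_one hs0
    obtain ⟨hb1, hb2⟩ := laplace_ofReal hs0
    have ha := ha1.smul_const x₀
    have hb := hb1.smul_const x₁
    have hab : Integrable (fun t : ℝ => (Complex.exp (-(s * t)) • (1 : ℂ)) • x₀ +
        (Complex.exp (-(s * t)) • (t : ℂ)) • x₁) (volume.restrict (Ioi 0)) := ha.add hb
    have hsplit : ∀ t ∈ Ioi (0 : ℝ), Complex.exp (-(s * t)) • x t =
        (Complex.exp (-(s * t)) • (1 : ℂ)) • x₀ + (Complex.exp (-(s * t)) • (t : ℂ)) • x₁ +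
        Complex.exp (-(s * t)) • rlInt α (fun τ => T (x τ)) t := fun t ht => by
      nth_rewrite 1 [heq t (le_of_lt ht)]
      simp only [smul_add, smul_eq_mul, mul_one, mul_smul, Complex.coe_smul]
    have hc : IntegrableOn (fun t : ℝ => Complex.exp (-(s * t)) • rlInt α (fun τ => T (x τ)) t)
        (Ioi 0) := by
      refine (((hint s hs).sub ha).sub hb).congr_fun (fun t ht => ?_) measurableSet_Ioi
      simp only [Pi.sub_apply]
      rw [hsplit t ht]
      abel
    rw [← hTl, ← laplace_rlInt hα0 hs0 hTi, ← ha2, ← hb2]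
    simp only [laplace]
    rw [← integral_smul_const, ← integral_smul_const, ← integral_add ha hb,
      ← integral_add hab hc]
    exact setIntegral_congr_fun measurableSet_Ioi hsplit
  -- Subtracting `e^(-t) x₀` makes the function start at `0`, so that its extension by zero is
  -- continuous, and removes the term `x₀ / s` that would spoil integrability of the transform at
  -- infinity.
  let Z : ℝ → V := fun t => x (max t 0) - Real.exp (-(max t 0)) • x₀
  have hZp : ∀ t, 0 ≤ t → Z t = x t - Real.exp (-t) • x₀ := fun t ht => by
    simp only [Z, max_eq_left ht]
  have hZc : Continuous Z := by
    refine Continuous.sub ?_ (by fun_prop)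
    exact hx.comp_continuous (by fun_prop) fun t => mem_Ici.mpr (le_max_right _ _)
  let F : ℂ → V := fun s => resolvent T (s ^ (α : ℂ))
    (s ^ ((α - 2 : ℝ) : ℂ) • x₁ + (s + 1)⁻¹ • (s ^ ((α - 1 : ℝ) : ℂ) • x₀ + T x₀))
  have hres : ∀ s : ℂ, 0 ≤ s.re → s ^ (α : ℂ) ∈ resolventSet ℂ T := fun s hs =>
    hT (cpow_mem_sector h₁ h₂ hs)
  have hs1 : ∀ s : ℂ, 0 ≤ s.re → s + 1 ≠ 0 := fun s hs h => by
    have := congrArg Complex.re h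
    simp at this
    linarith
  have hlapZ : ∀ s : ℂ, σ < s.re → laplace Z s = F s := by
    intro s hs
    have hs0 : 0 < s.re := hσ.trans hs
    have hne : s ≠ 0 := fun h => by simp [h] at hs0
    obtain ⟨he1, he2⟩ := laplace_one (s := s + 1) (by simp; linarith)
    have he := he1.smul_const x₀
    have hZl : laplace Z s = laplace x s - (s + 1)⁻¹ • x₀ := by
      rw [← he2, laplace, laplace, laplace, ← integral_smul_const, ← integral_sub (hint s hs) he]
      refine setIntegral_congr_fun measurableSet_Ioi fun t ht => ?_
      rw [hZp t (le_of_lt ht), smul_sub, smul_eq_mul, mul_one, ← Complex.coe_smul, smul_smul,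
        Complex.ofReal_exp, ← Complex.exp_add]
      congr 3
      push_cast
      ring
    have hX := hlapx s hs
    set X := laplace x s
    have hpow : s ^ (α : ℂ) ≠ 0 := by simp [Complex.cpow_eq_zero_iff, hne]
    have e1 : s ^ (α : ℂ) * s⁻¹ = s ^ ((α - 1 : ℝ) : ℂ) := by
      push_cast
      rw [Complex.cpow_sub _ _ hne, Complex.cpow_one, div_eq_mul_inv]
    have e2 : s ^ (α : ℂ) * (s ^ (2 : ℂ))⁻¹ = s ^ ((α - 2 : ℝ) : ℂ) := by
      push_cast
      rw [Complex.cpow_sub _ _ hne, div_eq_mul_inv]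
    have hX' : s ^ (α : ℂ) • X - T X = s ^ ((α - 1 : ℝ) : ℂ) • x₀ + s ^ ((α - 2 : ℝ) : ℂ) • x₁ := by
      have := congrArg (s ^ (α : ℂ) • ·) hX
      simp only [smul_add, smul_smul, e1, e2, mul_inv_cancel₀ hpow, one_smul] at this
      rw [this]
      abel
    have hb : (algebraMap ℂ (V →L[ℂ] V) (s ^ (α : ℂ)) - T) (X - (s + 1)⁻¹ • x₀) =
        s ^ ((α - 2 : ℝ) : ℂ) • x₁ + (s + 1)⁻¹ • (s ^ ((α - 1 : ℝ) : ℂ) • x₀ + T x₀) := by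
      have e3 : (s + 1)⁻¹ * s ^ (α : ℂ) =
          s ^ ((α - 1 : ℝ) : ℂ) - (s + 1)⁻¹ * s ^ ((α - 1 : ℝ) : ℂ) := by
        rw [← e1]
        have := hs1 s hs0.le
        field_simp
        ring
      have : (algebraMap ℂ (V →L[ℂ] V) (s ^ (α : ℂ)) - T) (X - (s + 1)⁻¹ • x₀) =
          (s ^ (α : ℂ) • X - T X) - ((s + 1)⁻¹ * s ^ (α : ℂ)) • x₀ + (s + 1)⁻¹ • T x₀ := by
        rw [Algebra.algebraMap_eq_smul_one]
        simp only [_root_.sub_apply, _root_.smul_apply,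
          one_apply_eq_self, map_sub, map_smul, smul_sub, smul_smul]
        rw [mul_comm (s + 1)⁻¹]
        abel
      rw [this, hX', e3, sub_smul, smul_add, mul_smul]
      abel
    have hinv : resolvent T (s ^ (α : ℂ)) * (algebraMap ℂ (V →L[ℂ] V) (s ^ (α : ℂ)) - T) = 1 :=
      Ring.inverse_mul_cancel _ (hres s hs0.le)
    rw [hZl]
    simp only [F]
    rw [← hb, ← mul_apply_eq_comp, hinv, one_apply_eq_self]
  obtain ⟨k, hk0, hk⟩ := exists_resolvent_bound T (isClosed_sector α) hT
  set K := k * (‖x₁‖ + ‖x₀‖ + ‖T x₀‖)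
  have hcoc := (tendsto_rpow_div_zero h₂).const_mul K
  rw [mul_zero] at hcoc
  have hZlim : Tendsto Z atTop (𝓝 0) := by
    refine tendsto_zero_of_laplace (σ₀ := σ) (M := 2 * (‖x₀‖ + ‖x₁‖) + ‖x₀‖) (F := F)
      (D := fun ω => K * (|ω| ^ (α - 2) / (1 + |ω| ^ α))) hσ hZc (fun t ht => ?_) (fun t ht => ?_)
      hlapZ (fun s hs hs0 => ?_) (fun s hs him => ?_) ((integrable_rpow_div h₁ h₂).const_mul K)
      (hcoc.mono_left atTop_le_cocompact) (hcoc.mono_left atBot_le_cocompact)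
    · simp [Z, max_eq_right ht, hx0]
    · rw [hZp t ht]
      refine (norm_sub_le _ _).trans ?_
      rw [norm_smul, Real.norm_of_nonneg (Real.exp_pos _).le, add_mul]
      have h1 : Real.exp (-t) ≤ Real.exp (σ * t) := Real.exp_le_exp.mpr (by nlinarith)
      have h2 := mul_le_mul_of_nonneg_right h1 (norm_nonneg x₀)
      have := hgrow t ht
      linarith
    · have hslit : s ∈ Complex.slitPlane := by
        rcases hs.lt_or_eq with h | h
        · exact Or.inl h
        · exact Or.inr fun him => hs0 (Complex.ext h.symm him)
      have hd : ∀ c : ℂ, DifferentiableAt ℂ (fun z : ℂ => z ^ c) s := fun c =>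
        differentiableAt_id.cpow_const hslit
      have hr : DifferentiableAt ℂ (fun z : ℂ => resolvent T (z ^ (α : ℂ))) s :=
        DifferentiableAt.comp (g := resolvent T) s
          (spectrum.hasDerivAt_resolvent_const_left (hres s hs)).differentiableAt (hd α)
      refine hr.clm_apply (((hd _).smul_const _).add ?_)
      refine DifferentiableAt.smul ?_ (((hd _).smul_const _).add_const _)
      exact (differentiableAt_id.add_const 1).inv (hs1 s hs)
    · have hs0 : s ≠ 0 := fun h => him (by simp [h])
      have hpos : 0 < ‖s‖ := norm_pos_iff.mpr hs0
      have him' : 0 < |s.im| := abs_pos.mpr him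
      have hle : |s.im| ≤ ‖s‖ := Complex.abs_im_le_norm s
      have hR : ‖resolvent T (s ^ (α : ℂ))‖ ≤ k / (1 + ‖s‖ ^ α) := by
        have := hk _ (cpow_mem_sector h₁ h₂ hs)
        rwa [Complex.norm_cpow_real] at this
      have hn1 : 1 ≤ ‖s + 1‖ := by
        have := (Complex.abs_re_le_norm (s + 1))
        rw [Complex.add_re, Complex.one_re, abs_of_nonneg (by linarith)] at this
        linarith
      have hns : ‖s‖ ≤ ‖s + 1‖ := by
        refine abs_le_of_sq_le_sq' ?_ (norm_nonneg _) |>.2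
        rw [Complex.sq_norm, Complex.sq_norm, Complex.normSq_apply, Complex.normSq_apply]
        simp
        nlinarith
      have hb1 : ‖s + 1‖⁻¹ * ‖s‖ ^ (α - 1) ≤ ‖s‖ ^ (α - 2) := by
        rw [inv_mul_le_iff₀ (by linarith)]
        have e : ‖s‖ ^ (α - 1) = ‖s‖ * ‖s‖ ^ (α - 2) := by
          rw [show α - 1 = 1 + (α - 2) by ring, Real.rpow_add hpos, Real.rpow_one]
        rw [e]
        exact mul_le_mul_of_nonneg_right hns (Real.rpow_nonneg hpos.le _)
      -- The exponent `2 - α` lies in `(0, 1)`, so `‖s‖^(2-α)` is at most `1` or at most `‖s‖`, and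
      -- both are bounded by `‖s + 1‖`.
      have hb2 : ‖s + 1‖⁻¹ ≤ ‖s‖ ^ (α - 2) := by
        rw [inv_le_comm₀ (by linarith) (Real.rpow_pos_of_pos hpos _), ← Real.rpow_neg hpos.le]
        rcases le_total ‖s‖ 1 with h | h
        · exact (Real.rpow_le_one hpos.le h (by linarith)).trans hn1
        · calc ‖s‖ ^ (-(α - 2)) ≤ ‖s‖ ^ (1 : ℝ) :=
              Real.rpow_le_rpow_of_exponent_le h (by linarith)
            _ ≤ ‖s + 1‖ := by rwa [Real.rpow_one]
      have hbr : ‖s ^ ((α - 2 : ℝ) : ℂ) • x₁ +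
          (s + 1)⁻¹ • (s ^ ((α - 1 : ℝ) : ℂ) • x₀ + T x₀)‖ ≤
          ‖s‖ ^ (α - 2) * (‖x₁‖ + ‖x₀‖ + ‖T x₀‖) := by
        have t1 : ‖(s + 1)⁻¹ • (s ^ ((α - 1 : ℝ) : ℂ) • x₀ + T x₀)‖ ≤
            ‖s + 1‖⁻¹ * ‖s‖ ^ (α - 1) * ‖x₀‖ + ‖s + 1‖⁻¹ * ‖T x₀‖ := by
          rw [norm_smul, norm_inv, mul_assoc, ← mul_add]
          refine mul_le_mul_of_nonneg_left ((norm_add_le _ _).trans_eq ?_) (by positivity)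
          rw [norm_smul, Complex.norm_cpow_real]
        have t2 := mul_le_mul_of_nonneg_right hb1 (norm_nonneg x₀)
        have t3 := mul_le_mul_of_nonneg_right hb2 (norm_nonneg (T x₀))
        refine (norm_add_le _ _).trans ?_
        rw [norm_smul, Complex.norm_cpow_real]
        linarith
      have hmono1 : ‖s‖ ^ (α - 2) ≤ |s.im| ^ (α - 2) :=
        Real.rpow_le_rpow_of_nonpos him' hle (by linarith)
      have hmono2 : |s.im| ^ α ≤ ‖s‖ ^ α := Real.rpow_le_rpow him'.le hle hα0.le
      have hfin : k / (1 + ‖s‖ ^ α) * (‖s‖ ^ (α - 2) * (‖x₁‖ + ‖x₀‖ + ‖T x₀‖)) ≤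
          k / (1 + |s.im| ^ α) * (|s.im| ^ (α - 2) * (‖x₁‖ + ‖x₀‖ + ‖T x₀‖)) := by
        gcongr
      calc ‖F s‖ ≤ _ := ContinuousLinearMap.le_opNorm _ _
        _ ≤ _ := mul_le_mul hR hbr (norm_nonneg _) (by positivity)
        _ ≤ _ := hfin
        _ = _ := by ring
  have hexp : Tendsto (fun t : ℝ => Real.exp (-t) • x₀) atTop (𝓝 0) := by
    simpa using (Real.tendsto_exp_neg_atTop_nhds_zero).smul_const x₀
  have hsum := hZlim.add hexp
  rw [add_zero] at hsum
  refine hsum.congr' ?_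
  filter_upwards [eventually_ge_atTop 0] with t ht
  rw [hZp t ht, sub_add_cancel]

end Decay

section Stability

variable {n : ℕ} {E A K B J : Matrix (Fin n) (Fin n) ℝ} {α : ℝ}

open Matrix in
-- The complexified solution satisfies the Volterra equation of `C`, whose spectrum avoids the
-- sector by `IsGroupDecomposition.det_ne_zero`.
lemma IsGroupDecomposition.stable (d : IsGroupDecomposition E A K B J)
    (h : SpectrallyAdmissible E A α) (h₁ : 1 < α) (h₂ : α < 2) : Stable E A α := by
  intro _ _ x hx _
  have heq := d.solution_eq_volterra h₁ h₂ hx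
  set C := B - (1 - J) with hC
  let T : (Fin n → ℂ) →L[ℂ] (Fin n → ℂ) :=
    (C.map ((↑) : ℝ → ℂ)).mulVecLin.toContinuousLinearMap
  let ι : (Fin n → ℝ) →L[ℝ] (Fin n → ℂ) :=
    ContinuousLinearMap.pi fun i => Complex.ofRealCLM.comp (ContinuousLinearMap.proj i)
  have hι : ∀ v i, ι v i = (v i : ℂ) := fun v i => rfl
  have hTι : ∀ v, T (ι v) = ι (C *ᵥ v) := fun v => by
    ext i
    change (C.map ((↑) : ℝ → ℂ) *ᵥ ι v) i = ((C *ᵥ v) i : ℂ)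
    simp [mulVec, dotProduct, hι]
  have hT : sector α ⊆ resolventSet ℂ T := by
    intro μ hμ
    have hdet := d.det_ne_zero h h₁ h₂ μ hμ
    set M : Matrix (Fin n) (Fin n) ℂ := μ • 1 - C.map ((↑) : ℝ → ℂ) with hM
    have hu : IsUnit M.det := isUnit_iff_ne_zero.mpr hdet
    have hMT : ∀ v, (algebraMap ℂ ((Fin n → ℂ) →L[ℂ] (Fin n → ℂ)) μ - T) v = M *ᵥ v := fun v => by
      rw [Algebra.algebraMap_eq_smul_one, hM, sub_mulVec, smul_mulVec, one_mulVec]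
      rfl
    refine spectrum.mem_resolventSet_of_left_right_inverse
      (b := M⁻¹.mulVecLin.toContinuousLinearMap) (c := M⁻¹.mulVecLin.toContinuousLinearMap) ?_ ?_
    · ext1 v
      rw [mul_apply_eq_comp, hMT]
      change M *ᵥ M⁻¹ *ᵥ v = v
      rw [mulVec_mulVec, mul_nonsing_inv M hu, one_mulVec]
    · ext1 v
      rw [mul_apply_eq_comp, hMT]
      change M⁻¹ *ᵥ M *ᵥ v = v
      rw [mulVec_mulVec, nonsing_inv_mul M hu, one_mulVec]
  have hxc := hx.contDiffOn_one.continuousOn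
  have hlim := tendsto_zero_of_volterra h₁ h₂ T hT (x := fun t => ι (x t))
    (ι.continuous.comp_continuousOn hxc) (ι (x 0)) (ι (derivWithin x (Ici 0) 0)) (fun t ht => by
      rcases ht.eq_or_lt with rfl | ht
      · simp [rlInt_zero_right]
      have hi : RLIntegrable α (fun τ => mulVecCLM C (x τ)) t := by
        refine rlIntegrable_of_integrableOn h₁.le ht.le ?_
        exact (((mulVecCLM C).continuous.comp_continuousOn hxc).mono
          Icc_subset_Ici_self).integrableOn_Icc.mono_set Ioc_subset_Icc_self
      have h1 := rlInt_clm ι hi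
      simp only [mulVecCLM_apply] at h1
      simp only [hTι, h1]
      nth_rewrite 1 [heq t ht.le]
      simp [map_add, map_smul])
  rw [← tendsto_zero_iff_norm_tendsto_zero, tendsto_pi_nhds]
  intro i
  have := (Complex.continuous_re.tendsto 0).comp ((tendsto_pi_nhds.mp hlim) i)
  simpa [Function.comp_def, hι] using this

end Stability

end SFOS

theorem mainTheorem1 (n r : ℕ) (E A : Matrix (Fin n) (Fin n) ℝ) (α : ℝ)
    (hα₁ : 1 < α) (hα₂ : α < 2) (hr : E.rank = r)
    (E₀ : Matrix (Fin n) (Fin (n - r)) ℝ) (hE₀ : E₀.rank = n - r)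
    (hEE₀ : E.transpose * E₀ = 0) :
    List.TFAE [
      SFOS.Admissible E A α,
      ∃ (P : Matrix (Fin n) (Fin n) ℝ) (Q : Matrix (Fin (n - r)) (Fin n) ℝ),
        P.PosDef ∧
        SFOS.NegDef (SFOS.sym (SFOS.theta α ⊗ₖ (E.transpose * P * A) +
          (1 : Matrix (Fin 2) (Fin 2) ℝ) ⊗ₖ (Q.transpose * E₀.transpose * A))),
      ∃ P : Matrix (Fin n) (Fin n) ℝ,
        SFOS.NegDef (SFOS.sym (SFOS.theta α ⊗ₖ (P * A))) ∧
        P * E = E.transpose * P.transpose ∧ (P * E).PosSemidef,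
      ∃ P Q : Matrix (Fin n) (Fin n) ℝ,
        P.PosDef ∧ Q.IsSymm ∧
        SFOS.NegDef (SFOS.sym (SFOS.theta α ⊗ₖ (E.transpose * P * A)) +
          (1 : Matrix (Fin 2) (Fin 2) ℝ) ⊗ₖ (A.transpose * Q * A)) ∧
        (E.transpose * Q * E).PosSemidef] := by
  -- Regularity and freedom from impulses account for the index; stability alone accounts for the
  -- sector.
  have h1 : SFOS.Admissible E A α ↔ SFOS.SpectrallyAdmissible E A α := by
    refine ⟨fun ⟨hR, hI, hS⟩ => ⟨SFOS.index_le_one_of_regular_impulseFree hα₁ hR hI,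
      SFOS.Stable.det_ne_zero hα₁ hα₂ hS⟩, fun h => ?_⟩
    obtain ⟨K, B, J, d⟩ := h.exists_isGroupDecomposition
    exact ⟨d.regular hα₁ hα₂, d.impulseFree hα₁, d.stable h hα₁ hα₂⟩
  tfae_have 1 → 2 := fun h => ((h1.mp h).lmis hα₁ hα₂ hr E₀ hE₀ hEE₀).1
  tfae_have 1 → 3 := fun h => ((h1.mp h).lmis hα₁ hα₂ hr E₀ hE₀ hEE₀).2.1
  tfae_have 1 → 4 := fun h => ((h1.mp h).lmis hα₁ hα₂ hr E₀ hE₀ hEE₀).2.2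
  tfae_have 2 → 1 := fun ⟨_, _, hP, h⟩ =>
    h1.mpr (SFOS.spectrallyAdmissible_of_lmi_two hEE₀ hP h)
  tfae_have 3 → 1 := fun ⟨_, h, _, hPE⟩ =>
    h1.mpr (SFOS.spectrallyAdmissible_of_lmi_three h hPE)
  tfae_have 4 → 1 := fun ⟨_, _, hP, hQ, h, hEQ⟩ =>
    h1.mpr (SFOS.spectrallyAdmissible_of_lmi_four hP hQ h hEQ)
  tfae_finish
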